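/- Let $G$ be an abelian group (finite or infinite) and let $S$ be a finite generating subset of $G$ with $0\in S$. For a finite set $X\subset G$ put $\partial_S(X)=(X+S)\setminus X$ and $X^S=G\setminus (X+S)$. For an integer $k\ge 1$ with $|G|\ge 2k-1$ let $$\kappa_k(S)=\min\{|\partial_S(X)| : X\subset G \text{ finite},\ |X|\ge k,\ |X^S|\ge k\},$$ where $\min\emptyset=|G|-2k+1$. A finite set $X$ with $|X|\ge k$, $|X^S|\ge k$ and $|\partial_S(X)|=\kappa_k(S)$ is called a $k$-fragment of $S$. The set $S$ is called degenerate if some subgroup of $G$ is a $2$-fragment of $S$, and non-degenerate otherwise. For $r\in G$ and an integer $j\ge 0$, a set is called an $(r,-j)$-progression if it is obtained by deleting exactly $j$ elements from a set of the form $\{a,a+r,\dots,a+nr\}$ with $a\in G$ and $n\ge 0$. Theorem. Let $\mu\in\{0,1\}$, and let $S$ be a finite generating subset of an abelian group $G$ such that $0\in S$ and $3\le |S|\le \frac{|G|+5\mu-4}{2}$ (the upper bound being vacuous if $G$ is infinite). Assume that $\kappa_{3-\mu}(S)\le |S|-\mu$ and, in the case where $|S|=3$ and $\mu=0$, assume moreover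 that $\kappa_4(S)\le |S|$. If $S$ is non-degenerate, then there is an $r\in G$ such that $S$ is an $(r,\mu-1)$-progression; that is, $S$ is an arithmetic progression if $\mu=1$, and $S$ is obtained from an arithmetic progression by deleting one element if $\mu=0$. -/

import Mathlib

open scoped Pointwise

/-- The boundary `∂_S(X) = (X + S) \ X`. -/
def addBoundary {G : Type*} [AddCommGroup G] [DecidableEq G] (S X : Finset G) : Finset G :=
  (X + S) \ X

/-- The exterior `X^S = G \ (X + S)`; it may be infinite. -/
def addExterior {G : Type*} [AddCommGroup G] [DecidableEq G] (S X : Finset G) : Set G :=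
  {g : G | g ∉ X + S}

/-- `X` is a finite set with `|X| ≥ k` and `|X^S| ≥ k`. -/
def IsKSeparating {G : Type*} [AddCommGroup G] [DecidableEq G] (k : ℕ) (S X : Finset G) : Prop :=
  k ≤ X.card ∧ (k : ℕ∞) ≤ (addExterior S X).encard

open Classical in
/-- The `k`-th connectivity `κ_k(S)` of a finite set `S`: the minimum of `|∂_S(X)|` over the finite
sets `X` with `|X| ≥ k` and `|X^S| ≥ k`, and `|G| - 2k + 1` if there is no such `X`.
It is meant for `|G| ≥ 2k - 1`. Since `S` is finite, the second case only
occurs for finite `G`, and then the subtraction is not truncated. -/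
noncomputable def connectivity {G : Type*} [AddCommGroup G] [DecidableEq G]
    (k : ℕ) (S : Finset G) : ℕ :=
  if ∃ X : Finset G, IsKSeparating k S X then
    sInf {m : ℕ | ∃ X : Finset G, IsKSeparating k S X ∧ (addBoundary S X).card = m}
  else Nat.card G + 1 - 2 * k

/-- `X` is a `k`-fragment of `S`. -/
def IsKFragment {G : Type*} [AddCommGroup G] [DecidableEq G] (k : ℕ) (S X : Finset G) : Prop :=
  IsKSeparating k S X ∧ (addBoundary S X).card = connectivity k S

/-- `S` is degenerate: some (finite) subgroup is a `2`-fragment of `S`. -/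
def IsDegenerate {G : Type*} [AddCommGroup G] [DecidableEq G] (S : Finset G) : Prop :=
  ∃ (H : AddSubgroup G) (X : Finset G), (X : Set G) = (H : Set G) ∧ IsKFragment 2 S X

/-- `P = {a, a + r, …, a + n r}` for some `a` and some `n ≥ 0`: an arithmetic progression
with difference `r`. -/
def IsAddProgression {G : Type*} [AddCommGroup G] [DecidableEq G] (r : G) (P : Finset G) : Prop :=
  ∃ (a : G) (n : ℕ), P = (Finset.range (n + 1)).image (fun i : ℕ => a + i • r)

/-- `S` is an `(r, -j)`-progression: it is obtained from an arithmetic progression with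
difference `r` by deleting `j` elements. -/
def IsNearProgression {G : Type*} [AddCommGroup G] [DecidableEq G]
    (r : G) (j : ℕ) (S : Finset G) : Prop :=
  ∃ P D : Finset G, IsAddProgression r P ∧ D ⊆ P ∧ D.card = j ∧ S = P \ D

/-!
The proof is isoperimetric. For a finite set `S` the function `X ↦ |X + S| - |X|` is submodular
and invariant under translations; a `k`-atom is a smallest minimiser of it among the sets `X` such
that `X` and the exterior of `X + S` have at least `k` elements. By submodularity an atom meets
its other translates in fewer than `k` elements, unless it is periodic, and a periodic atom leads
to a finite subgroup that is as good as the atom (`IsAtomOf.card_inter_lt_or_exists_addSubgroup`).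
When `S` is non-degenerate such subgroups do not occur (`subgroupBound_of_not_isDegenerate`), so
atoms have few repeated differences and the Cauchy–Schwarz inequality (`sq_card_mul_card_le`)
forces them to have large sums with other sets.

If `κ₂(S) < |S|`, compare the `2`-atom `A` of `S` with the `2`-atom of `A`: the Cauchy–Schwarz
bounds for the sum of the two leave only the possibility `A = {0, r}`
(`exists_pair_of_two_connectivity_lt`). Then `r` generates `G` and `S + {0, r}` has only one
element more than `S`, so `S` is a progression. This settles `μ = 1`, and for `μ = 0` it leaves
the case `κ₂(S) = κ₃(S) = |S|` (`IsVosperSet`).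

In this case the same comparison for a `3`-atom `A` of `S` shows that `A` has exactly three
elements (`IsThreeAtom.card_eq_three`). The exceptions to the Cauchy–Schwarz argument are
four-element atoms with a repeated difference, which are parallelograms or contain a three-term
progression and are excluded by following the ends of the maximal progressions in `S`, and
five-element atoms that are contained in two cosets of a subgroup of order five.

So `A = {0, a, b}`, with `|S + A| = |S| + 3`. Hence the `4`-atom `B` of `A` satisfies `|B + A| ≤
|B| + 3`, and strict inequality would bring back the case of the second paragraph, with `A` in the
place of `S`. Regard the elements of `B` as points of the triangular lattice spanned by `a` and
`b`. If `a` and `b` satisfy no short relation, then inclusion-exclusion shows that `B` has four or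
six points, and neither is possible (`HexFree.eight_le_card_add`,
`HexBalanced.false_of_card_eq_six`). If they do, then up to translation `A` is `{0, r, 2r}` or
`{0, r, 3r}`, since the differences of the elements of `A` have order at least four
(`exists_progression_of_card_eq_three`). Finally, `|S + A| = |S| + 3` for such an `A` means that
`S` has two maximal `r`-progressions separated on one side by a single element
(`isNearProgression_of_card_add`).

If `|S| = 3`, the classification of three-element sets is applied to `S` instead of `A`; this is
where the hypothesis on `κ₄(S)` is used.
-/

/-! ### Isoperimetric atoms -/

section Isoperimetric

variable {G : Type*} [AddCommGroup G] [DecidableEq G]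

/-- `LeCard G m` says that `G` has at least `m` elements; it holds for all `m` if `G` is
infinite. -/
def LeCard (G : Type*) (m : ℕ) : Prop := (m : ℕ∞) ≤ ENat.card G

theorem LeCard.mono {G : Type*} {m m' : ℕ} (h : LeCard G m) (hm : m' ≤ m) : LeCard G m' :=
  le_trans (by exact_mod_cast hm) h

theorem leCard_of_infinite {G : Type*} [Infinite G] (m : ℕ) : LeCard G m := by
  simp [LeCard]

theorem leCard_iff_of_finite {G : Type*} [Finite G] {m : ℕ} : LeCard G m ↔ m ≤ Nat.card G := by
  rw [LeCard, ENat.card_eq_coe_natCard]; exact_mod_cast Iff.rfl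

theorem leCard_card {G : Type*} (Z : Finset G) : LeCard G Z.card := by
  rcases finite_or_infinite G with hG | hG
  · rw [leCard_iff_of_finite]
    have := Fintype.ofFinite G
    rw [Nat.card_eq_fintype_card]
    exact Finset.card_le_univ Z
  · exact leCard_of_infinite _

theorem LeCard.le_card {G : Type*} {m : ℕ} {Z : Finset G} (h : LeCard G m) (hZ : ∀ g, g ∈ Z) :
    m ≤ Z.card := by
  have hfin : Finite G := Finite.of_finite_univ
    ((Finset.finite_toSet Z).subset fun g _ => hZ g)
  have := Fintype.ofFinite G
  rw [leCard_iff_of_finite, Nat.card_eq_fintype_card] at h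
  exact h.trans (Finset.card_le_card fun g _ => hZ g)

theorem LeCard.exists_notMem {G : Type*} {Z : Finset G} (h : LeCard G (Z.card + 1)) :
    ∃ g, g ∉ Z := by
  by_contra! hc
  have := h.le_card hc
  omega

theorem leCard_of_notMem {G : Type*} [DecidableEq G] {Z : Finset G} {g : G} (h : g ∉ Z) :
    LeCard G (Z.card + 1) := by
  have := leCard_card (insert g Z)
  rwa [Finset.card_insert_of_notMem h] at this

/-- `X` has at least `k` elements, at least `k` elements of `G` lie outside `X + S`, and `X` is
invariant under translation by `q`. The case `q = 0` is the separation condition in the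
definition of `κ_k(S)`; other `q` restrict attention to `q`-periodic sets. -/
structure IsSep (k : ℕ) (q : G) (S X : Finset G) : Prop where
  le_card : k ≤ X.card
  room : LeCard G ((X + S).card + k)
  periodic : q +ᵥ X = X

/-- `A` minimises `|X + S| - |X|` among the sets `X` with `IsSep k q S X`, with minimum `κ`, and
has the least cardinality among the minimisers: for `q = 0`, a `k`-atom. -/
structure IsAtomOf (k : ℕ) (q : G) (S : Finset G) (κ : ℕ) (A : Finset G) : Prop where
  sep : IsSep k q S A
  card_add : (A + S).card = A.card + κ
  le_of_sep : ∀ X, IsSep k q S X → X.card + κ ≤ (X + S).card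
  card_le : ∀ X, IsSep k q S X → (X + S).card = X.card + κ → A.card ≤ X.card

theorem exists_isAtomOf {k c : ℕ} {q : G} {S X : Finset G} (hS : S.Nonempty)
    (hX : IsSep k q S X) (hc : (X + S).card ≤ X.card + c) :
    ∃ κ ≤ c, ∃ A, IsAtomOf k q S κ A := by
  classical
  have hle : ∀ Y : Finset G, Y.card ≤ (Y + S).card := fun Y => Finset.card_le_card_add_right hS
  have hex : ∃ m, ∃ Y, IsSep k q S Y ∧ (Y + S).card = Y.card + m :=
    ⟨(X + S).card - X.card, X, hX, by have := hle X; omega⟩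
  have hex2 : ∃ m, ∃ Y, IsSep k q S Y ∧ (Y + S).card = Y.card + Nat.find hex ∧ Y.card = m := by
    obtain ⟨Y, h1, h2⟩ := Nat.find_spec hex
    exact ⟨_, Y, h1, h2, rfl⟩
  obtain ⟨A, hA, hA1, hA2⟩ := Nat.find_spec hex2
  refine ⟨Nat.find hex, ?_, A, hA, hA1, ?_, ?_⟩
  · have := Nat.find_min' hex ⟨X, hX, (by have := hle X; omega :
      (X + S).card = X.card + ((X + S).card - X.card))⟩
    omega
  · intro Y hY
    have := Nat.find_min' hex ⟨Y, hY, (by have := hle Y; omega :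
      (Y + S).card = Y.card + ((Y + S).card - Y.card))⟩
    have := hle Y
    omega
  · intro Y hY hY2
    rw [hA2]
    exact Nat.find_min' hex2 ⟨Y, hY, hY2, rfl⟩

theorem IsSep.vadd {k : ℕ} {q : G} {S X : Finset G} (h : IsSep k q S X) (x : G) :
    IsSep k q S (x +ᵥ X) := by
  refine ⟨by simpa using h.le_card, ?_, ?_⟩
  · rw [vadd_add_assoc, Finset.card_vadd_finset]; exact h.room
  · rw [vadd_comm, h.periodic]

theorem IsAtomOf.vadd {k κ : ℕ} {q : G} {S A : Finset G} (h : IsAtomOf k q S κ A) (x : G) :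
    IsAtomOf k q S κ (x +ᵥ A) := by
  refine ⟨h.sep.vadd x, ?_, h.le_of_sep, ?_⟩
  · rw [vadd_add_assoc, Finset.card_vadd_finset, Finset.card_vadd_finset]; exact h.card_add
  · rw [Finset.card_vadd_finset]; exact h.card_le

/-- The duality between a set and its exterior: sums of `S` with the negated exterior of `F` avoid
the negatives of the elements of `F`. -/
theorem neg_compl_add_subset [Fintype G] (F S : Finset G) : -(F + S)ᶜ + S ⊆ -Fᶜ := by
  intro z hz
  obtain ⟨d, hd, s, hs, rfl⟩ := Finset.mem_add.1 hz
  rw [Finset.mem_neg', Finset.mem_compl] at hd ⊢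
  intro hf
  apply hd
  rw [show -d = -(d + s) + s by abel]
  exact Finset.add_mem_add hf hs

/-- The exterior of a minimiser `F` has at least as many elements as an atom: in a finite group
the negative of the exterior of `F` is again a minimiser. -/
theorem IsAtomOf.leCard_add {k κ : ℕ} {q : G} {S A F : Finset G} (h : IsAtomOf k q S κ A)
    (hF : IsSep k q S F) (hFκ : (F + S).card = F.card + κ) :
    LeCard G ((F + S).card + A.card) := by
  rcases finite_or_infinite G with hG | hG
  swap
  · exact leCard_of_infinite _
  have := Fintype.ofFinite G
  set D : Finset G := (F + S)ᶜ with hD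
  have hDc : D.card + (F + S).card = Fintype.card G := Finset.card_compl_add_card _
  have hroom : (F + S).card + k ≤ Fintype.card G := by
    have := hF.room
    rwa [leCard_iff_of_finite, Nat.card_eq_fintype_card] at this
  have hsub : -D + S ⊆ -Fᶜ := neg_compl_add_subset F S
  have hcard : (-D + S).card ≤ Fintype.card G - F.card := by
    refine (Finset.card_le_card hsub).trans ?_
    rw [Finset.card_neg, Finset.card_compl]
  have hFle : F.card ≤ Fintype.card G := Finset.card_le_univ _
  have hper : q +ᵥ (F + S) = F + S := by rw [← vadd_add_assoc, hF.periodic]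
  have hDper : q +ᵥ (-D) = -D := by
    ext z
    rw [← Finset.neg_vadd_mem_iff, Finset.mem_neg', Finset.mem_neg', hD, Finset.mem_compl,
      Finset.mem_compl, not_iff_not]
    conv_lhs => rw [← hper]
    rw [← Finset.neg_vadd_mem_iff]
    simp only [vadd_eq_add]
    rw [show -q + -(-q + z) = -z by abel]
  have hsep : IsSep k q S (-D) := by
    refine ⟨by rw [Finset.card_neg]; omega, ?_, hDper⟩
    rw [leCard_iff_of_finite, Nat.card_eq_fintype_card]
    have := hF.le_card
    omega
  have h1 := h.le_of_sep _ hsep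
  have h2 := h.card_le _ hsep (by rw [Finset.card_neg] at *; omega)
  rw [Finset.card_neg] at h2
  rw [leCard_iff_of_finite, Nat.card_eq_fintype_card]
  omega

/-- Submodularity of `X ↦ |X + S|`. -/
theorem card_union_add_le (S A F : Finset G) :
    ((A ∪ F) + S).card + ((A ∩ F) + S).card ≤ (A + S).card + (F + S).card := by
  rw [Finset.union_add, ← Finset.card_union_add_card_inter (A + S)]
  have := Finset.card_le_card (Finset.inter_add_subset (s₁ := A) (s₂ := F) (t := S))
  omega

/-- The intersection property of atoms: by submodularity, if an atom `A` meets a minimiser `F` in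
at least `k` elements, then `A ∩ F` is a minimiser too, so that it is all of `A`. -/
theorem IsAtomOf.subset_of_le_card_inter {k κ : ℕ} {q : G} {S A F : Finset G}
    (h : IsAtomOf k q S κ A) (hF : IsSep k q S F) (hFκ : (F + S).card = F.card + κ)
    (hk : k ≤ (A ∩ F).card) : A ⊆ F := by
  have hsub := card_union_add_le S A F
  have hcard := Finset.card_union_add_card_inter A F
  have hinter : IsSep k q S (A ∩ F) := by
    refine ⟨hk, h.sep.room.mono ?_, ?_⟩
    · have := Finset.card_le_card (Finset.add_subset_add_right (t := S)
        (Finset.inter_subset_left (s₁ := A) (s₂ := F)))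
      omega
    · rw [Finset.vadd_finset_inter, h.sep.periodic, hF.periodic]
  have h1 := h.le_of_sep _ hinter
  have h2 := h.card_add
  have hunion : IsSep k q S (A ∪ F) := by
    refine ⟨h.sep.le_card.trans (Finset.card_le_card Finset.subset_union_left),
      (h.leCard_add hF hFκ).mono ?_, ?_⟩
    · omega
    · rw [Finset.vadd_finset_union, h.sep.periodic, hF.periodic]
  have h3 := h.le_of_sep _ hunion
  have h4 := h.card_le _ hinter (by omega)
  rw [← Finset.eq_of_subset_of_card_le Finset.inter_subset_left h4]
  exact Finset.inter_subset_right

theorem IsAtomOf.vadd_eq_of_le_card_inter {k κ : ℕ} {q : G} {S A : Finset G}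
    (h : IsAtomOf k q S κ A) {x : G} (hk : k ≤ (A ∩ (x +ᵥ A)).card) : x +ᵥ A = A := by
  have hx := h.vadd x
  have := h.subset_of_le_card_inter hx.sep hx.card_add hk
  exact (Finset.eq_of_subset_of_card_le this (by simp)).symm

/-- A periodic set with small sumset yields a finite subgroup containing the period with an
equally small sumset: the `q`-periodic `1`-atoms are cosets of a subgroup. -/
theorem exists_addSubgroup_of_periodic {c : ℕ} {q : G} {S X : Finset G} (hS : S.Nonempty)
    (hX : IsSep 1 q S X) (hc : (X + S).card ≤ X.card + c) :
    ∃ (H : AddSubgroup G) (Y : Finset G), (Y : Set G) = H ∧ q ∈ H ∧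
      LeCard G ((Y + S).card + 1) ∧ (Y + S).card ≤ Y.card + c := by
  obtain ⟨κ, hκ, A, hA⟩ := exists_isAtomOf hS hX hc
  obtain ⟨a, ha⟩ := Finset.card_pos.1 hA.sep.le_card
  have hB := hA.vadd (-a)
  set B := -a +ᵥ A with hBdef
  have h0 : (0 : G) ∈ B := by
    rw [hBdef, ← Finset.neg_vadd_mem_iff]; simpa using ha
  have key : ∀ b ∈ B, -b +ᵥ B = B := by
    intro b hb
    apply hB.vadd_eq_of_le_card_inter
    rw [Nat.one_le_iff_ne_zero, Finset.card_ne_zero]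
    refine ⟨0, Finset.mem_inter.2 ⟨h0, ?_⟩⟩
    rw [← Finset.neg_vadd_mem_iff]; simpa using hb
  have hneg : ∀ b ∈ B, -b ∈ B := by
    intro b hb
    rw [← key b hb, ← Finset.neg_vadd_mem_iff]; simpa using h0
  let H : AddSubgroup G :=
    { carrier := B
      zero_mem' := h0
      neg_mem' := fun {b} hb => hneg b hb
      add_mem' := by
        intro b c hb hc
        have := key _ (hneg b hb)
        rw [neg_neg] at this
        change b + c ∈ B
        rw [← this]
        exact Finset.vadd_mem_vadd_finset hc }
  refine ⟨H, B, rfl, ?_, hB.sep.room, by have := hB.card_add; omega⟩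
  change q ∈ B
  rw [← hB.sep.periodic]
  have := Finset.vadd_mem_vadd_finset (a := q) h0
  simpa using this

/-- A `k`-atom meets each of its other translates in fewer than `k` elements, unless some
non-trivial finite subgroup does as well as the atom. -/
theorem IsAtomOf.card_inter_lt_or_exists_addSubgroup {k κ : ℕ} {S A : Finset G}
    (hS : S.Nonempty) (hk : 1 ≤ k) (hA : IsAtomOf k 0 S κ A) :
    (∀ x : G, x ≠ 0 → (A ∩ (x +ᵥ A)).card < k) ∨
    ∃ (H : AddSubgroup G) (Y : Finset G), (Y : Set G) = H ∧ 2 ≤ Y.card ∧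
      LeCard G ((Y + S).card + 1) ∧ (Y + S).card ≤ Y.card + κ := by
  by_cases h : ∀ x : G, x ≠ 0 → (A ∩ (x +ᵥ A)).card < k
  · exact Or.inl h
  push Not at h
  obtain ⟨x, hx, hxk⟩ := h
  have hper := hA.vadd_eq_of_le_card_inter hxk
  obtain ⟨H, Y, hY, hxH, hr, hc⟩ := exists_addSubgroup_of_periodic hS
    (⟨hk.trans hA.sep.le_card, hA.sep.room.mono (by omega), hper⟩ : IsSep 1 x S A)
    hA.card_add.le
  refine Or.inr ⟨H, Y, hY, ?_, hr, hc⟩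
  have h0 : (0 : G) ∈ Y := by rw [← Finset.mem_coe, hY]; exact H.zero_mem
  have hxY : x ∈ Y := by rw [← Finset.mem_coe, hY]; exact hxH
  exact Finset.one_lt_card.2 ⟨x, hxY, 0, h0, hx⟩

end Isoperimetric

/-! ### A Cauchy–Schwarz bound for sumsets -/

section Energy

variable {G : Type*} [AddCommGroup G] [DecidableEq G]

theorem mem_vadd_finset_iff {x y : G} {A : Finset G} : y ∈ x +ᵥ A ↔ y - x ∈ A := by
  rw [← Finset.neg_vadd_mem_iff, vadd_eq_add, neg_add_eq_sub]

/-- The Cauchy–Schwarz bound for the number of sums, for a set `A` whose non-trivial translates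
meet it in at most `c` elements. -/
theorem sq_card_mul_card_le {A B : Finset G} {c : ℕ} (hB : B.Nonempty)
    (hA : ∀ x : G, x ≠ 0 → (A ∩ (x +ᵥ A)).card ≤ c) :
    A.card ^ 2 * B.card + (A + B).card * c ≤ (A + B).card * (A.card + c * B.card) := by
  have hE : A.addEnergy B + B.card * c ≤ B.card * (A.card + c * B.card) := by
    have h1 : A.addEnergy B = ∑ p ∈ B ×ˢ B, (A ∩ ((p.2 - p.1) +ᵥ A)).card := by
      rw [Finset.addEnergy, Finset.card_eq_sum_card_fiberwise
        (f := Prod.snd) (t := B ×ˢ B) (by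
          intro x hx
          exact (Finset.mem_product.1 (Finset.mem_filter.1 hx).1).2)]
      refine Finset.sum_congr rfl fun p hp => ?_
      refine Finset.card_bij (fun x _ => x.1.1) ?_ ?_ ?_
      · rintro ⟨⟨a, a'⟩, b⟩ hx
        simp only [Finset.mem_filter, Finset.mem_product] at hx
        obtain ⟨⟨⟨⟨ha, ha'⟩, hb⟩, he⟩, rfl⟩ := hx
        rw [Finset.mem_inter, mem_vadd_finset_iff]
        refine ⟨ha, ?_⟩
        rwa [show a - (b.2 - b.1) = a' by rw [sub_sub_eq_add_sub, he, add_sub_cancel_right]]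
      · rintro ⟨⟨a, a'⟩, b⟩ hx ⟨⟨d, d'⟩, b'⟩ hx' h
        simp only [Finset.mem_filter, Finset.mem_product] at hx hx'
        obtain ⟨⟨-, he⟩, rfl⟩ := hx
        obtain ⟨⟨-, he'⟩, rfl⟩ := hx'
        dsimp only at h
        subst h
        rw [he] at he'
        simp only [add_left_inj] at he'
        rw [he']
      · intro a ha
        rw [Finset.mem_inter, mem_vadd_finset_iff] at ha
        rw [Finset.mem_product] at hp
        refine ⟨((a, a - (p.2 - p.1)), p), ?_, rfl⟩
        simp only [Finset.mem_filter, Finset.mem_product]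
        exact ⟨⟨⟨ha, hp⟩, by abel⟩, trivial⟩
    have h2 : ∀ p ∈ B ×ˢ B, (A ∩ ((p.2 - p.1) +ᵥ A)).card + (if p.1 = p.2 then c else 0) ≤
        c + (if p.1 = p.2 then A.card else 0) := by
      intro p _
      split_ifs with h
      · have := Finset.card_le_card (Finset.inter_subset_left (s₁ := A) (s₂ := (p.2 - p.1) +ᵥ A))
        omega
      · have := hA (p.2 - p.1) (sub_ne_zero.2 (Ne.symm h))
        omega
    have h3 := Finset.sum_le_sum h2
    have h4 : ∀ t : ℕ, ∑ p ∈ B ×ˢ B, (if p.1 = p.2 then t else 0) = B.card * t := by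
      intro t
      rw [Finset.sum_product]
      simp
    rw [Finset.sum_add_distrib, Finset.sum_add_distrib, h4, h4, ← h1, Finset.sum_const,
      Finset.card_product, smul_eq_mul] at h3
    nlinarith
  have h := Finset.le_card_add_mul_addEnergy A B
  have hpos := Finset.card_pos.2 hB
  refine Nat.le_of_mul_le_mul_left ?_ hpos
  calc B.card * (A.card ^ 2 * B.card + (A + B).card * c)
      = A.card ^ 2 * B.card ^ 2 + (A + B).card * (B.card * c) := by ring
    _ ≤ (A + B).card * A.addEnergy B + (A + B).card * (B.card * c) := by gcongr
    _ = (A + B).card * (A.addEnergy B + B.card * c) := by ring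
    _ ≤ (A + B).card * (B.card * (A.card + c * B.card)) := by gcongr
    _ = _ := by ring

end Energy

/-! ### Sumsets and cosets -/

section Subgroups

variable {G : Type*} [AddCommGroup G] [DecidableEq G]

theorem zero_mem_of_coe_eq {G : Type*} [AddCommGroup G] {H : AddSubgroup G} {Y : Finset G}
    (hY : (Y : Set G) = H) : (0 : G) ∈ Y := by rw [← Finset.mem_coe, hY]; exact H.zero_mem

theorem mem_iff_of_coe_eq {G : Type*} [AddCommGroup G] {H : AddSubgroup G} {Y : Finset G}
    (hY : (Y : Set G) = H) {x : G} : x ∈ Y ↔ x ∈ H := by rw [← Finset.mem_coe, hY]; rfl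

theorem addSubgroup_eq_top_of_closure {G : Type*} [AddCommGroup G] {S : Finset G}
    {H : AddSubgroup G} (hgen : AddSubgroup.closure (S : Set G) = ⊤)
    (h : ∀ s ∈ S, s ∈ H) : H = ⊤ := by
  rw [eq_top_iff, ← hgen, AddSubgroup.closure_le]
  exact h

theorem ne_top_of_leCard {H : AddSubgroup G} {S Y : Finset G} (hS : S.Nonempty)
    (hY : (Y : Set G) = H) (h : LeCard G ((Y + S).card + 1)) : H ≠ ⊤ := by
  rintro rfl
  obtain ⟨g, hg⟩ := h.exists_notMem
  obtain ⟨s, hs⟩ := hS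
  apply hg
  have : g - s ∈ Y := by rw [mem_iff_of_coe_eq hY]; trivial
  simpa using Finset.add_mem_add this hs

/-- A generating set meets at least two cosets of a proper subgroup. -/
theorem two_mul_card_le_card_add {H : AddSubgroup G} {A Y : Finset G} (h0 : (0 : G) ∈ A)
    (hgen : AddSubgroup.closure (A : Set G) = ⊤) (hY : (Y : Set G) = H) (hH : H ≠ ⊤) :
    2 * Y.card ≤ (Y + A).card := by
  have : ∃ a ∈ A, a ∉ H := by
    by_contra! hc
    exact hH (addSubgroup_eq_top_of_closure hgen hc)
  obtain ⟨a, ha, haH⟩ := this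
  have hdisj : Disjoint Y (a +ᵥ Y) := by
    rw [Finset.disjoint_left]
    intro y hy hy'
    rw [mem_vadd_finset_iff, mem_iff_of_coe_eq hY] at hy'
    rw [mem_iff_of_coe_eq hY] at hy
    apply haH
    simpa using H.sub_mem hy hy'
  have hsub : Y ∪ (a +ᵥ Y) ⊆ Y + A := by
    apply Finset.union_subset
    · intro y hy
      simpa using Finset.add_mem_add hy h0
    · rw [add_comm, ← Finset.singleton_add]
      exact Finset.add_subset_add_right (by simpa using ha)
  have := Finset.card_le_card hsub
  rw [Finset.card_union_of_disjoint hdisj, Finset.card_vadd_finset] at this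
  omega

/-- For an element `x` of a finite subgroup, `A` and `x + A` both lie in the union of the cosets
of the subgroup that `A` meets. -/
theorem two_mul_card_le_of_mem {H : AddSubgroup G} {A Y : Finset G}
    (hY : (Y : Set G) = H) {x : G} (hx : x ∈ H) :
    2 * A.card ≤ (Y + A).card + (A ∩ (x +ᵥ A)).card := by
  have hsub : A ∪ (x +ᵥ A) ⊆ Y + A := by
    apply Finset.union_subset
    · intro y hy
      simpa using Finset.add_mem_add (zero_mem_of_coe_eq hY) hy
    · rw [← Finset.singleton_add]
      exact Finset.add_subset_add_right (by simpa [mem_iff_of_coe_eq hY] using hx)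
  have := Finset.card_le_card hsub
  have h := Finset.card_union_add_card_inter A (x +ᵥ A)
  rw [Finset.card_vadd_finset] at h
  omega

/-- A Cauchy–Davenport type bound: the obstruction would be a subgroup, and a set that meets its
translates in at most two elements cannot be nearly a union of cosets. -/
theorem card_add_card_le_of_inter_le_two {A X : Finset G} (h0 : (0 : G) ∈ A)
    (hgen : AddSubgroup.closure (A : Set G) = ⊤)
    (hA : ∀ x : G, x ≠ 0 → (A ∩ (x +ᵥ A)).card ≤ 2) (hX : X.Nonempty)
    (hroom : LeCard G ((X + A).card + 1)) : X.card + A.card ≤ (X + A).card + 1 := by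
  by_contra! hc
  have hAne : A.Nonempty := ⟨0, h0⟩
  have hXA : X.card ≤ (X + A).card := Finset.card_le_card_add_right hAne
  obtain ⟨H, Y, hY, -, hr, hcard⟩ := exists_addSubgroup_of_periodic (c := A.card - 2) hAne
    (⟨Finset.card_pos.2 hX, hroom, zero_vadd _ _⟩ : IsSep 1 0 A X) (by omega)
  have h2 := two_mul_card_le_card_add h0 hgen hY (ne_top_of_leCard hAne hY hr)
  have hY2 : 2 ≤ Y.card := by
    by_contra! h1
    have : A.card ≤ (Y + A).card := Finset.card_le_card_add_left ⟨0, zero_mem_of_coe_eq hY⟩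
    omega
  obtain ⟨x, hx, hx0⟩ := Finset.exists_mem_ne hY2 0
  have := two_mul_card_le_of_mem (A := A) hY ((mem_iff_of_coe_eq hY).1 hx)
  have := hA x hx0
  omega

/-- The previous bound inside a coset of the subgroup generated by `A`. -/
theorem card_add_card_le_of_subset_coset {A X : Finset G} (h0 : (0 : G) ∈ A)
    (hA : ∀ x : G, x ≠ 0 → (A ∩ (x +ᵥ A)).card ≤ 2) (hX : X.Nonempty) {g : G}
    (hXg : ∀ x ∈ X, x - g ∈ AddSubgroup.closure (A : Set G))
    (hfull : ∃ y, y - g ∈ AddSubgroup.closure (A : Set G) ∧ y ∉ X + A) :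
    X.card + A.card ≤ (X + A).card + 1 := by
  set H := AddSubgroup.closure (A : Set G) with hH
  have : DecidablePred (· ∈ H) := Classical.decPred _
  let φ : H →+ G := H.subtype
  have hφ : Function.Injective φ := Subtype.val_injective
  let A' : Finset H := A.subtype (· ∈ H)
  let X' : Finset H := (-g +ᵥ X).subtype (· ∈ H)
  have hA' : A'.image φ = A := by
    ext a
    simp only [Finset.mem_image, A', Finset.mem_subtype]
    constructor
    · rintro ⟨a, ha, rfl⟩; exact ha
    · intro ha; exact ⟨⟨a, AddSubgroup.subset_closure ha⟩, ha, rfl⟩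
  have hX' : X'.image φ = -g +ᵥ X := by
    ext a
    simp only [Finset.mem_image, X', Finset.mem_subtype]
    constructor
    · rintro ⟨a, ha, rfl⟩; exact ha
    · intro ha
      refine ⟨⟨a, ?_⟩, ha, rfl⟩
      have := hXg (a + g) (by rw [mem_vadd_finset_iff] at ha; simpa using ha)
      simpa using this
  have hXA : (X' + A').image φ = -g +ᵥ (X + A) := by
    rw [Finset.image_add φ, hA', hX', vadd_add_assoc]
  have c1 : A'.card = A.card := by rw [← hA', Finset.card_image_of_injective _ hφ]
  have c2 : X'.card = X.card := by
    rw [← Finset.card_image_of_injective X' hφ, hX', Finset.card_vadd_finset]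
  have c3 : (X' + A').card = (X + A).card := by
    rw [← Finset.card_image_of_injective _ hφ, hXA, Finset.card_vadd_finset]
  rw [← c1, ← c2, ← c3]
  apply card_add_card_le_of_inter_le_two
  · simpa [A'] using h0
  · have : (A' : Set H) = Subtype.val ⁻¹' (A : Set G) := by
      ext a; simp [A']
    rw [this]
    exact AddSubgroup.closure_closure_coe_preimage
  · intro x hx
    have hx' : (x : G) ≠ 0 := by simpa using hx
    refine le_trans ?_ (hA x hx')
    rw [← Finset.card_image_of_injective _ hφ]
    apply Finset.card_le_card
    intro y hy
    obtain ⟨z, hz, rfl⟩ := Finset.mem_image.1 hy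
    rw [Finset.mem_inter, mem_vadd_finset_iff] at hz ⊢
    simpa [A', φ] using hz
  · rw [← Finset.card_pos, c2]; exact Finset.card_pos.2 hX
  · obtain ⟨y, hy, hyX⟩ := hfull
    apply leCard_of_notMem (g := (⟨y - g, hy⟩ : H))
    intro hmem
    apply hyX
    have := Finset.mem_image_of_mem φ hmem
    rw [hXA, mem_vadd_finset_iff] at this
    simpa [φ] using this

/-- Suppose that `S + A` is small and let `H` be the subgroup generated by `A`. Each coset of `H`
that meets `S` without being contained in `S + A` contributes at least `|A| - 1` to `|S + A| -
|S|`, so there is at most one such coset. Hence `S` lies in a single coset of `H`, or `H` is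
finite and `|H + S| - |H| ≤ |S + A| - |A|`. -/
theorem exists_coset_or_card_add_le {A S : Finset G} (h0 : (0 : G) ∈ A)
    (hA : ∀ x : G, x ≠ 0 → (A ∩ (x +ᵥ A)).card ≤ 2) (hS : S.Nonempty)
    (hAS : (S + A).card + 3 ≤ S.card + 2 * A.card) :
    (∃ g, ∀ x ∈ S, x - g ∈ AddSubgroup.closure (A : Set G)) ∨
    ∃ Y : Finset G, (Y : Set G) = AddSubgroup.closure (A : Set G) ∧
      (Y + S).card + A.card ≤ (S + A).card + Y.card := by
  classical
  set H := AddSubgroup.closure (A : Set G) with hH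
  by_cases hall : ∀ g ∈ S, ∀ y, y - g ∈ H → y ∈ S + A
  · right
    obtain ⟨g, hg⟩ := hS
    have hfin : (H : Set G).Finite := by
      refine (Finset.finite_toSet (-g +ᵥ (S + A))).subset fun y hy => ?_
      rw [Finset.mem_coe, mem_vadd_finset_iff]
      exact hall g hg _ (by simpa using hy)
    refine ⟨hfin.toFinset, hfin.coe_toFinset, ?_⟩
    have h1 : hfin.toFinset + S ⊆ S + A := by
      intro z hz
      obtain ⟨y, hy, s, hs, rfl⟩ := Finset.mem_add.1 hz
      exact hall s hs _ (by simpa using hy)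
    have h2 : A ⊆ hfin.toFinset := fun a ha => by
      rw [Set.Finite.mem_toFinset]; exact AddSubgroup.subset_closure ha
    exact Nat.add_le_add (Finset.card_le_card h1) (Finset.card_le_card h2)
  push Not at hall
  obtain ⟨g, hg, y, hy, hyn⟩ := hall
  by_cases hone : ∀ x ∈ S, x - g ∈ H
  · exact Or.inl ⟨g, hone⟩
  push Not at hone
  right
  set S₀ := S.filter (fun x => x - g ∈ H) with hS₀
  set S₁ := S.filter (fun x => ¬ (x - g ∈ H)) with hS₁
  have hcardS : S₀.card + S₁.card = S.card := Finset.card_filter_add_card_filter_not _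
  have hsub₀ : S₀ ⊆ S := Finset.filter_subset _ _
  have hsub₁ : S₁ ⊆ S := Finset.filter_subset _ _
  have hAH : ∀ a ∈ A, a ∈ H := fun a ha => AddSubgroup.subset_closure ha
  have hb₀ : S₀.card + A.card ≤ (S₀ + A).card + 1 := by
    apply card_add_card_le_of_subset_coset h0 hA (g := g)
    · exact ⟨g, Finset.mem_filter.2 ⟨hg, by simp⟩⟩
    · intro x hx; exact (Finset.mem_filter.1 hx).2
    · exact ⟨y, hy, fun h => hyn (Finset.add_subset_add_right hsub₀ h)⟩
  have hcos : ∀ (T : Finset G) (g' : G), (∀ x ∈ T, x - g' ∈ H) → ∀ z ∈ T + A, z - g' ∈ H := by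
    intro T g' hT z hz
    obtain ⟨t, ht, a, ha, rfl⟩ := Finset.mem_add.1 hz
    rw [add_sub_right_comm]
    exact H.add_mem (hT t ht) (hAH a ha)
  have hcon : ∀ (T : Finset G) (g' : G), (∀ x ∈ T, ¬ x - g' ∈ H) → ∀ z ∈ T + A, ¬ z - g' ∈ H := by
    intro T g' hT z hz hzH
    obtain ⟨t, ht, a, ha, rfl⟩ := Finset.mem_add.1 hz
    apply hT t ht
    rw [add_sub_right_comm] at hzH
    simpa using H.sub_mem hzH (hAH a ha)
  have hdisj : Disjoint (S₀ + A) (S₁ + A) := by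
    rw [Finset.disjoint_left]
    intro z hz hz'
    exact hcon S₁ g (fun x hx => (Finset.mem_filter.1 hx).2) z hz'
      (hcos S₀ g (fun x hx => (Finset.mem_filter.1 hx).2) z hz)
  have hunion : S₀ ∪ S₁ = S := Finset.filter_union_filter_not_eq _ _
  have hcardSA : (S₀ + A).card + (S₁ + A).card = (S + A).card := by
    rw [← Finset.card_union_of_disjoint hdisj, ← Finset.union_add, hunion]
  have hle : ∀ T : Finset G, T ⊆ T + A := fun T t ht => by
    simpa using Finset.add_mem_add ht h0
  have hfull : ∀ g' ∈ S₁, ∀ z, z - g' ∈ H → z ∈ S₁ + A := by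
    intro g' hg' z hz
    by_contra hzn
    set T₀ := S₁.filter (fun x => x - g' ∈ H) with hT₀
    set T₁ := S₁.filter (fun x => ¬ (x - g' ∈ H)) with hT₁
    have hcardT : T₀.card + T₁.card = S₁.card := Finset.card_filter_add_card_filter_not _
    have hb : T₀.card + A.card ≤ (T₀ + A).card + 1 := by
      apply card_add_card_le_of_subset_coset h0 hA (g := g')
      · exact ⟨g', Finset.mem_filter.2 ⟨hg', by simp⟩⟩
      · intro x hx; exact (Finset.mem_filter.1 hx).2
      · exact ⟨z, hz, fun h => hzn (Finset.add_subset_add_right (Finset.filter_subset _ _) h)⟩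
    have hd : Disjoint (T₀ + A) (T₁ + A) := by
      rw [Finset.disjoint_left]
      intro z hz hz'
      exact hcon T₁ g' (fun x hx => (Finset.mem_filter.1 hx).2) z hz'
        (hcos T₀ g' (fun x hx => (Finset.mem_filter.1 hx).2) z hz)
    have hc : (T₀ + A).card + (T₁ + A).card = (S₁ + A).card := by
      rw [← Finset.card_union_of_disjoint hd, ← Finset.union_add,
        Finset.filter_union_filter_not_eq]
    have := Finset.card_le_card (hle T₁)
    omega
  obtain ⟨g', hg', hg'H⟩ := hone
  have hg'₁ : g' ∈ S₁ := Finset.mem_filter.2 ⟨hg', hg'H⟩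
  have hfin : (H : Set G).Finite := by
    refine (Finset.finite_toSet (-g' +ᵥ (S₁ + A))).subset fun y hy => ?_
    rw [Finset.mem_coe, mem_vadd_finset_iff]
    exact hfull g' hg'₁ _ (by simpa using hy)
  refine ⟨hfin.toFinset, hfin.coe_toFinset, ?_⟩
  have hsub : hfin.toFinset + S ⊆ (g +ᵥ hfin.toFinset) ∪ (S₁ + A) := by
    intro z hz
    obtain ⟨y, hy, s, hs, rfl⟩ := Finset.mem_add.1 hz
    rw [Set.Finite.mem_toFinset] at hy
    rw [Finset.mem_union, mem_vadd_finset_iff, Set.Finite.mem_toFinset]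
    by_cases hsg : s - g ∈ H
    · left
      rw [add_sub_assoc]
      exact H.add_mem hy hsg
    · right
      exact hfull s (Finset.mem_filter.2 ⟨hs, hsg⟩) _ (by simpa using hy)
  have h1 := (Finset.card_le_card hsub).trans (Finset.card_union_le _ _)
  rw [Finset.card_vadd_finset] at h1
  have h2 : A.card ≤ (S₀ + A).card :=
    Finset.card_le_card_add_left ⟨g, Finset.mem_filter.2 ⟨hg, by simp⟩⟩
  omega

end Subgroups

/-! ### Ends of progressions -/

section Progressions

variable {G : Type*} [AddCommGroup G] [DecidableEq G]

/-- A finite non-empty set closed under translation by generators of `G` is all of `G`. -/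
theorem forall_mem_of_add_mem {G : Type*} [AddCommGroup G] {D : Set G} {Z : Finset G}
    (hZ : Z.Nonempty) (hD : AddSubgroup.closure D = ⊤) (h : ∀ d ∈ D, ∀ z ∈ Z, z + d ∈ Z) (g : G) :
    g ∈ Z := by
  classical
  have key : ∀ x : G, ∀ z ∈ Z, z + x ∈ Z := by
    intro x
    have hx : x ∈ AddSubgroup.closure D := by rw [hD]; trivial
    induction hx using AddSubgroup.closure_induction with
    | mem x hx => exact h x hx
    | zero => simp
    | add x y _ _ hx hy => intro z hz; rw [← add_assoc]; exact hy _ (hx _ hz)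
    | neg x _ hx =>
      have himg : Z.image (· + x) = Z := by
        apply Finset.eq_of_subset_of_card_le
        · intro w hw
          obtain ⟨z, hz, rfl⟩ := Finset.mem_image.1 hw
          exact hx z hz
        · rw [Finset.card_image_of_injective _ (add_left_injective x)]
      intro z hz
      rw [← himg] at hz
      obtain ⟨w, hw, rfl⟩ := Finset.mem_image.1 hz
      simpa using hw
  obtain ⟨z, hz⟩ := hZ
  simpa using key (g - z) z hz

theorem exists_add_notMem {r : G} {Z : Finset G} (hZ : Z.Nonempty)
    (hr : AddSubgroup.closure {r} = ⊤) (hne : ∃ g, g ∉ Z) : ∃ z ∈ Z, z + r ∉ Z := by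
  by_contra! hc
  obtain ⟨g, hg⟩ := hne
  exact hg (forall_mem_of_add_mem hZ hr (by simpa using hc) g)

theorem pair_add_eq_union (r : G) (S : Finset G) : {0, r} + S = S ∪ (r +ᵥ S) := by
  rw [show ({0, r} : Finset G) = {0} ∪ {r} from rfl, Finset.union_add, Finset.singleton_add,
    Finset.singleton_add, zero_vadd]

/-- The elements of `S` whose successor `x + r` is not in `S`: the last elements of the maximal
`r`-progressions in `S`. -/
def rightEnds (r : G) (S : Finset G) : Finset G := S.filter (fun x => x + r ∉ S)

theorem mem_rightEnds {r x : G} {S : Finset G} : x ∈ rightEnds r S ↔ x ∈ S ∧ x + r ∉ S :=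
  Finset.mem_filter

/-- Adding `{0, r}` to `S` appends one element after each right end of `S`. -/
theorem card_pair_add (r : G) (S : Finset G) :
    ({0, r} + S).card = S.card + (rightEnds r S).card := by
  have h : {0, r} + S = S ∪ (r +ᵥ rightEnds r S) := by
    rw [pair_add_eq_union]
    ext x
    simp only [Finset.mem_union, mem_vadd_finset_iff, mem_rightEnds, sub_add_cancel]
    tauto
  rw [h, Finset.card_union_of_disjoint, Finset.card_vadd_finset]
  rw [Finset.disjoint_right]
  intro x hx
  rw [mem_vadd_finset_iff, mem_rightEnds, sub_add_cancel] at hx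
  exact hx.2

/-- A set with only one right end, in a group generated by `r`, is a progression. -/
theorem exists_eq_image_of_card_rightEnds_le_one {r : G} {S : Finset G} (hS : S.Nonempty)
    (hr : AddSubgroup.closure {r} = ⊤) (hne : ∃ g, g ∉ S) (hE : (rightEnds r S).card ≤ 1) :
    ∃ (a : G) (n : ℕ), S = (Finset.range (n + 1)).image (fun i : ℕ => a + i • r) ∧
      a + (n + 1) • r ∉ S := by
  classical
  obtain ⟨x₀, hx₀, hx₀r⟩ := exists_add_notMem hS hr hne
  have huniq : ∀ x ∈ S, x + r ∉ S → x = x₀ := fun x hx hxr =>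
    Finset.card_le_one.1 hE _ (mem_rightEnds.2 ⟨hx, hxr⟩) _ (mem_rightEnds.2 ⟨hx₀, hx₀r⟩)
  have hr' : AddSubgroup.closure {-r} = ⊤ := by
    rw [← Set.neg_singleton, AddSubgroup.closure_neg, hr]
  have hex : ∃ j : ℕ, x₀ - (j + 1) • r ∉ S := by
    by_contra! hc
    obtain ⟨g, hg⟩ := hne
    have := forall_mem_of_add_mem (Z := S.filter (fun x => ∃ j : ℕ, x = x₀ - j • r))
      (D := {-r}) ⟨x₀, Finset.mem_filter.2 ⟨hx₀, 0, by simp⟩⟩ hr' (by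
        simp only [Set.mem_singleton_iff, forall_eq, Finset.mem_filter]
        rintro z ⟨hz, j, rfl⟩
        have : x₀ - j • r + -r = x₀ - (j + 1) • r := by rw [succ_nsmul]; abel
        rw [this]
        exact ⟨hc j, j + 1, rfl⟩) g
    exact hg (Finset.mem_filter.1 this).1
  set j := Nat.find hex with hj
  have hjn : x₀ - (j + 1) • r ∉ S := Nat.find_spec hex
  have hjm : ∀ i ≤ j, x₀ - i • r ∈ S := by
    intro i hi
    rcases i with _ | i
    · simpa using hx₀
    · by_contra hc
      exact Nat.find_min hex (m := i) (by omega) hc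
  refine ⟨x₀ - j • r, j, ?_, ?_⟩
  swap
  · rw [succ_nsmul]
    rwa [show x₀ - j • r + (j • r + r) = x₀ + r by abel]
  set S' := (Finset.range (j + 1)).image (fun i : ℕ => x₀ - j • r + i • r) with hS'
  have hmem : ∀ x, x ∈ S' ↔ ∃ i ≤ j, x = x₀ - i • r := by
    intro x
    simp only [hS', Finset.mem_image, Finset.mem_range]
    constructor
    · rintro ⟨i, hi, rfl⟩
      refine ⟨j - i, by omega, ?_⟩
      have : j • r = (j - i) • r + i • r := by rw [← add_nsmul]; congr 1; omega
      rw [this]; abel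
    · rintro ⟨i, hi, rfl⟩
      refine ⟨j - i, by omega, ?_⟩
      have : j • r = (j - i) • r + i • r := by rw [← add_nsmul]; congr 1; omega
      rw [this]; abel
  have hsub : S' ⊆ S := by
    intro x hx
    obtain ⟨i, hi, rfl⟩ := (hmem x).1 hx
    exact hjm i hi
  refine (Finset.Subset.antisymm hsub ?_).symm
  rw [← Finset.sdiff_eq_empty_iff_subset]
  by_contra hcon
  have hx₀S' : x₀ ∈ S' := (hmem _).2 ⟨0, by omega, by simp⟩
  have hfull := forall_mem_of_add_mem (Z := S \ S') (D := {r})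
    (Finset.nonempty_iff_ne_empty.2 hcon) hr (by
      simp only [Set.mem_singleton_iff, forall_eq, Finset.mem_sdiff]
      rintro z ⟨hz, hzS'⟩
      have hzr : z + r ∈ S := by
        by_contra hc
        exact hzS' (huniq z hz hc ▸ hx₀S')
      refine ⟨hzr, fun hc => ?_⟩
      obtain ⟨i, hi, hi'⟩ := (hmem _).1 hc
      have hz' : z = x₀ - (i + 1) • r := by
        rw [succ_nsmul, ← sub_sub, ← hi']; abel
      rcases Nat.lt_or_ge i j with h | h
      · exact hzS' ((hmem _).2 ⟨i + 1, h, hz'⟩)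
      · have : i = j := by omega
        subst this
        exact hjn (hz' ▸ hz)) x₀
  exact (Finset.mem_sdiff.1 hfull).2 hx₀S'

end Progressions

/-! ### Sets with `κ₂(S) < |S|` -/

section Vosper

variable {G : Type*} [AddCommGroup G] [DecidableEq G]

/-- Every non-trivial proper finite subgroup `H` of `G` satisfies `|H + S| > |H| + κ`. -/
def SubgroupBound (κ : ℕ) (S : Finset G) : Prop :=
  ∀ (H : AddSubgroup G) (Y : Finset G), (Y : Set G) = H → 2 ≤ Y.card → H ≠ ⊤ →
    Y.card + κ + 1 ≤ (Y + S).card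

/-- If `A + S` is small and `A` meets its other translates in at most two elements, then `A`
generates `G`. -/
theorem closure_eq_top_of_subgroupBound {S A : Finset G} {κ : ℕ} (h0 : (0 : G) ∈ S)
    (hgen : AddSubgroup.closure (S : Set G) = ⊤) (hsub : SubgroupBound κ S)
    (hA0 : (0 : G) ∈ A) (hA2 : 2 ≤ A.card)
    (hA : ∀ x : G, x ≠ 0 → (A ∩ (x +ᵥ A)).card ≤ 2) (hAS : (A + S).card ≤ A.card + κ)
    (hκ : κ + 3 ≤ S.card + A.card) : AddSubgroup.closure (A : Set G) = ⊤ := by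
  rw [add_comm A S] at hAS
  rcases exists_coset_or_card_add_le hA0 hA ⟨0, h0⟩ (by omega) with ⟨g, hg⟩ | ⟨Y, hY, hYc⟩
  · apply addSubgroup_eq_top_of_closure hgen
    intro s hs
    have := AddSubgroup.sub_mem _ (hg s hs) (hg 0 h0)
    simpa using this
  · by_contra hne
    have hAY : A ⊆ Y := fun a ha => by
      rw [mem_iff_of_coe_eq hY]; exact AddSubgroup.subset_closure ha
    have := Finset.card_le_card hAY
    have := hsub _ Y hY (by omega) hne
    omega

/-- Two sets of sizes `h` and `k`, both meeting their other translates in at most one element,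
have a sumset of size `N ≥ h + k`; `h1` and `h2` are the two Cauchy–Schwarz bounds. -/
theorem false_of_sidon_bounds {h k N : ℕ} (hh : 3 ≤ h) (hk : 2 ≤ k) (hN : N + 1 ≤ h + k)
    (h1 : h ^ 2 * k + N * 1 ≤ N * (h + 1 * k)) (h2 : k ^ 2 * h + N * 1 ≤ N * (k + 1 * h)) :
    False := by
  zify at *
  have hM : (N : ℤ) * (h + k - 1) ≤ (h + k - 1) * (h + k - 1) := by
    apply mul_le_mul_of_nonneg_right <;> linarith
  have h1' : (h : ℤ) ^ 2 * k ≤ (h + k - 1) ^ 2 := by linarith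
  have h2' : (k : ℤ) ^ 2 * h ≤ (h + k - 1) ^ 2 := by linarith
  rcases le_or_gt (k : ℤ) h with hkh | hkh
  · rcases le_or_gt (4 : ℤ) k with h4 | h4
    · nlinarith [mul_le_mul_of_nonneg_left h4 (sq_nonneg (h : ℤ))]
    · have : (k : ℤ) = 2 ∨ (k : ℤ) = 3 := by omega
      rcases this with hk' | hk' <;> rw [hk'] at h1' <;> nlinarith
  · rcases le_or_gt (4 : ℤ) h with h4 | h4
    · nlinarith [mul_le_mul_of_nonneg_left h4 (sq_nonneg (k : ℤ))]
    · have : (h : ℤ) = 3 := by omega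
      rw [this] at h2'
      nlinarith

/-- Vosper's theorem in isoperimetric form: if `κ₂(S) < |S|`, then the `2`-atom of `S` is a pair
`{0, r}` that generates `G`. If the atom `A` had more elements, then `κ₂(A) < |A|`, because `S` is
a candidate, and `A` and the `2`-atom `M` of `A`, which both meet their other translates in at
most one element, would have too small a sum. -/
theorem exists_pair_of_two_connectivity_lt {S X : Finset G} {κ : ℕ} (h0 : (0 : G) ∈ S)
    (hgen : AddSubgroup.closure (S : Set G) = ⊤) (hs : 2 ≤ S.card) (hκ : κ + 1 ≤ S.card)
    (hsub : SubgroupBound κ S) (hX : IsSep 2 0 S X) (hXκ : (X + S).card ≤ X.card + κ) :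
    ∃ r : G, AddSubgroup.closure {r} = ⊤ ∧ ({0, r} + S).card ≤ S.card + 1 := by
  have hSne : S.Nonempty := ⟨0, h0⟩
  obtain ⟨κ', hκ', A₁, hA₁⟩ := exists_isAtomOf hSne hX hXκ
  obtain ⟨a, ha⟩ := Finset.card_pos.1 (lt_of_lt_of_le two_pos hA₁.sep.le_card)
  have hA := hA₁.vadd (-a)
  set A := -a +ᵥ A₁ with hAdef
  have hA0 : (0 : G) ∈ A := by rw [hAdef, mem_vadd_finset_iff]; simpa using ha
  have hA2 := hA.sep.le_card
  have hAS := hA.card_add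
  rcases hA.card_inter_lt_or_exists_addSubgroup hSne one_le_two with hsid | ⟨H, Y, hY, hY2, hr, hc⟩
  swap
  · have := hsub H Y hY hY2 (ne_top_of_leCard hSne hY hr)
    omega
  have hAtop : AddSubgroup.closure (A : Set G) = ⊤ :=
    closure_eq_top_of_subgroupBound h0 hgen hsub hA0 hA2
      (fun x hx => (hsid x hx).le) (by omega) (by omega)
  rcases Nat.lt_or_ge A.card 3 with h3 | h3
  · obtain ⟨r, hr, hrA⟩ : ∃ r : G, r ≠ 0 ∧ A = {0, r} := by
      obtain ⟨r, hr, hr0⟩ := Finset.exists_mem_ne hA2 0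
      refine ⟨r, hr0, (Finset.eq_of_subset_of_card_le ?_ ?_).symm⟩
      · intro x hx
        rcases Finset.mem_insert.1 hx with rfl | hx
        · exact hA0
        · rw [Finset.mem_singleton.1 hx]; exact hr
      · rw [Finset.card_pair hr0.symm]; omega
    refine ⟨r, ?_, ?_⟩
    · rw [← hAtop, hrA]
      simp [AddSubgroup.closure_insert_zero]
    · rw [← hrA, hAS]; omega
  exfalso
  have hAne : A.Nonempty := ⟨0, hA0⟩
  obtain ⟨κ₂, hκ₂, M, hM⟩ := exists_isAtomOf (k := 2) (q := 0) (c := A.card - 1) (X := S) hAne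
    ⟨hs, by rw [add_comm S A]; exact hA.sep.room, zero_vadd _ _⟩ (by rw [add_comm S A]; omega)
  have hMA := hM.card_add
  rcases hM.card_inter_lt_or_exists_addSubgroup hAne one_le_two with hsidM | ⟨H, Y, hY, hY2, hr, hc⟩
  · have hMne : M.Nonempty := Finset.card_pos.1 (lt_of_lt_of_le two_pos hM.sep.le_card)
    have e1 := sq_card_mul_card_le (A := A) (B := M) (c := 1) hMne
      (fun x hx => Nat.le_of_lt_succ (hsid x hx))
    have e2 := sq_card_mul_card_le (A := M) (B := A) (c := 1) hAne
      (fun x hx => Nat.le_of_lt_succ (hsidM x hx))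
    rw [add_comm A M] at e1
    exact false_of_sidon_bounds h3 hM.sep.le_card (by omega) e1 e2
  · have h2 := two_mul_card_le_card_add hA0 hAtop hY (ne_top_of_leCard hAne hY hr)
    obtain ⟨x, hx, hx0⟩ := Finset.exists_mem_ne hY2 0
    have := two_mul_card_le_of_mem (A := A) hY ((mem_iff_of_coe_eq hY).1 hx)
    have := hsid x hx0
    omega

end Vosper

/-! ### Connectivity and degenerate sets -/

section Connectivity

variable {G : Type*} [AddCommGroup G] [DecidableEq G]

theorem isKSeparating_iff {k : ℕ} {S X : Finset G} : IsKSeparating k S X ↔ IsSep k 0 S X := by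
  have hext : addExterior S X = ((X + S : Finset G) : Set G)ᶜ := rfl
  have h := Set.encard_add_encard_compl ((X + S : Finset G) : Set G)
  rw [Set.encard_univ, Set.encard_coe_eq_coe_finsetCard] at h
  constructor
  · rintro ⟨h1, h2⟩
    refine ⟨h1, ?_, zero_vadd _ _⟩
    rw [LeCard, ← h, Nat.cast_add, ← hext]
    gcongr
  · rintro ⟨h1, h2, -⟩
    refine ⟨h1, ?_⟩
    rw [LeCard, ← h, Nat.cast_add, ← hext] at h2
    exact (ENat.add_le_add_iff_left (ENat.natCast_ne_top _)).1 h2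

theorem card_addBoundary {S : Finset G} (h0 : (0 : G) ∈ S) (X : Finset G) :
    X.card + (addBoundary S X).card = (X + S).card := by
  have hsub : X ⊆ X + S := fun x hx => by simpa using Finset.add_mem_add hx h0
  rw [addBoundary, Finset.card_sdiff_of_subset hsub]
  have := Finset.card_le_card hsub
  omega

theorem exists_card_add_eq_connectivity {k : ℕ} {S X : Finset G} (h0 : (0 : G) ∈ S)
    (hX : IsSep k 0 S X) :
    ∃ Y, IsSep k 0 S Y ∧ (Y + S).card = Y.card + connectivity k S := by
  classical
  have hex : ∃ X : Finset G, IsKSeparating k S X := ⟨X, isKSeparating_iff.2 hX⟩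
  have hne : {m : ℕ | ∃ X : Finset G, IsKSeparating k S X ∧ (addBoundary S X).card = m}.Nonempty :=
    ⟨_, X, isKSeparating_iff.2 hX, rfl⟩
  obtain ⟨Y, hY, hYc⟩ := Nat.sInf_mem hne
  refine ⟨Y, isKSeparating_iff.1 hY, ?_⟩
  rw [← card_addBoundary h0, hYc, connectivity, if_pos hex]

theorem card_add_connectivity_le {k : ℕ} {S X : Finset G} (h0 : (0 : G) ∈ S)
    (hX : IsSep k 0 S X) : X.card + connectivity k S ≤ (X + S).card := by
  classical
  have hex : ∃ X : Finset G, IsKSeparating k S X := ⟨X, isKSeparating_iff.2 hX⟩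
  rw [← card_addBoundary h0, connectivity, if_pos hex]
  refine Nat.add_le_add_left (Nat.sInf_le ?_) _
  exact ⟨X, isKSeparating_iff.2 hX, rfl⟩

/-- Without a separating set, the convention in the definition of `κ_k(S)` applies and `G` is
finite. -/
theorem finite_and_connectivity_eq {k : ℕ} {S : Finset G} (h : ¬ ∃ X, IsSep k 0 S X) :
    Finite G ∧ connectivity k S = Nat.card G + 1 - 2 * k := by
  classical
  constructor
  · by_contra hfin
    rw [not_finite_iff_infinite] at hfin
    obtain ⟨X, hX⟩ := Infinite.exists_subset_card_eq G k
    exact h ⟨X, hX.ge, leCard_of_infinite _, zero_vadd _ _⟩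
  · rw [connectivity, if_neg]
    rintro ⟨X, hX⟩
    exact h ⟨X, isKSeparating_iff.1 hX⟩

/-- A proper finite subgroup `H` with at least two elements is `2`-separating unless `H + S = G`,
and it is not a `2`-fragment if `S` is non-degenerate. -/
theorem subgroupBound_of_not_isDegenerate {S : Finset G} (h0 : (0 : G) ∈ S)
    (hgen : AddSubgroup.closure (S : Set G) = ⊤) (hnd : ¬ IsDegenerate S)
    (hcard : LeCard G (2 * connectivity 2 S + 1)) : SubgroupBound (connectivity 2 S) S := by
  intro H Y hY hY2 hH
  by_cases hfull : ∀ g, g ∈ Y + S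
  · have h1 := hcard.le_card hfull
    have h2 := two_mul_card_le_card_add h0 hgen hY hH
    omega
  push Not at hfull
  obtain ⟨g, hg⟩ := hfull
  have hdisj : Disjoint (Y + S) (g +ᵥ Y) := by
    rw [Finset.disjoint_left]
    intro z hz hz'
    rw [mem_vadd_finset_iff, mem_iff_of_coe_eq hY] at hz'
    obtain ⟨y, hy, s, hs, rfl⟩ := Finset.mem_add.1 hz
    rw [mem_iff_of_coe_eq hY] at hy
    apply hg
    have : y - (y + s - g) ∈ Y := by
      rw [mem_iff_of_coe_eq hY]; exact H.sub_mem hy hz'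
    have h2 := Finset.add_mem_add this hs
    rwa [show y - (y + s - g) + s = g by abel] at h2
  have hsep : IsSep 2 0 S Y := by
    refine ⟨hY2, ?_, zero_vadd _ _⟩
    have := leCard_card ((Y + S) ∪ (g +ᵥ Y))
    rw [Finset.card_union_of_disjoint hdisj, Finset.card_vadd_finset] at this
    exact this.mono (by omega)
  have h1 := card_add_connectivity_le h0 hsep
  have h2 : (Y + S).card ≠ Y.card + connectivity 2 S := by
    intro heq
    refine hnd ⟨H, Y, hY, isKSeparating_iff.2 hsep, ?_⟩
    have := card_addBoundary h0 Y
    omega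
  omega

/-- A non-degenerate set with `κ₂(S) < |S|` has at most one right end for some generator `r` of
`G`. This includes the groups of order five, which have no `2`-separating sets. -/
theorem exists_pair_of_not_isDegenerate {S : Finset G} (h0 : (0 : G) ∈ S)
    (hgen : AddSubgroup.closure (S : Set G) = ⊤) (h3 : 3 ≤ S.card)
    (hcard : LeCard G (2 * S.card - 1)) (hκ : connectivity 2 S + 1 ≤ S.card)
    (hnd : ¬ IsDegenerate S) :
    ∃ r : G, AddSubgroup.closure {r} = ⊤ ∧ ({0, r} + S).card ≤ S.card + 1 := by
  by_cases hex : ∃ X, IsSep 2 0 S X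
  · obtain ⟨X, hX⟩ := hex
    obtain ⟨Y, hY, hYc⟩ := exists_card_add_eq_connectivity h0 hX
    exact exists_pair_of_two_connectivity_lt h0 hgen (by omega) hκ
      (subgroupBound_of_not_isDegenerate h0 hgen hnd (hcard.mono (by omega))) hY hYc.le
  -- Without a separating set, `|G| = 5` and `|S| = 3`, and the complement of `S` is a pair.
  obtain ⟨hfin, hconn⟩ := finite_and_connectivity_eq hex
  have := Fintype.ofFinite G
  rw [leCard_iff_of_finite] at hcard
  have h5 : Nat.card G = 5 := by omega
  have hS3 : S.card = 3 := by omega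
  have hprime : Fact (Nat.Prime 5) := ⟨by norm_num⟩
  have hcompl : 1 < Sᶜ.card := by
    rw [Finset.card_compl, ← Nat.card_eq_fintype_card]; omega
  obtain ⟨c, hc, d, hd, hcd⟩ := Finset.one_lt_card.1 hcompl
  rw [Finset.mem_compl] at hc hd
  refine ⟨d - c, ?_, ?_⟩
  · rw [eq_top_iff]
    intro g _
    rw [← AddSubgroup.zmultiples_eq_closure]
    exact mem_zmultiples_of_prime_card h5 (sub_ne_zero.2 hcd.symm)
  · have : ({0, d - c} + S) ⊆ Finset.univ.erase d := by
      rw [pair_add_eq_union]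
      intro x hx
      rw [Finset.mem_union, mem_vadd_finset_iff] at hx
      rw [Finset.mem_erase]
      refine ⟨?_, Finset.mem_univ _⟩
      rintro rfl
      rcases hx with hx | hx
      · exact hd hx
      · rw [sub_sub_cancel] at hx; exact hc hx
    have := Finset.card_le_card this
    rw [Finset.card_erase_of_mem (Finset.mem_univ _), Finset.card_univ,
      ← Nat.card_eq_fintype_card] at this
    omega

end Connectivity

/-! ### Sets with two right ends -/

section Ends

variable {G : Type*} [AddCommGroup G] [DecidableEq G]

theorem card_rightEnds_neg (r : G) (S : Finset G) :
    (rightEnds (-r) S).card = (rightEnds r S).card := by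
  have h1 := card_pair_add r S
  have h2 := card_pair_add (-r) S
  have h3 : ({0, -r} : Finset G) = -r +ᵥ ({0, r} : Finset G) := by
    ext x
    simp only [Finset.mem_insert, Finset.mem_singleton, mem_vadd_finset_iff, sub_neg_eq_add]
    constructor
    · rintro (rfl | rfl) <;> simp
    · rintro (h | h)
      · exact Or.inr (eq_neg_of_add_eq_zero_left h)
      · exact Or.inl (by simpa using h)
  rw [h3, vadd_add_assoc, Finset.card_vadd_finset] at h2
  omega

theorem mem_rightEnds_neg {r x : G} {S : Finset G} :
    x ∈ rightEnds (-r) S ↔ x ∈ S ∧ x - r ∉ S := by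
  rw [mem_rightEnds, sub_eq_add_neg]

theorem eq_or_eq_of_card_eq_two {α : Type*} {E : Finset α} (hE : E.card = 2) {a b c : α}
    (ha : a ∈ E) (hb : b ∈ E) (hab : a ≠ b) (hc : c ∈ E) : c = a ∨ c = b := by
  classical
  have : E = {a, b} := by
    refine (Finset.eq_of_subset_of_card_le ?_ ?_).symm
    · intro x hx
      rcases Finset.mem_insert.1 hx with rfl | hx
      · exact ha
      · rw [Finset.mem_singleton.1 hx]; exact hb
    · rw [Finset.card_pair hab]; omega
  rw [this] at hc
  simpa using hc

/-- A two-element set invariant under a non-trivial translation: the translation has order two. -/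
theorem two_nsmul_eq_zero_of_sub_mem {G : Type*} [AddCommGroup G] {E : Finset G}
    (hE : E.card = 2) {w : G} (hw : w ≠ 0) (h : ∀ x ∈ E, x - w ∈ E) : (2 : ℕ) • w = 0 := by
  obtain ⟨x, hx⟩ := Finset.card_pos.1 (by omega : 0 < E.card)
  have h1 := h x hx
  have h2 := h _ h1
  have hne : x ≠ x - w := fun hc => hw (sub_eq_self.1 hc.symm)
  rcases eq_or_eq_of_card_eq_two hE hx h1 hne h2 with h3 | h3
  · have : x - w - w = x - 2 • w := by rw [two_nsmul]; abel
    rw [this] at h3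
    simpa using h3
  · exact absurd (by simpa using h3) hw

/-- `S` cannot have two right ends for the difference `d` if `{0, d, 2d, w} + S` coincides with
`{0, d, 2d} + S` and with the sums obtained by leaving out `0` or `2d` instead of `w`. -/
theorem false_of_three_term_progression {S : Finset G} {d w : G} (hSne : S.Nonempty)
    (hgen : AddSubgroup.closure {d, w} = ⊤) (hw : w ≠ 0) (hwd : w ≠ d + d)
    (hw2 : (2 : ℕ) • w ≠ 0) (hcard : LeCard G (S.card + 7))
    (hE : (rightEnds d S).card = 2) (hE2 : ∀ x ∈ rightEnds d S, x + d + d ∉ S)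
    {Y : Finset G} (hYc : Y.card = S.card + 4)
    (hY : ∀ y, y ∈ Y ↔ y ∈ S ∨ y - d ∈ S ∨ y - d - d ∈ S) (hwY : ∀ x ∈ S, x + w ∈ Y)
    (hR : ∀ x ∈ rightEnds d S, x + d + d - w ∈ S) (hL : ∀ x ∈ rightEnds (-d) S, x - w ∈ S) :
    False := by
  classical
  have hSY : ∀ x ∈ S, x ∈ Y := fun x hx => (hY x).2 (Or.inl hx)
  have hYne : Y.Nonempty := hSne.mono hSY
  have hL2 : (rightEnds (-d) S).card = 2 := by rw [card_rightEnds_neg, hE]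
  have hRY : ∀ y ∈ rightEnds d Y, y - d - d ∈ rightEnds d S := by
    intro y hy
    rw [mem_rightEnds, hY (y + d)] at hy
    push Not at hy
    obtain ⟨h1, h2, h3, h4⟩ := hy
    rw [add_sub_cancel_right] at h3 h4
    rcases (hY y).1 h1 with h | h | h
    · exact absurd h h3
    · exact absurd h h4
    · rw [mem_rightEnds, sub_add_cancel]; exact ⟨h, h4⟩
  have hLY : ∀ y ∈ rightEnds (-d) Y, y ∈ rightEnds (-d) S := by
    intro y hy
    rw [mem_rightEnds_neg] at hy ⊢
    obtain ⟨h1, h2⟩ := hy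
    rw [hY] at h2
    push Not at h2
    rcases (hY y).1 h1 with h | h | h
    · exact ⟨h, h2.1⟩
    · exact absurd h h2.1
    · exact absurd h h2.2.1
  have hRw : ∀ y ∈ rightEnds d Y, y - w ∈ rightEnds d S := by
    intro y hy
    have h1 := hR _ (hRY y hy)
    rw [sub_add_cancel, sub_add_cancel] at h1
    refine mem_rightEnds.2 ⟨h1, fun hc => (mem_rightEnds.1 hy).2 ?_⟩
    have := hwY _ hc
    rwa [show y - w + d + w = y + d by abel] at this
  have hLw : ∀ y ∈ rightEnds (-d) Y, y - w ∈ rightEnds (-d) S := by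
    intro y hy
    have h1 := hL _ (hLY y hy)
    refine mem_rightEnds_neg.2 ⟨h1, fun hc => (mem_rightEnds_neg.1 hy).2 ?_⟩
    have := hwY _ hc
    rwa [show y - w - d + w = y - d by abel] at this
  have hLYc : (rightEnds (-d) Y).card ≤ 2 := by
    rw [← hL2]; exact Finset.card_le_card hLY
  have hcardeq := card_rightEnds_neg d Y
  obtain h0 | h1 | h2 : (rightEnds (-d) Y).card = 0 ∨ (rightEnds (-d) Y).card = 1 ∨
    (rightEnds (-d) Y).card = 2 := by omega
  · have hclosed : ∀ y ∈ Y, y + d ∈ Y := by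
      intro y hy
      by_contra hc
      have := Finset.card_pos.2 ⟨y, mem_rightEnds.2 ⟨hy, hc⟩⟩
      omega
    have := hcard.le_card (forall_mem_of_add_mem hYne hgen (by
      simp only [Set.mem_insert_iff, Set.mem_singleton_iff, forall_eq_or_imp, forall_eq]
      refine ⟨hclosed, fun z hz => ?_⟩
      rcases (hY z).1 hz with h | h | h
      · exact hwY z h
      · have := hclosed _ (hwY _ h)
        rwa [show z - d + w + d = z + w by abel] at this
      · have := hclosed _ (hclosed _ (hwY _ h))
        rwa [show z - d - d + w + d + d = z + w by abel] at this))
    omega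
  · obtain ⟨ρ, hρ⟩ := Finset.card_pos.1 (by omega : 0 < (rightEnds d Y).card)
    obtain ⟨l, hl⟩ := Finset.card_pos.1 (by omega : 0 < (rightEnds (-d) Y).card)
    obtain ⟨x₂, rfl⟩ : ∃ x₂, ρ = x₂ + d + d := ⟨ρ - d - d, by abel⟩
    have hx₂ := hRY _ hρ
    rw [add_sub_cancel_right, add_sub_cancel_right] at hx₂
    have hx₁ := hRw _ hρ
    set x₁ := x₂ + d + d - w with hx₁def
    have hx₁₂ : x₁ ≠ x₂ := by
      intro hc
      apply hwd
      have : x₂ + d + d - w - x₂ = 0 := by rw [← hx₁def, hc, sub_self]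
      rw [show x₂ + d + d - w - x₂ = d + d - w by abel] at this
      exact (sub_eq_zero.1 this).symm
    have hx₁Y : x₁ + d + d ∈ Y := by
      rw [hY]; right; right
      simpa using (mem_rightEnds.1 hx₁).1
    have hx₁S : x₁ + d + d + d ∈ S := by
      have h3 : x₁ + d + d + d ∈ Y := by
        by_contra hc
        have h4 : x₁ + d + d = x₂ + d + d :=
          Finset.card_le_one.1 (by omega) _ (mem_rightEnds.2 ⟨hx₁Y, hc⟩) _ hρ
        exact hx₁₂ (by simpa using h4)
      rcases (hY _).1 h3 with h | h | h
      · exact h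
      · rw [add_sub_cancel_right] at h
        exact absurd h (hE2 _ hx₁)
      · rw [add_sub_cancel_right, add_sub_cancel_right] at h
        exact absurd h (mem_rightEnds.1 hx₁).2
    have hl₁ : x₁ + d + d + d ∈ rightEnds (-d) S := by
      rw [mem_rightEnds_neg, add_sub_cancel_right]
      exact ⟨hx₁S, hE2 _ hx₁⟩
    have hl₁l : x₁ + d + d + d ≠ l := by
      rintro rfl
      apply (mem_rightEnds_neg.1 hl).2
      rwa [add_sub_cancel_right]
    have hlw : l - w = x₁ + d + d + d := by
      rcases eq_or_eq_of_card_eq_two hL2 hl₁ (hLY _ hl) hl₁l (hLw _ hl) with h | h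
      · exact h
      · exact absurd (by simpa using h) hw
    have hl' : l = x₂ + d + d + d + d + d := by
      rw [← sub_add_cancel l w, hlw, hx₁def]; abel
    -- The gap after `x₂` has four elements, so that adding two of them to `Y` closes it.
    set Z := insert (x₂ + d + d + d) (insert (x₂ + d + d + d + d) Y) with hZ
    have hZmem : ∀ z, z ∈ Z ↔ z = x₂ + d + d + d ∨ z = x₂ + d + d + d + d ∨ z ∈ Y := by
      intro z; simp [hZ]
    have hZd : ∀ z ∈ Z, z + d ∈ Z := by
      intro z hz
      rw [hZmem] at hz ⊢
      rcases hz with rfl | rfl | hz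
      · exact Or.inr (Or.inl rfl)
      · right; right
        rw [← hl']
        exact (mem_rightEnds.1 hl).1
      · by_cases hzd : z + d ∈ Y
        · exact Or.inr (Or.inr hzd)
        · left
          have : z = x₂ + d + d :=
            Finset.card_le_one.1 (by omega) _ (mem_rightEnds.2 ⟨hz, hzd⟩) _ hρ
          rw [this]
    have hYZ : ∀ y ∈ Y, y ∈ Z := fun y hy => (hZmem y).2 (Or.inr (Or.inr hy))
    have hx₂S := (mem_rightEnds.1 hx₂).1
    have h7 := hcard.le_card (forall_mem_of_add_mem (hYne.mono hYZ) hgen (by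
      simp only [Set.mem_insert_iff, Set.mem_singleton_iff, forall_eq_or_imp, forall_eq]
      refine ⟨hZd, fun z hz => ?_⟩
      rcases (hZmem z).1 hz with rfl | rfl | hz
      · have := hZd _ (hZd _ (hZd _ (hYZ _ (hwY _ hx₂S))))
        rwa [show x₂ + w + d + d + d = x₂ + d + d + d + w by abel] at this
      · have := hZd _ (hZd _ (hZd _ (hZd _ (hYZ _ (hwY _ hx₂S)))))
        rwa [show x₂ + w + d + d + d + d = x₂ + d + d + d + d + w by abel] at this
      · rcases (hY z).1 hz with h | h | h
        · exact hYZ _ (hwY z h)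
        · have := hZd _ (hYZ _ (hwY _ h))
          rwa [show z - d + w + d = z + w by abel] at this
        · have := hZd _ (hZd _ (hYZ _ (hwY _ h)))
          rwa [show z - d - d + w + d + d = z + w by abel] at this))
    have h8 : Z.card ≤ Y.card + 2 := by
      refine (Finset.card_insert_le _ _).trans ?_
      have := Finset.card_insert_le (x₂ + d + d + d + d) Y
      omega
    omega
  · have heq : rightEnds (-d) Y = rightEnds (-d) S :=
      Finset.eq_of_subset_of_card_le hLY (by omega)
    exact hw2 (two_nsmul_eq_zero_of_sub_mem hL2 hw (by rw [← heq] at hLw ⊢; exact hLw))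

/-- If `Y` has two elements more than `M` and fills exactly one of the gaps of `M` at least
partially, then it fills a gap of length two. -/
theorem eq_add_of_card_sdiff_eq_two {M Y : Finset G} {x ρ l : G} (hx : x ≠ 0)
    (hx2 : x + x ≠ 0) (hcard : (Y \ M).card = 2)
    (hr : ∀ z ∈ Y, z ∉ M → z + x ∈ Y) (hl : ∀ z ∈ Y, z ∉ M → z - x ∈ Y)
    (hρ : ρ ∈ rightEnds x M) (hρY : ρ + x ∈ Y)
    (hρ' : ∀ ρ' ∈ rightEnds x M, ρ' ≠ ρ → ρ' + x ∉ Y)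
    (hl' : ∀ l' ∈ rightEnds (-x) M, l' ≠ l → l' - x ∉ Y) :
    l = ρ + x + x + x ∧ ∀ z ∈ Y, z ∉ M → z = ρ + x ∨ z = ρ + x + x := by
  have hρM := (mem_rightEnds.1 hρ).2
  have hz1 : ρ + x ∈ Y \ M := Finset.mem_sdiff.2 ⟨hρY, hρM⟩
  have hz1x := hr _ hρY hρM
  by_cases h : ρ + x + x ∈ M
  · exfalso
    obtain ⟨z₂, hz₂, hz₂1⟩ := Finset.exists_mem_ne (by omega : 1 < (Y \ M).card) (ρ + x)
    obtain ⟨hz₂Y, hz₂M⟩ := Finset.mem_sdiff.1 hz₂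
    have h3 := hl _ hz₂Y hz₂M
    by_cases h4 : z₂ - x ∈ M
    · have h5 : z₂ - x ∈ rightEnds x M := mem_rightEnds.2 ⟨h4, by simpa using hz₂M⟩
      by_cases h6 : z₂ - x = ρ
      · exact hz₂1 (by rw [← h6]; abel)
      · exact hρ' _ h5 h6 (by simpa using hz₂Y)
    · rcases eq_or_eq_of_card_eq_two hcard hz1 hz₂ hz₂1.symm
        (Finset.mem_sdiff.2 ⟨h3, h4⟩) with h5 | h5
      · apply hz₂M
        rwa [← h5, sub_add_cancel] at h
      · exact hx (by simpa using h5)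
  · have hz2 : ρ + x + x ∈ Y \ M := Finset.mem_sdiff.2 ⟨hz1x, h⟩
    have hne : ρ + x ≠ ρ + x + x := fun hc => hx (by simpa using hc)
    have hz2x := hr _ hz1x h
    have h3 : ρ + x + x + x ∈ M := by
      by_contra hc
      rcases eq_or_eq_of_card_eq_two hcard hz1 hz2 hne (Finset.mem_sdiff.2 ⟨hz2x, hc⟩) with h5 | h5
      · rw [add_assoc (ρ + x)] at h5
        exact hx2 (by simpa using h5)
      · exact hx (by simpa using h5)
    refine ⟨?_, fun z hz hzM =>
      eq_or_eq_of_card_eq_two hcard hz1 hz2 hne (Finset.mem_sdiff.2 ⟨hz, hzM⟩)⟩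
    by_contra hc
    refine hl' (ρ + x + x + x) ?_ (Ne.symm hc) ?_
    · rw [mem_rightEnds_neg, add_sub_cancel_right]; exact ⟨h3, h⟩
    · rw [add_sub_cancel_right]; exact hz1x

theorem mem_rightEnds_vadd {x y z : G} {M : Finset G} :
    z ∈ rightEnds x (y +ᵥ M) ↔ z - y ∈ rightEnds x M := by
  rw [mem_rightEnds, mem_rightEnds, mem_vadd_finset_iff, mem_vadd_finset_iff, add_sub_right_comm]

/-- A set `M` with two right ends for the difference `x` cannot differ from its translate `y + M`
in two elements only, if none of the elements of the difference is at an end of a maximal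
`x`-progression. -/
theorem false_of_parallelogram {M : Finset G} {x y : G} (hMne : M.Nonempty)
    (hgen : AddSubgroup.closure {x, y} = ⊤) (hx : x ≠ 0) (hx2 : x + x ≠ 0) (hy : y ≠ 0)
    (hy2 : (2 : ℕ) • y ≠ 0) (hcard : LeCard G (M.card + 5)) (hE : (rightEnds x M).card = 2)
    (hYc : (M ∪ (y +ᵥ M)).card = M.card + 2)
    (h1 : ∀ z ∈ y +ᵥ M, z ∉ M → z + x ∈ y +ᵥ M ∧ z - x ∈ y +ᵥ M)
    (h2 : ∀ z ∈ M, z ∉ y +ᵥ M → z + x ∈ M ∧ z - x ∈ M) : False := by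
  classical
  set Y := M ∪ (y +ᵥ M) with hY
  have hMY : M ⊆ Y := Finset.subset_union_left
  have hMY' : y +ᵥ M ⊆ Y := Finset.subset_union_right
  have hyM : ∀ z ∈ M, z + y ∈ Y := fun z hz => hMY' (by
    rw [mem_vadd_finset_iff, add_sub_cancel_right]; exact hz)
  have hmem : ∀ z ∈ Y, z ∉ M → z ∈ y +ᵥ M := fun z hz hzM =>
    (Finset.mem_union.1 hz).resolve_left hzM
  have hmem' : ∀ z ∈ Y, z ∉ y +ᵥ M → z ∈ M := fun z hz hzM =>
    (Finset.mem_union.1 hz).resolve_right hzM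
  have hL2 : (rightEnds (-x) M).card = 2 := by rw [card_rightEnds_neg, hE]
  have hRY : ∀ v ∈ rightEnds x Y, v ∈ rightEnds x M := by
    intro v hv
    rw [mem_rightEnds] at hv ⊢
    refine ⟨?_, fun hc => hv.2 (hMY hc)⟩
    by_contra hc
    exact hv.2 (hMY' (h1 v (hmem v hv.1 hc) hc).1)
  have hLY : ∀ v ∈ rightEnds (-x) Y, v ∈ rightEnds (-x) M := by
    intro v hv
    rw [mem_rightEnds_neg] at hv ⊢
    refine ⟨?_, fun hc => hv.2 (hMY hc)⟩
    by_contra hc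
    exact hv.2 (hMY' (h1 v (hmem v hv.1 hc) hc).2)
  have hRy : ∀ v ∈ rightEnds x Y, v - y ∈ rightEnds x M := by
    intro v hv
    rw [← mem_rightEnds_vadd]
    rw [mem_rightEnds] at hv ⊢
    refine ⟨?_, fun hc => hv.2 (hMY' hc)⟩
    by_contra hc
    exact hv.2 (hMY (h2 v (hmem' v hv.1 hc) hc).1)
  have hLy : ∀ v ∈ rightEnds (-x) Y, v - y ∈ rightEnds (-x) M := by
    intro v hv
    rw [← mem_rightEnds_vadd]
    rw [mem_rightEnds_neg] at hv ⊢
    refine ⟨?_, fun hc => hv.2 (hMY' hc)⟩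
    by_contra hc
    exact hv.2 (hMY (h2 v (hmem' v hv.1 hc) hc).2)
  have hRYc : (rightEnds x Y).card ≤ 2 := by
    rw [← hE]; exact Finset.card_le_card hRY
  have hcardeq := card_rightEnds_neg x Y
  have hdiff : (Y \ M).card = 2 := by
    rw [Finset.card_sdiff_of_subset hMY]; omega
  have hdiff' : (Y \ (y +ᵥ M)).card = 2 := by
    rw [Finset.card_sdiff_of_subset hMY', Finset.card_vadd_finset]; omega
  have hr : ∀ z ∈ Y, z ∉ M → z + x ∈ Y := fun z hz hzM => hMY' (h1 z (hmem z hz hzM) hzM).1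
  have hl : ∀ z ∈ Y, z ∉ M → z - x ∈ Y := fun z hz hzM => hMY' (h1 z (hmem z hz hzM) hzM).2
  obtain h | h | h : (rightEnds x Y).card = 0 ∨ (rightEnds x Y).card = 1 ∨
    (rightEnds x Y).card = 2 := by omega
  · have hR0 : ∀ y ∈ Y, y + x ∈ Y := by
      intro y hy
      by_contra hc
      have := Finset.card_pos.2 ⟨y, mem_rightEnds.2 ⟨hy, hc⟩⟩
      omega
    have hL0 : ∀ y ∈ Y, y - x ∈ Y := by
      intro y hy
      by_contra hc
      have := Finset.card_pos.2 ⟨y, mem_rightEnds_neg.2 ⟨hy, hc⟩⟩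
      omega
    have := hcard.le_card (forall_mem_of_add_mem (hMne.mono hMY) hgen (by
      simp only [Set.mem_insert_iff, Set.mem_singleton_iff, forall_eq_or_imp, forall_eq]
      refine ⟨hR0, fun z hz => ?_⟩
      by_cases hz0 : z ∈ M
      · exact hyM z hz0
      by_cases hz1 : z + x ∈ M
      · have := hL0 _ (hyM _ hz1)
        rwa [show z + x + y - x = z + y by abel] at this
      by_cases hz2 : z + x + x ∈ M
      · have := hL0 _ (hL0 _ (hyM _ hz2))
        rwa [show z + x + x + y - x - x = z + y by abel] at this
      -- Three elements of the `x`-orbit of `z` cannot all lie in the two-element set `Y \ M`.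
      exfalso
      rcases eq_or_eq_of_card_eq_two hdiff (Finset.mem_sdiff.2 ⟨hz, hz0⟩)
        (Finset.mem_sdiff.2 ⟨hR0 _ hz, hz1⟩) (fun hc => hx (by simpa using hc))
        (Finset.mem_sdiff.2 ⟨hR0 _ (hR0 _ hz), hz2⟩) with h5 | h5
      · rw [add_assoc] at h5
        exact hx2 (by simpa using h5)
      · exact hx (by simpa using h5)))
    omega
  · obtain ⟨ρ₂, hρ₂⟩ := Finset.card_pos.1 (by omega : 0 < (rightEnds x Y).card)
    obtain ⟨l₂, hl₂⟩ := Finset.card_pos.1 (by omega : 0 < (rightEnds (-x) Y).card)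
    have hR1 : ∀ v ∈ Y, v ≠ ρ₂ → v + x ∈ Y := fun v hv hne => by
      by_contra hc
      exact hne (Finset.card_le_one.1 (by omega) _ (mem_rightEnds.2 ⟨hv, hc⟩) _ hρ₂)
    have hl₁₂ : l₂ - y ≠ l₂ := by simpa using hy
    have hρ₁₂ : ρ₂ - y ≠ ρ₂ := by simpa using hy
    obtain ⟨-, hρ₂x⟩ := mem_rightEnds.1 hρ₂
    obtain ⟨hl₂Y, hl₂x⟩ := mem_rightEnds_neg.1 hl₂
    obtain ⟨-, hdesc⟩ := eq_add_of_card_sdiff_eq_two (l := l₂ - y) hx hx2 hdiff hr hl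
      (hRy _ hρ₂) (hR1 _ (hMY (mem_rightEnds.1 (hRy _ hρ₂)).1) hρ₁₂)
      (fun ρ' hρ' hne => by
        rcases eq_or_eq_of_card_eq_two hE (hRy _ hρ₂) (hRY _ hρ₂) hρ₁₂ hρ' with h5 | h5
        · exact absurd h5 hne
        · rwa [h5])
      (fun l' hl' hne => by
        rcases eq_or_eq_of_card_eq_two hL2 (hLy _ hl₂) (hLY _ hl₂) hl₁₂ hl' with h5 | h5
        · exact absurd h5 hne
        · rwa [h5])
    have hρ₂R : ρ₂ + y ∈ rightEnds x (y +ᵥ M) := by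
      rw [mem_rightEnds_vadd, add_sub_cancel_right]; exact hRY _ hρ₂
    obtain ⟨hl₂eq, -⟩ := eq_add_of_card_sdiff_eq_two (M := y +ᵥ M) (ρ := ρ₂ + y) (l := l₂ + y)
      hx hx2 hdiff'
      (fun z hz hzM => hMY (h2 z (hmem' z hz hzM) hzM).1)
      (fun z hz hzM => hMY (h2 z (hmem' z hz hzM) hzM).2) hρ₂R
      (hR1 _ (hMY' (mem_rightEnds.1 hρ₂R).1) (by simpa using hy))
      (fun ρ' hρ' hne => by
        rw [mem_rightEnds_vadd] at hρ'
        rcases eq_or_eq_of_card_eq_two hE (hRy _ hρ₂) (hRY _ hρ₂) hρ₁₂ hρ' with h5 | h5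
        · rwa [sub_left_injective h5]
        · exact absurd (by rw [← h5, sub_add_cancel]) hne)
      (fun l' hl' hne => by
        rw [mem_rightEnds_vadd] at hl'
        rcases eq_or_eq_of_card_eq_two hL2 (hLy _ hl₂) (hLY _ hl₂) hl₁₂ hl' with h5 | h5
        · rwa [sub_left_injective h5]
        · exact absurd (by rw [← h5, sub_add_cancel]) hne)
    have hl₂' : l₂ = ρ₂ + x + x + x := by
      have : l₂ + y = ρ₂ + x + x + x + y := by rw [hl₂eq]; abel
      exact add_right_cancel this
    set Z := insert (ρ₂ + x) (insert (ρ₂ + x + x) Y) with hZ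
    have hZmem : ∀ z, z ∈ Z ↔ z = ρ₂ + x ∨ z = ρ₂ + x + x ∨ z ∈ Y := by
      intro z; simp [hZ]
    have hZx : ∀ z ∈ Z, z + x ∈ Z := by
      intro z hz
      rw [hZmem] at hz ⊢
      rcases hz with rfl | rfl | hz
      · exact Or.inr (Or.inl rfl)
      · right; right
        rwa [← hl₂']
      · by_cases hzx : z = ρ₂
        · left; rw [hzx]
        · exact Or.inr (Or.inr (hR1 z hz hzx))
    have hYZ : ∀ z ∈ Y, z ∈ Z := fun y hy => (hZmem y).2 (Or.inr (Or.inr hy))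
    have hρ₂y : ρ₂ + y ∈ Z := hYZ _ (hyM _ (mem_rightEnds.1 (hRY _ hρ₂)).1)
    have h7 := hcard.le_card (forall_mem_of_add_mem ((hMne.mono hMY).mono hYZ) hgen (by
      simp only [Set.mem_insert_iff, Set.mem_singleton_iff, forall_eq_or_imp, forall_eq]
      refine ⟨hZx, fun z hz => ?_⟩
      rcases (hZmem z).1 hz with rfl | rfl | hz
      · have := hZx _ hρ₂y
        rwa [show ρ₂ + y + x = ρ₂ + x + y by abel] at this
      · have := hZx _ (hZx _ hρ₂y)
        rwa [show ρ₂ + y + x + x = ρ₂ + x + x + y by abel] at this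
      · by_cases hzM : z ∈ M
        · exact hYZ _ (hyM z hzM)
        · rw [hZmem]
          rcases hdesc z hz hzM with rfl | rfl
          · left; abel
          · right; left; abel))
    have h8 : Z.card ≤ Y.card + 2 := by
      refine (Finset.card_insert_le _ _).trans ?_
      have := Finset.card_insert_le (ρ₂ + x + x) Y
      omega
    omega
  · have heq : rightEnds x Y = rightEnds x M :=
      Finset.eq_of_subset_of_card_le hRY (by omega)
    exact hy2 (two_nsmul_eq_zero_of_sub_mem hE hy (by rw [← heq] at hRy ⊢; exact hRy))

end Ends

/-! ### Atoms with four elements -/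

section Atoms

variable {G : Type*} [AddCommGroup G] [DecidableEq G]

/-- A generating set `S` with `κ₂(S) ≥ |S|`, for which non-trivial finite subgroups are not
extremal, in a group with at least `2 |S| + 4` elements. -/
structure IsVosperSet (S : Finset G) : Prop where
  zero_mem : (0 : G) ∈ S
  closure : AddSubgroup.closure (S : Set G) = ⊤
  three_le : 3 ≤ S.card
  room : LeCard G (2 * S.card + 4)
  subgroupBound : SubgroupBound S.card S
  two_sep : ∀ X, IsSep 2 0 S X → X.card + S.card ≤ (X + S).card

theorem IsVosperSet.card_add_le {S X : Finset G} (h : IsVosperSet S) (hX : 2 ≤ X.card)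
    (hr : LeCard G (X.card + S.card + 1)) : X.card + S.card ≤ (X + S).card := by
  by_cases hsep : LeCard G ((X + S).card + 2)
  · exact h.two_sep X ⟨hX, hsep, zero_vadd _ _⟩
  · by_contra! hc
    exact hsep (hr.mono (by omega))

/-- `A` is a `3`-atom of a Vosper set `S` with `κ₃(S) = |S|`, containing `0`. -/
structure IsThreeAtom (S A : Finset G) : Prop where
  vosper : IsVosperSet S
  atom : IsAtomOf 3 0 S S.card A
  zero_mem : (0 : G) ∈ A

namespace IsThreeAtom

variable {S A : Finset G}

theorem card_inter_le (h : IsThreeAtom S A) (x : G) (hx : x ≠ 0) :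
    (A ∩ (x +ᵥ A)).card ≤ 2 := by
  have hSne : S.Nonempty := ⟨0, h.vosper.zero_mem⟩
  rcases h.atom.card_inter_lt_or_exists_addSubgroup hSne (by norm_num) with
    hsid | ⟨H, Y, hY, hY2, hr, hc⟩
  · exact Nat.le_of_lt_succ (hsid x hx)
  · have := h.vosper.subgroupBound H Y hY hY2 (ne_top_of_leCard hSne hY hr)
    omega

theorem closure (h : IsThreeAtom S A) : AddSubgroup.closure (A : Set G) = ⊤ :=
  closure_eq_top_of_subgroupBound h.vosper.zero_mem h.vosper.closure h.vosper.subgroupBound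
    h.zero_mem (by have := h.atom.sep.le_card; omega) h.card_inter_le h.atom.card_add.le
    (by have := h.atom.sep.le_card; omega)

theorem room (h : IsThreeAtom S A) : LeCard G (S.card + 2 * A.card) := by
  have := h.atom.leCard_add h.atom.sep h.atom.card_add
  rw [h.atom.card_add] at this
  exact this.mono (by omega)

/-- Sets smaller than the atom are not extremal. -/
theorem card_add_lt (h : IsThreeAtom S A) {T : Finset G} (hT : 3 ≤ T.card)
    (hTA : T.card < A.card) : T.card + S.card + 1 ≤ (T + S).card := by
  by_cases hsep : LeCard G ((T + S).card + 3)
  · have hs : IsSep 3 0 S T := ⟨hT, hsep, zero_vadd _ _⟩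
    have h1 := h.atom.le_of_sep _ hs
    by_contra! hc
    have := h.atom.card_le _ hs (by omega)
    omega
  · by_contra! hc
    exact hsep (h.room.mono (by omega))

/-- If the atom meets a translate of itself in two elements, then by submodularity that pair is
extremal for `S`. -/
theorem card_pair_add_eq (h : IsThreeAtom S A) {u v x : G} (hx : x ≠ 0) (huv : u ≠ v)
    (hu : u ∈ A) (hv : v ∈ A) (hu' : u - x ∈ A) (hv' : v - x ∈ A) :
    ({0, v - u} + S).card = S.card + 2 := by
  have hinter : A ∩ (x +ᵥ A) = {u, v} := by
    refine (Finset.eq_of_subset_of_card_le ?_ ?_).symm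
    · intro z hz
      rw [Finset.mem_inter, mem_vadd_finset_iff]
      rcases Finset.mem_insert.1 hz with rfl | hz
      · exact ⟨hu, hu'⟩
      · rw [Finset.mem_singleton.1 hz]; exact ⟨hv, hv'⟩
    · rw [Finset.card_pair huv]; exact h.card_inter_le x hx
  have hsub := card_union_add_le S A (x +ᵥ A)
  have hcu := Finset.card_union_add_card_inter A (x +ᵥ A)
  rw [hinter, vadd_add_assoc, Finset.card_vadd_finset, h.atom.card_add] at hsub
  rw [hinter, Finset.card_pair huv, Finset.card_vadd_finset] at hcu
  have hpair := h.vosper.card_add_le (X := {u, v}) (by rw [Finset.card_pair huv])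
    (by
      rw [Finset.card_pair huv]
      exact h.vosper.room.mono (by have := h.vosper.three_le; omega))
  rw [Finset.card_pair huv] at hpair
  have h3 := h.atom.sep.le_card
  have hunion := h.vosper.two_sep (A ∪ (x +ᵥ A)) ⟨by omega, h.room.mono (by omega), zero_vadd _ _⟩
  have htr : ({u, v} : Finset G) = u +ᵥ ({0, v - u} : Finset G) := by
    ext z
    simp [mem_vadd_finset_iff, sub_eq_zero]
  rw [htr, vadd_add_assoc, Finset.card_vadd_finset] at hpair hsub
  omega

theorem vadd (h : IsThreeAtom S A) {a : G} (ha : a ∈ A) : IsThreeAtom S (-a +ᵥ A) :=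
  ⟨h.vosper, h.atom.vadd _, by rw [mem_vadd_finset_iff]; simpa using ha⟩

end IsThreeAtom

theorem mem_insert_add_iff {a z : G} {T S : Finset G} :
    z ∈ insert a T + S ↔ z - a ∈ S ∨ z ∈ T + S := by
  rw [Finset.insert_eq, Finset.union_add, Finset.mem_union, Finset.singleton_add,
    mem_vadd_finset_iff]

theorem mem_singleton_add_iff {a z : G} {S : Finset G} :
    z ∈ ({a} : Finset G) + S ↔ z - a ∈ S := by
  rw [Finset.singleton_add, mem_vadd_finset_iff]

theorem mem_pair_add_iff {x z : G} {S : Finset G} :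
    z ∈ ({0, x} : Finset G) + S ↔ z ∈ S ∨ z - x ∈ S := by
  rw [mem_insert_add_iff, mem_singleton_add_iff, sub_zero]

theorem rightEnds_pair_add_subset (x : G) (S : Finset G) :
    rightEnds x ({0, x} + S) ⊆ x +ᵥ rightEnds x S := by
  intro z hz
  rw [mem_rightEnds, mem_pair_add_iff, mem_pair_add_iff, add_sub_cancel_right] at hz
  rw [mem_vadd_finset_iff, mem_rightEnds, sub_add_cancel]
  tauto

theorem ne_of_card_eq_four {α : Type*} [DecidableEq α] {a b c d : α}
    (h : ({a, b, c, d} : Finset α).card = 4) :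
    a ≠ b ∧ a ≠ c ∧ a ≠ d ∧ b ≠ c ∧ b ≠ d ∧ c ≠ d := by
  simp only [Finset.card_insert_eq_ite, Finset.mem_insert, Finset.mem_singleton,
    Finset.card_singleton] at h
  grind

theorem coe_pair_eq_zmultiples {x : G} (h2 : (2 : ℕ) • x = 0) :
    ((({0, x} : Finset G) : Set G)) = AddSubgroup.zmultiples x := by
  ext z
  simp only [Finset.coe_insert, Finset.coe_singleton, Set.mem_insert_iff, Set.mem_singleton_iff,
    SetLike.mem_coe, AddSubgroup.mem_zmultiples_iff]
  constructor
  · rintro (rfl | rfl)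
    · exact ⟨0, by simp⟩
    · exact ⟨1, by simp⟩
  · rintro ⟨n, rfl⟩
    have h2' : (2 : ℤ) • x = 0 := by exact_mod_cast h2
    rcases Int.even_or_odd' n with ⟨m, rfl | rfl⟩
    · left; rw [mul_comm, mul_zsmul, h2', zsmul_zero]
    · right; rw [add_zsmul, mul_comm, mul_zsmul, h2', zsmul_zero, zero_add, one_zsmul]

/-- If `{0, x}` is extremal, then it is not a subgroup. -/
theorem IsVosperSet.two_nsmul_ne_zero {S : Finset G} (h : IsVosperSet S) {x : G} (hx : x ≠ 0)
    (hc : ({0, x} + S).card ≤ S.card + 2) : (2 : ℕ) • x ≠ 0 := by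
  intro h2
  have hY := coe_pair_eq_zmultiples h2
  have hcard : ({0, x} : Finset G).card = 2 := Finset.card_pair (Ne.symm hx)
  have := h.subgroupBound _ _ hY hcard.ge (by
    intro htop
    have hle := h.room.le_card (Z := {0, x}) (fun g => by
      rw [mem_iff_of_coe_eq hY, htop]; trivial)
    omega)
  omega

namespace IsThreeAtom

variable {S A : Finset G}

/-- The three-element subsets of a four-element atom are not extremal, so they all have the same
sum with `S` as the atom. -/
theorem triple_add_eq (h : IsThreeAtom S A) (h4 : A.card = 4) {T : Finset G} (hTA : T ⊆ A)
    (hT : T.card = 3) : T + S = A + S := by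
  apply Finset.eq_of_subset_of_card_le (Finset.add_subset_add_right hTA)
  have := h.card_add_lt hT.ge (by omega)
  rw [h.atom.card_add]
  omega

/-- An extremal pair `{0, x}` in a four-element atom: adding `2x` does not merge the two maximal
`x`-progressions of `S`. -/
theorem card_rightEnds_pair_add (h : IsThreeAtom S A) (h4 : A.card = 4) {x : G} (hx : x ≠ 0)
    (hc : ({0, x} + S).card = S.card + 2) :
    (rightEnds x S).card = 2 ∧ (rightEnds x ({0, x} + S)).card = 2 := by
  have h1 := card_pair_add x S
  have h2 := card_pair_add x ({0, x} + S)
  have h3 := Finset.card_le_card (rightEnds_pair_add_subset x S)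
  rw [Finset.card_vadd_finset] at h3
  have hx2 := h.vosper.two_nsmul_ne_zero hx hc.le
  rw [two_nsmul] at hx2
  have h5 : ({0, x, x + x} : Finset G).card = 3 := by
    rw [Finset.card_eq_three]
    exact ⟨0, x, x + x, hx.symm, hx2.symm, fun h => hx (by simpa using h), rfl⟩
  have h6 := h.card_add_lt h5.ge (by omega)
  have h7 : {0, x, x + x} + S = {0, x} + ({0, x} + S) := by
    ext z
    simp only [mem_insert_add_iff, mem_singleton_add_iff, sub_zero, ← sub_sub]
    tauto
  rw [h7] at h6
  omega

/-- An atom with four elements is not a parallelogram. -/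
theorem false_of_parallelogram (h : IsThreeAtom S A) (h4 : A.card = 4) {x y : G}
    (hA : A = {0, x, y, x + y}) : False := by
  obtain ⟨hx, hy, -, hxy, -, -⟩ := ne_of_card_eq_four (hA ▸ h4)
  have m0 : (0 : G) ∈ A := h.zero_mem
  have mx : x ∈ A := by simp [hA]
  have my : y ∈ A := by simp [hA]
  have mxy : x + y ∈ A := by simp [hA]
  have ex := h.card_pair_add_eq (u := y) (v := x + y) (x := y) hy.symm
    (by simpa using hx.symm) my mxy (by simpa using m0) (by simpa using mx)
  have ey := h.card_pair_add_eq (u := x) (v := x + y) (x := x) hx.symm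
    (by simpa using hy.symm) mx mxy (by simpa using m0) (by simpa using my)
  rw [add_sub_cancel_right] at ex
  rw [add_sub_cancel_left] at ey
  have hx2 := h.vosper.two_nsmul_ne_zero hx.symm ex.le
  have hy2 := h.vosper.two_nsmul_ne_zero hy.symm ey.le
  obtain ⟨-, hE⟩ := h.card_rightEnds_pair_add h4 hx.symm ex
  set M := {0, x} + S with hM
  have hMY : M ∪ (y +ᵥ M) = A + S := by
    ext z
    simp only [hA, hM, Finset.mem_union, mem_vadd_finset_iff, mem_insert_add_iff,
      mem_singleton_add_iff, sub_zero]
    rw [show z - y - x = z - (x + y) by abel]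
    tauto
  have triple : ∀ T ⊆ A, T.card = 3 → ∀ z ∈ M ∪ (y +ᵥ M), z ∈ T + S := by
    intro T hTA hT z hz
    rw [h.triple_add_eq h4 hTA hT, ← hMY]; exact hz
  obtain ⟨n1, n2, n3, n4, n5, n6⟩ := ne_of_card_eq_four (hA ▸ h4)
  refine _root_.false_of_parallelogram (M := M) (x := x) (y := y)
    ⟨0, mem_pair_add_iff.2 (Or.inl h.vosper.zero_mem)⟩ ?_ hx.symm (by rwa [← two_nsmul]) hy.symm
    hy2 (h.vosper.room.mono (by have := h.vosper.three_le; omega)) hE ?_ ?_ ?_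
  · apply addSubgroup_eq_top_of_closure h.closure
    have hx' : x ∈ AddSubgroup.closure {x, y} := AddSubgroup.subset_closure (by simp)
    have hy' : y ∈ AddSubgroup.closure {x, y} := AddSubgroup.subset_closure (by simp)
    rw [hA]
    simp only [Finset.mem_insert, Finset.mem_singleton, forall_eq_or_imp, forall_eq]
    exact ⟨AddSubgroup.zero_mem _, hx', hy', AddSubgroup.add_mem _ hx' hy'⟩
  · rw [hMY, h.atom.card_add]; omega
  · intro z hz hzM
    have hzY := Finset.mem_union_right M hz
    have t1 := triple {0, x, y} (by simp [Finset.insert_subset_iff, m0, mx, my])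
      (Finset.card_eq_three.2 ⟨_, _, _, n1, n2, n4, rfl⟩) z hzY
    have t2 := triple {0, x, x + y} (by simp [Finset.insert_subset_iff, m0, mx, mxy])
      (Finset.card_eq_three.2 ⟨_, _, _, n1, n3, n5, rfl⟩) z hzY
    rw [hM, mem_pair_add_iff] at hzM
    simp only [mem_insert_add_iff, mem_singleton_add_iff, sub_zero] at t1 t2
    rw [mem_vadd_finset_iff, mem_vadd_finset_iff, hM, mem_pair_add_iff, mem_pair_add_iff,
      show z + x - y - x = z - y by abel, show z - x - y = z - (x + y) by abel]
    tauto
  · intro z hz hzM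
    have hzY := Finset.mem_union_left (y +ᵥ M) hz
    have t1 := triple {0, y, x + y} (by simp [Finset.insert_subset_iff, m0, my, mxy])
      (Finset.card_eq_three.2 ⟨_, _, _, n2, n3, n6, rfl⟩) z hzY
    have t2 := triple {x, y, x + y} (by simp [Finset.insert_subset_iff, mx, my, mxy])
      (Finset.card_eq_three.2 ⟨_, _, _, n4, n5, n6, rfl⟩) z hzY
    rw [mem_vadd_finset_iff, hM, mem_pair_add_iff, show z - y - x = z - (x + y) by abel] at hzM
    simp only [mem_insert_add_iff, mem_singleton_add_iff, sub_zero] at t1 t2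
    rw [hM, mem_pair_add_iff, mem_pair_add_iff, add_sub_cancel_right]
    tauto

/-- An atom with four elements does not contain a three-term progression. -/
theorem false_of_three_term_progression (h : IsThreeAtom S A) (h4 : A.card = 4) {d w : G}
    (hA : A = {0, d, d + d, w}) : False := by
  obtain ⟨n1, n2, n3, n4, n5, n6⟩ := ne_of_card_eq_four (hA ▸ h4)
  have m0 : (0 : G) ∈ A := h.zero_mem
  have md : d ∈ A := by simp [hA]
  have mdd : d + d ∈ A := by simp [hA]
  have mw : w ∈ A := by simp [hA]
  have ed := h.card_pair_add_eq (u := d) (v := d + d) (x := d) n1.symm n4 md mdd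
    (by simpa using m0) (by simpa using md)
  rw [add_sub_cancel_right] at ed
  obtain ⟨hE, hE'⟩ := h.card_rightEnds_pair_add h4 n1.symm ed
  have hEeq : rightEnds d ({0, d} + S) = d +ᵥ rightEnds d S :=
    Finset.eq_of_subset_of_card_le (rightEnds_pair_add_subset d S)
      (by rw [Finset.card_vadd_finset]; omega)
  have hE2 : ∀ x ∈ rightEnds d S, x + d + d ∉ S := by
    intro x hx hc
    have : x + d ∈ rightEnds d ({0, d} + S) := by
      rw [hEeq, mem_vadd_finset_iff, add_sub_cancel_right]; exact hx
    exact (mem_rightEnds.1 this).2 (mem_pair_add_iff.2 (Or.inl hc))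
  have hw2 : (2 : ℕ) • w ≠ 0 := by
    intro hc
    have hw : 0 - w = w := by
      rw [two_nsmul] at hc
      rw [zero_sub]; exact (eq_neg_of_add_eq_zero_left hc).symm
    have ew := h.card_pair_add_eq (u := 0) (v := w) (x := w) n3.symm n3 m0 mw
      (by rwa [hw]) (by simpa using m0)
    rw [sub_zero] at ew
    exact h.vosper.two_nsmul_ne_zero n3.symm ew.le hc
  have triple : ∀ T ⊆ A, T.card = 3 → ∀ z ∈ A + S, z ∈ T + S := by
    intro T hTA hT z hz
    rw [h.triple_add_eq h4 hTA hT]; exact hz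
  have memAS : ∀ a ∈ A, ∀ σ ∈ S, σ + a ∈ A + S := fun a ha σ hσ => by
    rw [add_comm σ]; exact Finset.add_mem_add ha hσ
  refine _root_.false_of_three_term_progression (S := S) (d := d) (w := w) (Y := A + S)
    ⟨0, h.vosper.zero_mem⟩ ?_ n3.symm n6.symm hw2
    (h.vosper.room.mono (by have := h.vosper.three_le; omega)) hE hE2 ?_ ?_
    (fun x hx => memAS w mw x hx) ?_ ?_
  · apply addSubgroup_eq_top_of_closure h.closure
    have hd' : d ∈ AddSubgroup.closure {d, w} := AddSubgroup.subset_closure (by simp)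
    have hw' : w ∈ AddSubgroup.closure {d, w} := AddSubgroup.subset_closure (by simp)
    rw [hA]
    simp only [Finset.mem_insert, Finset.mem_singleton, forall_eq_or_imp, forall_eq]
    exact ⟨AddSubgroup.zero_mem _, hd', AddSubgroup.add_mem _ hd' hd', hw'⟩
  · rw [h.atom.card_add]; omega
  · intro y
    rw [← h.triple_add_eq h4 (T := {0, d, d + d}) (by simp [Finset.insert_subset_iff, m0, md, mdd])
      (Finset.card_eq_three.2 ⟨_, _, _, n1, n2, n4, rfl⟩)]
    simp only [mem_insert_add_iff, mem_singleton_add_iff, sub_zero, sub_sub]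
  · intro x hx
    have t := triple {0, d, w} (by simp [Finset.insert_subset_iff, m0, md, mw])
      (Finset.card_eq_three.2 ⟨_, _, _, n1, n3, n5, rfl⟩) (x + d + d)
      (by rw [add_assoc]; exact memAS _ mdd x (mem_rightEnds.1 hx).1)
    simp only [mem_insert_add_iff, mem_singleton_add_iff, sub_zero, add_sub_cancel_right] at t
    have := hE2 x hx
    have := (mem_rightEnds.1 hx).2
    tauto
  · intro l hl
    rw [mem_rightEnds_neg] at hl
    have t := triple {d, d + d, w} (by simp [Finset.insert_subset_iff, md, mdd, mw])
      (Finset.card_eq_three.2 ⟨_, _, _, n4, n5, n6, rfl⟩) l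
      (by simpa using memAS 0 m0 l hl.1)
    simp only [mem_insert_add_iff, mem_singleton_add_iff] at t
    rcases t with t | t | t
    · exact absurd t hl.2
    · refine absurd ?_ (hE2 (l - d - d) ?_)
      · rw [sub_add_cancel, sub_add_cancel]; exact hl.1
      · rw [mem_rightEnds, sub_add_cancel, sub_sub]; exact ⟨t, hl.2⟩
    · exact t

/-- A four-element atom meets its other translates in at most one element: otherwise it would be
a parallelogram or contain a three-term progression. -/
theorem card_inter_le_one (h : IsThreeAtom S A) (h4 : A.card = 4) (x : G) (hx : x ≠ 0) :
    (A ∩ (x +ᵥ A)).card ≤ 1 := by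
  by_contra! hc
  -- The case `v - x = u` is the case `u - x = v` with `u` and `v` exchanged.
  have key : ∀ u v : G, u ∈ A → v ∈ A → u ≠ v → v - x ∈ A → u - x = v → False := by
    intro u v hu hv huv hv' huxv
    have hu' : u - x ∈ A := by rwa [huxv]
    have e := h.card_pair_add_eq hx huv hu hv hu' hv'
    have h2 := h.vosper.two_nsmul_ne_zero (sub_ne_zero.2 huv.symm) e.le
    have hvu : v - x ≠ u := by
      intro hc
      apply h2
      rw [two_nsmul, ← huxv] at *
      have : u - x - u + (u - x - u) = u - x - x - u := by abel
      rw [this, hc, sub_self]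
    have hvx : v - x ≠ v := by simpa using hx
    set T : Finset G := {v - x, v, u} with hT
    have hTc : T.card = 3 := Finset.card_eq_three.2 ⟨_, _, _, hvx, hvu, huv.symm, rfl⟩
    have hTA : T ⊆ A := by simp [hT, Finset.insert_subset_iff, hu, hv, hv']
    obtain ⟨w, hw, hwT⟩ := Finset.exists_mem_notMem_of_card_lt_card (by omega : T.card < A.card)
    have hAeq : A = {v - x, v, u, w} := by
      symm
      apply Finset.eq_of_subset_of_card_le
      · simp [Finset.insert_subset_iff, hu, hv, hv', hw]
      · have : ({v - x, v, u, w} : Finset G) = insert w T := by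
          ext z; simp [hT]; tauto
        rw [this, Finset.card_insert_of_notMem hwT]; omega
    refine (h.vadd hv').false_of_three_term_progression (d := x) (w := w - (v - x))
      (by rwa [Finset.card_vadd_finset]) ?_
    ext z
    have hux : u = v + x := by rw [← huxv]; abel
    rw [mem_vadd_finset_iff, hAeq, hux]
    simp only [Finset.mem_insert, Finset.mem_singleton, sub_neg_eq_add]
    rw [← eq_sub_iff_add_eq, ← eq_sub_iff_add_eq, ← eq_sub_iff_add_eq, ← eq_sub_iff_add_eq,
      sub_self, show v - (v - x) = x by abel, show v + x - (v - x) = x + x by abel]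
  obtain ⟨u, hu, v, hv, huv⟩ := Finset.one_lt_card.1 hc
  rw [Finset.mem_inter, mem_vadd_finset_iff] at hu hv
  by_cases h1 : u - x = v
  · exact key u v hu.1 hv.1 huv hv.2 h1
  by_cases h2 : v - x = u
  · exact key v u hv.1 hu.1 huv.symm hu.2 h2
  have n1 : u - x ≠ u := by simpa using hx
  have n2 : v - x ≠ v := by simpa using hx
  have n3 : u - x ≠ v - x := by simpa using huv
  have hAeq : A = {u - x, u, v - x, v} := by
    symm
    apply Finset.eq_of_subset_of_card_le
    · simp [Finset.insert_subset_iff, hu.1, hu.2, hv.1, hv.2]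
    · rw [Finset.card_insert_of_notMem, Finset.card_insert_of_notMem,
        Finset.card_insert_of_notMem, Finset.card_singleton, h4]
      · simpa using hx
      · simp [huv, Ne.symm h2]
      · simp [hx, huv, h1]
  refine (h.vadd hu.2).false_of_parallelogram (x := x) (y := v - u)
    (by rwa [Finset.card_vadd_finset]) ?_
  ext z
  rw [mem_vadd_finset_iff, hAeq]
  simp only [Finset.mem_insert, Finset.mem_singleton, sub_neg_eq_add]
  rw [← eq_sub_iff_add_eq, ← eq_sub_iff_add_eq, ← eq_sub_iff_add_eq, ← eq_sub_iff_add_eq,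
    sub_self, show u - (u - x) = x by abel, show v - x - (u - x) = v - u by abel,
    show v - (u - x) = x + (v - u) by abel]

end IsThreeAtom

end Atoms

/-! ### Atoms have three elements -/

section ThreeAtoms

variable {G : Type*} [AddCommGroup G] [DecidableEq G]

theorem card_dvd_card_add_of_coe_eq {H : AddSubgroup G} {Y : Finset G} (hY : (Y : Set G) = H)
    (A : Finset G) : Y.card ∣ (Y + A).card := by
  apply Finset.card_dvd_card_add_left
  have hmem : ∀ c z : G, z ∈ Y.image (fun a => a + c) ↔ z - c ∈ H := by
    intro c z
    simp only [Finset.mem_image, mem_iff_of_coe_eq hY]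
    constructor
    · rintro ⟨y, hy, rfl⟩; simpa using hy
    · intro h; exact ⟨z - c, h, by abel⟩
  rintro _ ⟨a, -, rfl⟩ _ ⟨b, -, rfl⟩ hab
  rw [Function.onFun, id, id, Finset.disjoint_left]
  intro z hz hz'
  rw [hmem] at hz hz'
  apply hab
  ext t
  rw [hmem, hmem]
  have hba : b - a ∈ H := by
    have := H.sub_mem hz hz'
    rwa [sub_sub_sub_cancel_left] at this
  constructor
  · intro h
    have := H.sub_mem h hba
    rwa [sub_sub_sub_cancel_right] at this
  · intro h
    have := H.add_mem h hba
    rwa [sub_add_sub_cancel] at this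

/-- The Cauchy–Schwarz bounds exclude `κ₂(A) ≤ 4` for a four-element atom `A` that meets its other
translates in at most one element. -/
theorem false_of_four_bounds {k N : ℕ} (hk : 2 ≤ k) (hN : N ≤ 4 + k)
    (h1 : 4 ^ 2 * k + N * 1 ≤ N * (4 + 1 * k)) (h2 : k ^ 2 * 4 + N * 1 ≤ N * (k + 1 * 4)) :
    False := by
  rcases Nat.lt_or_ge k 4 with h | h
  · interval_cases k <;> omega
  · have h3 : N * (k + 3) ≤ (4 + k) * (k + 3) := Nat.mul_le_mul_right _ hN
    nlinarith

/-- The Cauchy–Schwarz bounds exclude `κ₂(A) ≤ |A|` for an atom `A` with at least five elements if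
the `2`-atom of `A` meets its other translates in at most one element. -/
theorem false_of_large_bounds {h k N : ℕ} (hh : 5 ≤ h) (hk : 2 ≤ k) (hN : N ≤ h + k)
    (h1 : h ^ 2 * k + N * 2 ≤ N * (h + 2 * k)) (h2 : k ^ 2 * h + N * 1 ≤ N * (k + 1 * h)) :
    False := by
  zify at *
  have h1' : (h : ℤ) ^ 2 * k ≤ (h + k) * (h + 2 * k - 2) := by
    have : (N : ℤ) * (h + 2 * k - 2) ≤ (h + k) * (h + 2 * k - 2) :=
      mul_le_mul_of_nonneg_right hN (by linarith)
    linarith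
  have h2' : (k : ℤ) ^ 2 * h ≤ (h + k) * (h + k - 1) := by
    have : (N : ℤ) * (h + k - 1) ≤ (h + k) * (h + k - 1) :=
      mul_le_mul_of_nonneg_right hN (by linarith)
    linarith
  clear h1 h2 hN
  rcases le_or_gt (h : ℤ) k with hkh | hkh
  · have h3 : (k : ℤ) ^ 2 * 5 ≤ k ^ 2 * h := mul_le_mul_of_nonneg_left hh (sq_nonneg (k : ℤ))
    have h4 : ((h : ℤ) + k) * (h + k - 1) ≤ (k + k) * (k + k) := by
      apply mul_le_mul <;> linarith
    nlinarith
  rcases le_or_gt (6 : ℤ) k with h6 | h6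
  · have h3 : (h : ℤ) ^ 2 * 6 ≤ h ^ 2 * k := mul_le_mul_of_nonneg_left h6 (sq_nonneg (h : ℤ))
    have h4 : ((h : ℤ) + k) * (h + 2 * k - 2) ≤ (2 * h - 1) * (3 * h - 4) := by
      apply mul_le_mul <;> linarith
    linarith
  · have : (k : ℤ) = 2 ∨ (k : ℤ) = 3 ∨ (k : ℤ) = 4 ∨ (k : ℤ) = 5 := by omega
    rcases this with hk' | hk' | hk' | hk' <;> rw [hk'] at h1' <;> nlinarith

/-- Adding a progression to `S` adds at most one element per right end and per step. -/
theorem exists_progression_add_subset (g : G) (S : Finset G) (n : ℕ) :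
    ∃ T : Finset G, T.card ≤ S.card + n * (rightEnds g S).card ∧
      ∀ i ≤ n, ∀ σ ∈ S, σ + i • g ∈ T := by
  have key : ∀ n : ℕ, ∃ T : Finset G, T.card ≤ S.card + n * (rightEnds g S).card ∧
      (rightEnds g T).card ≤ (rightEnds g S).card ∧ ∀ i ≤ n, ∀ σ ∈ S, σ + i • g ∈ T := by
    intro n
    induction n with
    | zero =>
      refine ⟨S, by simp, le_rfl, fun i hi σ hσ => ?_⟩
      obtain rfl : i = 0 := by omega
      simpa using hσ
    | succ n ih =>
      obtain ⟨T, h1, h2, h3⟩ := ih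
      refine ⟨{0, g} + T, ?_, ?_, ?_⟩
      · rw [card_pair_add, add_mul]; omega
      · have := Finset.card_le_card (rightEnds_pair_add_subset g T)
        rw [Finset.card_vadd_finset] at this
        omega
      · intro i hi σ hσ
        rw [mem_pair_add_iff]
        rcases i with _ | i
        · exact Or.inl (h3 0 (by omega) σ hσ)
        · right
          rw [succ_nsmul, ← add_assoc, add_sub_cancel_right]
          exact h3 i (by omega) σ hσ
  obtain ⟨T, h1, -, h3⟩ := key n
  exact ⟨T, h1, h3⟩

theorem exists_nsmul_eq_of_card_prime {p : ℕ} [hp : Fact p.Prime] {H : AddSubgroup G}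
    {Y : Finset G} (hY : (Y : Set G) = H) (hp : Y.card = p) {g : G} (hg : g ∈ H) (hg0 : g ≠ 0)
    {y : G} (hy : y ∈ H) : ∃ i < p, i • g = y := by
  classical
  have hcard : Nat.card H = p := by
    rw [← hp, ← Set.ncard_coe_finset, hY]; rfl
  have hfin : Finite H := Nat.finite_of_card_ne_zero (by
    rw [hcard]; exact (Fact.out : p.Prime).ne_zero)
  have h1 : (⟨y, hy⟩ : H) ∈ AddSubgroup.zmultiples (⟨g, hg⟩ : H) :=
    mem_zmultiples_of_prime_card hcard (by simpa [Subtype.ext_iff] using hg0)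
  rw [mem_zmultiples_iff_mem_range_addOrderOf] at h1
  obtain ⟨i, hi, hiy⟩ := Finset.mem_image.1 h1
  refine ⟨i, ?_, by simpa [Subtype.ext_iff] using hiy⟩
  have := Nat.le_of_dvd (by rw [hcard]; exact (Fact.out : p.Prime).pos)
    (addOrderOf_dvd_natCard (⟨g, hg⟩ : H))
  rw [Finset.mem_range] at hi
  omega

namespace IsThreeAtom

variable {S A : Finset G}

/-- A five-element atom cannot lie in two cosets of a subgroup of order five. -/
theorem false_of_card_eq_five (h : IsThreeAtom S A) (h5 : A.card = 5) {H : AddSubgroup G}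
    {Y : Finset G} (hY : (Y : Set G) = H) (hY5 : Y.card = 5) (hYA : (Y + A).card = 10) :
    False := by
  classical
  have hprime : Fact (Nat.Prime 5) := ⟨by norm_num⟩
  have hH : H ≠ ⊤ := by
    rintro rfl
    have := h.room.le_card (Z := Y) (fun g => by rw [mem_iff_of_coe_eq hY]; trivial)
    omega
  obtain ⟨a₁, ha₁, ha₁H⟩ : ∃ a ∈ A, a ∉ H := by
    by_contra! hc
    exact hH (addSubgroup_eq_top_of_closure h.closure hc)
  -- `A` lies in the union of the cosets `H` and `a₁ + H`.
  have htwo : ∀ a ∈ A, a ∈ H ∨ a - a₁ ∈ H := by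
    have hdisj : Disjoint Y (a₁ +ᵥ Y) := by
      rw [Finset.disjoint_left]
      intro y hy hy'
      rw [mem_vadd_finset_iff, mem_iff_of_coe_eq hY] at hy'
      rw [mem_iff_of_coe_eq hY] at hy
      apply ha₁H
      simpa using H.sub_mem hy hy'
    have heq : Y ∪ (a₁ +ᵥ Y) = Y + A := by
      apply Finset.eq_of_subset_of_card_le
      · apply Finset.union_subset
        · intro y hy; simpa using Finset.add_mem_add hy h.zero_mem
        · rw [add_comm, ← Finset.singleton_add]
          exact Finset.add_subset_add_right (by simpa using ha₁)
      · rw [Finset.card_union_of_disjoint hdisj, Finset.card_vadd_finset]; omega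
    intro a ha
    have : a ∈ Y ∪ (a₁ +ᵥ Y) := by
      rw [heq]
      simpa using Finset.add_mem_add (zero_mem_of_coe_eq hY) ha
    rwa [Finset.mem_union, mem_vadd_finset_iff, mem_iff_of_coe_eq hY, mem_iff_of_coe_eq hY] at this
  obtain ⟨g₀, g₁, C, D, hCD, hC3, hC, hD, hDne⟩ : ∃ (g₀ g₁ : G) (C D : Finset G),
      (C ∪ D = A ∧ Disjoint C D) ∧ 3 ≤ C.card ∧ (∀ c ∈ C, c - g₀ ∈ H) ∧
      (∀ d ∈ D, d - g₁ ∈ H) ∧ D.Nonempty := by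
    set C := A.filter (· ∈ H) with hCdef
    set D := A.filter (¬ · ∈ H) with hDdef
    have hcard : C.card + D.card = A.card := Finset.card_filter_add_card_filter_not _
    have hu : C ∪ D = A := Finset.filter_union_filter_not_eq _ _
    have hdis : Disjoint C D := Finset.disjoint_filter_filter_not _ _ _
    have hC : ∀ c ∈ C, c - 0 ∈ H := fun c hc => by simpa using (Finset.mem_filter.1 hc).2
    have hD : ∀ d ∈ D, d - a₁ ∈ H := fun d hd =>
      (htwo d (Finset.mem_filter.1 hd).1).resolve_left (Finset.mem_filter.1 hd).2
    rcases Nat.lt_or_ge C.card 3 with hlt | hge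
    · exact ⟨a₁, 0, D, C, ⟨by rw [Finset.union_comm]; exact hu, hdis.symm⟩, by omega, hD, hC,
        ⟨0, Finset.mem_filter.2 ⟨h.zero_mem, H.zero_mem⟩⟩⟩
    · exact ⟨0, a₁, C, D, ⟨hu, hdis⟩, hge, hC, hD, ⟨a₁, Finset.mem_filter.2 ⟨ha₁, ha₁H⟩⟩⟩
  obtain ⟨hCD, hdis⟩ := hCD
  have hcardCD : C.card + D.card = 5 := by
    rw [← Finset.card_union_of_disjoint hdis, hCD, h5]
  have hDpos := Finset.card_pos.2 hDne
  have hCA : C ⊆ A := hCD ▸ Finset.subset_union_left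
  have hDA : D ⊆ A := hCD ▸ Finset.subset_union_right
  -- Two of the at least six differences of elements of `C` coincide.
  obtain ⟨u, u', x, hu, hu', hux, hu'x, huu', hx⟩ : ∃ u u' x : G, u ∈ C ∧ u' ∈ C ∧ u - x ∈ C ∧
      u' - x ∈ C ∧ u ≠ u' ∧ x ≠ 0 := by
    have hlt : (Y.erase 0).card < C.offDiag.card := by
      rw [Finset.card_erase_of_mem (zero_mem_of_coe_eq hY), Finset.offDiag_card, hY5]
      have : 3 * C.card ≤ C.card * C.card := Nat.mul_le_mul_right _ hC3
      omega
    obtain ⟨p, hp, q, hq, hpq, he⟩ := Finset.exists_ne_map_eq_of_card_lt_of_maps_to hlt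
      (f := fun p : G × G => p.1 - p.2) (by
        intro p hp
        rw [Finset.mem_coe, Finset.mem_offDiag] at hp
        rw [Finset.mem_coe, Finset.mem_erase, mem_iff_of_coe_eq hY]
        refine ⟨sub_ne_zero.2 hp.2.2, ?_⟩
        have := H.sub_mem (hC _ hp.1) (hC _ hp.2.1)
        rwa [sub_sub_sub_cancel_right] at this)
    rw [Finset.mem_offDiag] at hp hq
    refine ⟨p.1, q.1, p.1 - p.2, hp.1, hq.1, by simpa using hp.2.1, ?_, ?_, sub_ne_zero.2 hp.2.2⟩
    · rw [show p.1 - p.2 = q.1 - q.2 from he]; simpa using hq.2.1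
    · intro h1
      apply hpq
      rw [h1, sub_right_inj] at he
      exact Prod.ext h1 he
  have e := h.card_pair_add_eq hx huu' (hCA hu) (hCA hu') (hCA hux) (hCA hu'x)
  set g := u' - u with hg
  have hgH : g ∈ H := by
    have := H.sub_mem (hC _ hu') (hC _ hu)
    rwa [sub_sub_sub_cancel_right] at this
  have hg0 : g ≠ 0 := sub_ne_zero.2 huu'.symm
  have hCS := h.card_add_lt hC3 (by omega)
  -- A sum outside of `g₀ + H + S` would come with a whole translate of `D`.
  have hsub : ∀ a ∈ A, ∀ σ ∈ S, ∃ τ ∈ S, a + σ - g₀ - τ ∈ H := by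
    intro a ha σ hσ
    by_contra! hc
    have haD : a ∈ D := by
      rw [← hCD, Finset.mem_union] at ha
      refine ha.resolve_left fun haC => hc σ hσ ?_
      rw [show a + σ - g₀ - σ = a - g₀ by abel]
      exact hC a haC
    have hdisj : Disjoint (C + S) (σ +ᵥ D) := by
      rw [Finset.disjoint_left]
      intro z hz hz'
      obtain ⟨c, hcC, τ, hτ, rfl⟩ := Finset.mem_add.1 hz
      rw [mem_vadd_finset_iff] at hz'
      apply hc τ hτ
      have h1 := H.sub_mem (hD _ haD) (hD _ hz')
      have h2 := H.add_mem h1 (hC _ hcC)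
      rwa [show a - g₁ - (c + τ - σ - g₁) + (c - g₀) = a + σ - g₀ - τ by abel] at h2
    have hsub : (C + S) ∪ (σ +ᵥ D) ⊆ A + S := by
      apply Finset.union_subset (Finset.add_subset_add_right hCA)
      intro z hz
      rw [mem_vadd_finset_iff] at hz
      have := Finset.add_mem_add (hDA hz) hσ
      rwa [sub_add_cancel] at this
    have := Finset.card_le_card hsub
    rw [Finset.card_union_of_disjoint hdisj, Finset.card_vadd_finset, h.atom.card_add] at this
    omega
  obtain ⟨T, hT, hTmem⟩ := exists_progression_add_subset g S 4
  have hYS : Y + S ⊆ T := by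
    intro z hz
    obtain ⟨y, hy, σ, hσ, rfl⟩ := Finset.mem_add.1 hz
    rw [mem_iff_of_coe_eq hY] at hy
    obtain ⟨i, hi, rfl⟩ := exists_nsmul_eq_of_card_prime hY hY5 hgH hg0 hy
    rw [add_comm]
    exact hTmem i (by omega) σ hσ
  have hE : (rightEnds g S).card = 2 := by
    have := card_pair_add g S
    omega
  have hmemYS : ∀ z : G, z ∈ Y + S ↔ ∃ τ ∈ S, z - τ ∈ H := by
    intro z
    constructor
    · intro hz
      obtain ⟨y, hy, σ, hσ, rfl⟩ := Finset.mem_add.1 hz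
      exact ⟨σ, hσ, by simpa [mem_iff_of_coe_eq hY] using hy⟩
    · rintro ⟨τ, hτ, hz⟩
      rw [← mem_iff_of_coe_eq hY] at hz
      simpa using Finset.add_mem_add hz hτ
  have hclos : AddSubgroup.closure ((fun a => a - g₀) '' (A : Set G)) = ⊤ := by
    have hin : ∀ a ∈ A, a - g₀ ∈ AddSubgroup.closure ((fun a => a - g₀) '' (A : Set G)) :=
      fun a ha => AddSubgroup.subset_closure ⟨a, ha, rfl⟩
    apply addSubgroup_eq_top_of_closure h.closure
    intro a ha
    have := AddSubgroup.sub_mem _ (hin a ha) (hin 0 h.zero_mem)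
    rwa [sub_sub_sub_cancel_right, sub_zero] at this
  have hfull := h.room.le_card (forall_mem_of_add_mem (Z := Y + S)
    (D := (fun a => a - g₀) '' (A : Set G))
    ⟨0, (hmemYS 0).2 ⟨0, h.vosper.zero_mem, by simp⟩⟩ hclos (by
      rintro _ ⟨a, ha, rfl⟩ z hz
      rw [hmemYS] at hz ⊢
      obtain ⟨σ, hσ, hz⟩ := hz
      obtain ⟨τ, hτ, h1⟩ := hsub a ha σ hσ
      refine ⟨τ, hτ, ?_⟩
      have := H.add_mem hz h1
      dsimp only
      rwa [show z - σ + (a + σ - g₀ - τ) = z + (a - g₀) - τ by abel] at this))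
  have := Finset.card_le_card hYS
  omega

/-- A `3`-atom has exactly three elements: otherwise the `2`-atoms of the atom itself would be too
small for the Cauchy–Schwarz bound. -/
theorem card_eq_three (h : IsThreeAtom S A) : A.card = 3 := by
  have h3 := h.atom.sep.le_card
  by_contra hne
  have hAne : A.Nonempty := ⟨0, h.zero_mem⟩
  have hAS := h.atom.card_add
  obtain ⟨c, hc, hcA⟩ : ∃ c, ((c = 1 ∧ A.card = 4) ∨ (c = 2 ∧ 5 ≤ A.card)) ∧
      ∀ x : G, x ≠ 0 → (A ∩ (x +ᵥ A)).card ≤ c := by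
    rcases Nat.lt_or_ge A.card 5 with h5 | h5
    · exact ⟨1, Or.inl ⟨rfl, by omega⟩, h.card_inter_le_one (by omega)⟩
    · exact ⟨2, Or.inr ⟨rfl, h5⟩, h.card_inter_le⟩
  obtain ⟨κ, hκ, M, hM⟩ := exists_isAtomOf (k := 2) (q := 0) (c := A.card) (X := S) hAne
    ⟨by have := h.vosper.three_le; omega,
      by rw [add_comm S A]; exact h.atom.sep.room.mono (by omega), zero_vadd _ _⟩
    (by rw [add_comm S A]; omega)
  have hMA := hM.card_add
  have hM2 := hM.sep.le_card
  rcases hM.card_inter_lt_or_exists_addSubgroup hAne one_le_two with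
    hsidM | ⟨H, Y, hY, hY2, hr, hYc⟩
  · have e1 := sq_card_mul_card_le (A := A) (B := M) (Finset.card_pos.1 (by omega)) hcA
    have e2 := sq_card_mul_card_le (A := M) (B := A) (c := 1) hAne
      (fun x hx => Nat.le_of_lt_succ (hsidM x hx))
    rw [add_comm A M] at e1
    rcases hc with ⟨rfl, h4⟩ | ⟨rfl, h5⟩
    · rw [h4] at e1 e2
      exact false_of_four_bounds hM2 (by omega) e1 e2
    · exact false_of_large_bounds h5 hM2 (by omega) e1 e2
  · have h2 := two_mul_card_le_card_add h.zero_mem h.closure hY (ne_top_of_leCard hAne hY hr)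
    obtain ⟨x, hx, hx0⟩ := Finset.exists_mem_ne hY2 0
    have h4 := two_mul_card_le_of_mem (A := A) hY ((mem_iff_of_coe_eq hY).1 hx)
    have h5 := hcA x hx0
    have e1 := sq_card_mul_card_le (A := A) (B := Y) (Finset.card_pos.1 (by omega)) hcA
    have hdvd := card_dvd_card_add_of_coe_eq hY A
    rw [add_comm A Y] at e1
    obtain ⟨t, ht⟩ := hdvd
    rw [ht] at h2 h4 hYc e1
    rcases hc with ⟨rfl, hA4⟩ | ⟨rfl, hA5⟩
    · rw [hA4] at e1 h4
      have : Y.card ≤ 4 := by omega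
      have : 3 ≤ Y.card := by omega
      obtain hq | hq : Y.card = 3 ∨ Y.card = 4 := by omega
      · rw [hq] at e1 h4 hYc h2; omega
      · rw [hq] at e1 h4 hYc h2; omega
    · have hq : A.card ≤ Y.card + 2 := by omega
      have hq' : Y.card ≤ A.card := by omega
      have ht2 : t = 2 := by
        have h6 : 2 ≤ t := by
          by_contra! hlt
          have : Y.card * t ≤ Y.card * 1 := Nat.mul_le_mul_left _ (by omega)
          omega
        by_contra ht2
        have : Y.card * 3 ≤ Y.card * t := Nat.mul_le_mul_left _ (by omega)
        omega
      subst ht2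
      have h7 : A.card ^ 2 + 4 ≤ 2 * A.card + 4 * Y.card := by
        have : Y.card * (A.card ^ 2 + 4) ≤ Y.card * (2 * A.card + 4 * Y.card) := by linarith
        exact Nat.le_of_mul_le_mul_left this (by omega)
      have h8 : A.card ≤ 5 := by nlinarith
      have h9 : A.card = 5 := by omega
      rw [h9] at h7
      have h10 : Y.card = 5 := by omega
      exact h.false_of_card_eq_five h9 hY h10 (by omega)

end IsThreeAtom

end ThreeAtoms

/-! ### Short relations in the triangular lattice -/

section Hexagonal

variable {G : Type*} [AddCommGroup G]

/-- The homomorphism from the triangular lattice, with coordinates in `ℤ × ℤ`, given by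
`(m, n) ↦ m a + n b`. -/
def latticeMap (a b : G) (d : ℤ × ℤ) : G := d.1 • a + d.2 • b

/-- The squared length of a vector of the triangular lattice. -/
def hexNorm (d : ℤ × ℤ) : ℤ := d.1 ^ 2 + d.1 * d.2 + d.2 ^ 2

/-- There is no short relation between `a` and `b`: the kernel of `latticeMap a b` contains no
non-zero vector of squared length at most `9`. The bound `9` is the largest one for which every
forbidden relation makes `{0, a, b}` a progression of length three, or one of length four with a
term deleted, or gives two of the three points a difference of order at most three. -/
def HexFree (a b : G) : Prop := ∀ d : ℤ × ℤ, hexNorm d ≤ 9 → latticeMap a b d = 0 → d = 0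

/-- The six shortest non-zero vectors of the triangular lattice. -/
def hexUnits : Finset (ℤ × ℤ) := {(1, 0), (-1, 0), (0, 1), (0, -1), (-1, 1), (1, -1)}

theorem latticeMap_sub (a b : G) (d e : ℤ × ℤ) :
    latticeMap a b (d - e) = latticeMap a b d - latticeMap a b e := by
  simp only [latticeMap, Prod.fst_sub, Prod.snd_sub, sub_zsmul]; abel

theorem HexFree.eq_of_latticeMap_eq {a b : G} (h : HexFree a b) {d e : ℤ × ℤ}
    (hde : hexNorm (d - e) ≤ 9) (heq : latticeMap a b d = latticeMap a b e) : d = e :=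
  sub_eq_zero.1 (h _ hde (by rw [latticeMap_sub, heq, sub_self]))

theorem HexFree.swap {a b : G} (h : HexFree a b) : HexFree b a := by
  intro d hd h0
  have := h d.swap (by unfold hexNorm at *; simp only [Prod.fst_swap, Prod.snd_swap]; linarith)
    (by unfold latticeMap at *; simp only [Prod.fst_swap, Prod.snd_swap]; rwa [add_comm])
  simpa [Prod.ext_iff, and_comm] using this

/-- A short relation between `a` and `b` makes `{0, a, b}` nearly a progression, unless two of the
three points differ by an element of order two or three. -/
theorem exists_progression_of_not_hexFree [DecidableEq G] {a b : G} (ha : a ≠ 0) (hb : b ≠ 0)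
    (hab : a ≠ b) (ha2 : (2 : ℤ) • a ≠ 0) (hb2 : (2 : ℤ) • b ≠ 0) (hab2 : (2 : ℤ) • (b - a) ≠ 0)
    (ha3 : (3 : ℤ) • a ≠ 0) (hb3 : (3 : ℤ) • b ≠ 0) (hab3 : (3 : ℤ) • (b - a) ≠ 0)
    (h : ¬ HexFree a b) : ∃ t r : G, ({0, a, b} : Finset G) = {t, t + r, t + r + r} ∨
      ({0, a, b} : Finset G) = {t, t + r, t + r + r + r} := by
  set P : Prop := ∃ t r : G, ({0, a, b} : Finset G) = {t, t + r, t + r + r} ∨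
      ({0, a, b} : Finset G) = {t, t + r, t + r + r + r} with hP
  have perm : ∀ x y z : G, ((x = 0 ∧ y = a ∧ z = b) ∨ (x = 0 ∧ y = b ∧ z = a) ∨
      (x = a ∧ y = 0 ∧ z = b) ∨ (x = b ∧ y = 0 ∧ z = a) ∨ (x = a ∧ y = b ∧ z = 0) ∨
      (x = b ∧ y = a ∧ z = 0)) → ({0, a, b} : Finset G) = {x, y, z} := by
    rintro x y z (⟨rfl, rfl, rfl⟩ | ⟨rfl, rfl, rfl⟩ | ⟨rfl, rfl, rfl⟩ | ⟨rfl, rfl, rfl⟩ |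
      ⟨rfl, rfl, rfl⟩ | ⟨rfl, rfl, rfl⟩) <;> ext w <;> simp only [Finset.mem_insert,
      Finset.mem_singleton] <;> tauto
  have g1 : (1 : ℤ) • a + (1 : ℤ) • b = 0 → P := fun h => ⟨b, a, Or.inl (perm _ _ _ (by
    have : b = -a := by rw [← sub_eq_zero, ← h]; module
    right; right; right; left; subst this; simp))⟩
  have g2 : (2 : ℤ) • a + (-1 : ℤ) • b = 0 → P := fun h => ⟨0, a, Or.inl (perm _ _ _ (by
    have : b = a + a := by rw [← sub_eq_zero, ← neg_eq_zero, ← h]; module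
    left; subst this; simp))⟩
  have g3 : (1 : ℤ) • a + (-2 : ℤ) • b = 0 → P := fun h => ⟨0, b, Or.inl (perm _ _ _ (by
    have : a = b + b := by rw [← sub_eq_zero, ← h]; module
    right; left; subst this; simp))⟩
  have g4 : (2 : ℤ) • a + (1 : ℤ) • b = 0 → P := fun h => ⟨a, -a, Or.inr (perm _ _ _ (by
    have : b = -a - a := by rw [← sub_eq_zero, ← h]; module
    right; right; left; subst this; simp [sub_eq_add_neg]))⟩
  have g5 : (1 : ℤ) • a + (2 : ℤ) • b = 0 → P := fun h => ⟨b, -b, Or.inr (perm _ _ _ (by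
    have : a = -b - b := by rw [← sub_eq_zero, ← h]; module
    right; right; right; left; subst this; simp [sub_eq_add_neg]))⟩
  have g6 : (3 : ℤ) • a + (-1 : ℤ) • b = 0 → P := fun h => ⟨0, a, Or.inr (perm _ _ _ (by
    have : b = a + a + a := by rw [← sub_eq_zero, ← neg_eq_zero, ← h]; module
    left; subst this; simp))⟩
  have g7 : (1 : ℤ) • a + (-3 : ℤ) • b = 0 → P := fun h => ⟨0, b, Or.inr (perm _ _ _ (by
    have : a = b + b + b := by rw [← sub_eq_zero, ← h]; module
    right; left; subst this; simp))⟩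
  have g8 : (3 : ℤ) • a + (-2 : ℤ) • b = 0 → P := fun h => ⟨b, a - b, Or.inr (perm _ _ _ (by
    right; right; right; right; right
    exact ⟨rfl, by abel, Eq.trans (by module) h⟩))⟩
  have g9 : (2 : ℤ) • a + (-3 : ℤ) • b = 0 → P := fun h => ⟨a, b - a, Or.inr (perm _ _ _ (by
    right; right; right; right; left
    exact ⟨rfl, by abel, neg_eq_zero.1 (Eq.trans (by module) h)⟩))⟩
  have neg : ∀ m n : ℤ, m • a + n • b = 0 → (-m) • a + (-n) • b = 0 := by
    intro m n h
    rw [← neg_eq_zero, ← h]; module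
  unfold HexFree at h
  push Not at h
  obtain ⟨⟨m, n⟩, hN, hz, hne⟩ := h
  simp only [hexNorm, latticeMap] at hN hz
  have hm : -3 ≤ m ∧ m ≤ 3 := by constructor <;> nlinarith [sq_nonneg (m + 2 * n)]
  have hn : -3 ≤ n ∧ n ≤ 3 := by constructor <;> nlinarith [sq_nonneg (n + 2 * m)]
  -- up to sign, the first non-zero coordinate is positive
  obtain ⟨m, n, hN, hz, hne, hm, hn, hpos⟩ : ∃ m n : ℤ, m ^ 2 + m * n + n ^ 2 ≤ 9 ∧
      m • a + n • b = 0 ∧ (m, n) ≠ 0 ∧ (-3 ≤ m ∧ m ≤ 3) ∧ (-3 ≤ n ∧ n ≤ 3) ∧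
      (0 < m ∨ m = 0 ∧ 0 < n) := by
    rcases lt_trichotomy m 0 with h | h | h
    · exact ⟨-m, -n, by linarith, neg _ _ hz, by simpa using hne, by omega, by omega, by omega⟩
    · rcases lt_trichotomy n 0 with h' | h' | h'
      · exact ⟨-m, -n, by linarith, neg _ _ hz, by simpa using hne, by omega, by omega, by omega⟩
      · exact absurd (by rw [h, h']; rfl) hne
      · exact ⟨m, n, hN, hz, hne, hm, hn, by omega⟩
    · exact ⟨m, n, hN, hz, hne, hm, hn, by omega⟩
  have key : ∀ m ∈ Finset.Icc (0 : ℤ) 3, ∀ n ∈ Finset.Icc (-3 : ℤ) 3,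
      m ^ 2 + m * n + n ^ 2 ≤ 9 → (0 < m ∨ m = 0 ∧ 0 < n) → (m, n) ∈ ({(1, 0), (0, 1), (1, -1),
        (1, 1), (2, -1), (1, -2), (2, 0), (0, 2), (2, -2), (2, 1), (1, 2), (3, -1), (1, -3),
        (3, -2), (2, -3), (3, 0), (0, 3), (3, -3)} : Finset (ℤ × ℤ)) := by decide
  have hmem := key m (Finset.mem_Icc.2 (by omega)) n (Finset.mem_Icc.2 (by omega)) hN hpos
  simp only [Finset.mem_insert, Finset.mem_singleton, Prod.mk.injEq] at hmem
  rcases hmem with ⟨rfl, rfl⟩ | ⟨rfl, rfl⟩ | ⟨rfl, rfl⟩ | ⟨rfl, rfl⟩ | ⟨rfl, rfl⟩ | ⟨rfl, rfl⟩ |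
    ⟨rfl, rfl⟩ | ⟨rfl, rfl⟩ | ⟨rfl, rfl⟩ | ⟨rfl, rfl⟩ | ⟨rfl, rfl⟩ | ⟨rfl, rfl⟩ | ⟨rfl, rfl⟩ |
    ⟨rfl, rfl⟩ | ⟨rfl, rfl⟩ | ⟨rfl, rfl⟩ | ⟨rfl, rfl⟩ | ⟨rfl, rfl⟩
  · exact absurd (Eq.trans (by module) hz) ha
  · exact absurd (Eq.trans (by module) hz) hb
  · exact absurd (sub_eq_zero.1 (Eq.trans (by module) hz)) hab
  · exact g1 hz
  · exact g2 hz
  · exact g3 hz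
  · exact absurd (Eq.trans (by module) hz) ha2
  · exact absurd (Eq.trans (by module) hz) hb2
  · exact absurd (neg_eq_zero.1 (Eq.trans (by module) hz)) hab2
  · exact g4 hz
  · exact g5 hz
  · exact g6 hz
  · exact g7 hz
  · exact g8 hz
  · exact g9 hz
  · exact absurd (Eq.trans (by module) hz) ha3
  · exact absurd (Eq.trans (by module) hz) hb3
  · exact absurd (neg_eq_zero.1 (Eq.trans (by module) hz)) hab3

end Hexagonal

/-! ### Four-point sets in the triangular lattice -/

section HexagonalSets

variable {G : Type*} [AddCommGroup G]

/-- A set of lattice vectors of diameter at most `3` is mapped injectively when `a` and `b`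
satisfy no short relation. -/
theorem HexFree.card_le {a b : G} (h : HexFree a b) {F : Finset (ℤ × ℤ)}
    (hF : ∀ d ∈ F, ∀ e ∈ F, hexNorm (d - e) ≤ 9) {B : Finset G} {v : G}
    (hB : ∀ d ∈ F, v + latticeMap a b d ∈ B) : F.card ≤ B.card :=
  Finset.card_le_card_of_injOn (fun d => v + latticeMap a b d) hB
    fun d hd e he hde => h.eq_of_latticeMap_eq (hF d hd e he) (add_left_cancel hde)

variable [DecidableEq G]

/-- A set of lattice vectors of diameter at most `3` whose image is contained in a set `B` of no
larger cardinality fills `B`. -/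
theorem HexFree.exists_eq {a b : G} (h : HexFree a b) {F : Finset (ℤ × ℤ)}
    (hF : ∀ d ∈ F, ∀ e ∈ F, hexNorm (d - e) ≤ 9) {B : Finset G} {v : G}
    (hB : ∀ d ∈ F, v + latticeMap a b d ∈ B) (hc : B.card ≤ F.card) {g : G} (hg : g ∈ B) :
    ∃ d ∈ F, g = v + latticeMap a b d := by
  have hinj : Set.InjOn (fun d => v + latticeMap a b d) (F : Set (ℤ × ℤ)) :=
    fun d hd e he hde => h.eq_of_latticeMap_eq (hF d hd e he) (add_left_cancel hde)
  have : F.image (fun d => v + latticeMap a b d) = B := by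
    refine Finset.eq_of_subset_of_card_le ?_ (by rw [Finset.card_image_of_injOn hinj]; exact hc)
    intro x hx
    obtain ⟨d, hd, rfl⟩ := Finset.mem_image.1 hx
    exact hB d hd
  rw [← this] at hg
  obtain ⟨d, hd, rfl⟩ := Finset.mem_image.1 hg
  exact ⟨d, hd, rfl⟩

/-- Inclusion-exclusion for `B + {0, a, b} = B ∪ (a + B) ∪ (b + B)`. -/
theorem card_add_triple (a b : G) (B : Finset G) :
    (B + {0, a, b}).card + (B ∩ (a +ᵥ B)).card + (B ∩ (b +ᵥ B)).card +
      ((a +ᵥ B) ∩ (b +ᵥ B)).card = 3 * B.card + (B ∩ (a +ᵥ B) ∩ (b +ᵥ B)).card := by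
  have hU : B + {0, a, b} = B ∪ (a +ᵥ B) ∪ (b +ᵥ B) := by
    rw [add_comm]
    ext z
    simp only [mem_insert_add_iff, mem_singleton_add_iff, Finset.mem_union, mem_vadd_finset_iff,
      sub_zero, or_assoc]
  have h1 := Finset.card_union_add_card_inter B (a +ᵥ B)
  have h2 := Finset.card_union_add_card_inter (B ∪ (a +ᵥ B)) (b +ᵥ B)
  have h3 := Finset.card_union_add_card_inter (B ∩ (b +ᵥ B)) ((a +ᵥ B) ∩ (b +ᵥ B))
  rw [← Finset.union_inter_distrib_right] at h3
  have h4 : B ∩ (b +ᵥ B) ∩ ((a +ᵥ B) ∩ (b +ᵥ B)) = B ∩ (a +ᵥ B) ∩ (b +ᵥ B) := by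
    ext z; simp only [Finset.mem_inter]; tauto
  rw [h4] at h3
  rw [Finset.card_vadd_finset] at h1 h2
  rw [hU]
  omega

theorem card_inter_vadd_neg (x : G) (B : Finset G) :
    (B ∩ (-x +ᵥ B)).card = (B ∩ (x +ᵥ B)).card := by
  rw [← Finset.card_vadd_finset x (B ∩ (-x +ᵥ B)), Finset.vadd_finset_inter, vadd_vadd,
    add_neg_cancel, zero_vadd, Finset.inter_comm]

theorem card_vadd_inter_vadd (x y : G) (B : Finset G) :
    ((x +ᵥ B) ∩ (y +ᵥ B)).card = (B ∩ ((y - x) +ᵥ B)).card := by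
  rw [← Finset.card_vadd_finset x (B ∩ ((y - x) +ᵥ B)), Finset.vadd_finset_inter, vadd_vadd,
    add_sub_cancel]

/-- The number of ordered pairs in `B` whose difference is the image of a shortest lattice
vector. -/
theorem HexFree.card_adjacent {a b : G} (h : HexFree a b) (B : Finset G) :
    (B.offDiag.filter fun q => ∃ d ∈ hexUnits, q.1 - q.2 = latticeMap a b d).card =
      2 * ((B ∩ (a +ᵥ B)).card + (B ∩ (b +ᵥ B)).card + ((a +ᵥ B) ∩ (b +ᵥ B)).card) := by
  have hU : ∀ d ∈ hexUnits, ∀ e ∈ hexUnits, hexNorm (d - e) ≤ 9 := by decide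
  have hU0 : ∀ d ∈ hexUnits, hexNorm (d - 0) ≤ 9 ∧ d ≠ 0 := by decide
  have h1 : (B.offDiag.filter fun q => ∃ d ∈ hexUnits, q.1 - q.2 = latticeMap a b d) =
      hexUnits.biUnion fun d => B.offDiag.filter fun q => q.1 - q.2 = latticeMap a b d := by
    ext q
    simp only [Finset.mem_filter, Finset.mem_biUnion]
    tauto
  have h2 : ∀ d ∈ hexUnits, (B.offDiag.filter fun q => q.1 - q.2 = latticeMap a b d).card =
      (B ∩ (latticeMap a b d +ᵥ B)).card := by
    intro d hd
    refine Finset.card_bij' (fun q _ => q.1) (fun z _ => (z, z - latticeMap a b d)) ?_ ?_ ?_ ?_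
    · rintro ⟨y, z⟩ hq
      simp only [Finset.mem_filter, Finset.mem_offDiag, Finset.mem_inter, mem_vadd_finset_iff] at *
      rw [← hq.2, sub_sub_cancel]
      exact ⟨hq.1.1, hq.1.2.1⟩
    · intro z hz
      simp only [Finset.mem_filter, Finset.mem_offDiag, Finset.mem_inter, mem_vadd_finset_iff] at *
      refine ⟨⟨hz.1, hz.2, fun h0 => (hU0 d hd).2 ?_⟩, sub_sub_cancel _ _⟩
      refine h.eq_of_latticeMap_eq (hU0 d hd).1 ?_
      rw [sub_eq_self.1 h0.symm]; simp [latticeMap]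
    · rintro ⟨y, z⟩ hq
      simp only [Finset.mem_filter] at hq
      simp only [← hq.2, sub_sub_cancel]
    · intro z hz; rfl
  rw [h1, Finset.card_biUnion, Finset.sum_congr rfl h2]
  · have e1 : latticeMap a b (1, 0) = a := by simp [latticeMap]
    have e2 : latticeMap a b (-1, 0) = -a := by simp [latticeMap]
    have e3 : latticeMap a b (0, 1) = b := by simp [latticeMap]
    have e4 : latticeMap a b (0, -1) = -b := by simp [latticeMap]
    have e5 : latticeMap a b (-1, 1) = b - a := by simp [latticeMap]; abel
    have e6 : latticeMap a b (1, -1) = -(b - a) := by simp [latticeMap]; abel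
    unfold hexUnits
    rw [Finset.sum_insert (by decide), Finset.sum_insert (by decide),
      Finset.sum_insert (by decide), Finset.sum_insert (by decide), Finset.sum_insert (by decide),
      Finset.sum_singleton, e1, e2, e3, e4, e5, e6, card_inter_vadd_neg, card_inter_vadd_neg,
      card_inter_vadd_neg, card_vadd_inter_vadd]
    ring
  · intro d hd e he hde
    rw [Function.onFun, Finset.disjoint_left]
    intro q hq hq'
    exact hde (h.eq_of_latticeMap_eq (hU d hd e he)
      ((Finset.mem_filter.1 hq).2.symm.trans (Finset.mem_filter.1 hq').2))

/-- Four points in general position with respect to `a` and `b` have at least eight neighbours: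
at most one pair of them fails to be adjacent, so they form a rhombus, which contains a triangle
`z, z - a, z - b`; then inclusion-exclusion forces the remaining pair to be adjacent as well. -/
theorem HexFree.eight_le_card_add {a b : G} (h : HexFree a b) {B : Finset G} (hB : B.card = 4) :
    8 ≤ (B + {0, a, b}).card := by
  by_contra! hlt
  have hie := card_add_triple a b B
  set N := B.offDiag.filter fun q => ¬ ∃ d ∈ hexUnits, q.1 - q.2 = latticeMap a b d with hN
  have hadj := h.card_adjacent B
  have hNcard : N.card + 2 * (B ∩ (a +ᵥ B) ∩ (b +ᵥ B)).card ≤ 2 := by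
    have : (B.offDiag.filter fun q => ∃ d ∈ hexUnits, q.1 - q.2 = latticeMap a b d).card + N.card =
        B.offDiag.card := Finset.card_filter_add_card_filter_not _
    rw [Finset.offDiag_card, hB] at this
    omega
  have hneg : ∀ d ∈ hexUnits, -d ∈ hexUnits := by decide
  have hNsymm : ∀ y z, (y, z) ∈ N → (z, y) ∈ N := by
    intro y z hyz
    simp only [hN, Finset.mem_filter, Finset.mem_offDiag] at hyz ⊢
    refine ⟨⟨hyz.1.2.1, hyz.1.1, hyz.1.2.2.symm⟩, ?_⟩
    rintro ⟨d, hd, hd'⟩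
    refine hyz.2 ⟨-d, hneg d hd, ?_⟩
    rw [← zero_sub d, latticeMap_sub, ← hd']
    simp [latticeMap]
  -- `{u, v}` contains the only pair that may fail to be adjacent
  obtain ⟨u, hu, v, hv, huv, hNuv⟩ : ∃ u ∈ B, ∃ v ∈ B, u ≠ v ∧ N ⊆ {(u, v), (v, u)} := by
    rcases N.eq_empty_or_nonempty with h0 | ⟨⟨u, v⟩, huv⟩
    · obtain ⟨u, hu, v, hv, huv⟩ := Finset.one_lt_card.1 (show 1 < B.card by omega)
      exact ⟨u, hu, v, hv, huv, by simp [h0]⟩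
    · have hm := Finset.mem_offDiag.1 (Finset.mem_filter.1 huv).1
      refine ⟨u, hm.1, v, hm.2.1, hm.2.2, ?_⟩
      refine (Finset.eq_of_subset_of_card_le (s := {(u, v), (v, u)}) ?_ ?_).ge
      · intro q hq
        simp only [Finset.mem_insert, Finset.mem_singleton] at hq
        rcases hq with rfl | rfl
        exacts [huv, hNsymm _ _ huv]
      · rw [Finset.card_pair (by simp only [ne_eq, Prod.mk.injEq]; tauto)]
        omega
  have hadj' : ∀ y ∈ B, ∀ z ∈ B, y ≠ z → (y, z) ∉ N → ∃ d ∈ hexUnits,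
      y - z = latticeMap a b d := by
    intro y hy z hz hyz hmem
    by_contra hno
    exact hmem (Finset.mem_filter.2 ⟨Finset.mem_offDiag.2 ⟨hy, hz, hyz⟩, hno⟩)
  obtain ⟨p, q, hpq, hpq'⟩ := Finset.card_eq_two.1 (show ((B.erase u).erase v).card = 2 by
    rw [Finset.card_erase_of_mem (Finset.mem_erase.2 ⟨huv.symm, hv⟩),
      Finset.card_erase_of_mem hu]; omega)
  have hp : p ∈ (B.erase u).erase v := by rw [hpq']; simp
  have hq : q ∈ (B.erase u).erase v := by rw [hpq']; simp
  simp only [Finset.mem_erase] at hp hq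
  have hnot : ∀ y z, y ≠ u → y ≠ v → (z, y) ∉ N := by
    intro y z h1 h2 hyz
    have := hNuv hyz
    simp only [Finset.mem_insert, Finset.mem_singleton, Prod.mk.injEq] at this
    tauto
  obtain ⟨d₁, hd₁, e₁⟩ := hadj' q hq.2.2 p hp.2.2 hpq.symm (hnot _ _ hp.2.1 hp.1)
  obtain ⟨d₂, hd₂, e₂⟩ := hadj' u hu p hp.2.2 hp.2.1.symm (hnot _ _ hp.2.1 hp.1)
  obtain ⟨d₃, hd₃, e₃⟩ := hadj' v hv p hp.2.2 hp.1.symm (hnot _ _ hp.2.1 hp.1)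
  obtain ⟨d₄, hd₄, e₄⟩ := hadj' u hu q hq.2.2 hq.2.1.symm (hnot _ _ hq.2.1 hq.1)
  obtain ⟨d₅, hd₅, e₅⟩ := hadj' v hv q hq.2.2 hq.1.symm (hnot _ _ hq.2.1 hq.1)
  have hU3 : ∀ d ∈ hexUnits, ∀ e ∈ hexUnits, ∀ f ∈ hexUnits, hexNorm (d - e - f) ≤ 9 := by
    decide
  have h21 : d₂ - d₁ = d₄ := h.eq_of_latticeMap_eq (hU3 _ hd₂ _ hd₁ _ hd₄) (by
    rw [latticeMap_sub, ← e₁, ← e₂, ← e₄]; abel)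
  have h31 : d₃ - d₁ = d₅ := h.eq_of_latticeMap_eq (hU3 _ hd₃ _ hd₁ _ hd₅) (by
    rw [latticeMap_sub, ← e₁, ← e₃, ← e₅]; abel)
  have h23 : d₂ ≠ d₃ := by
    rintro rfl
    exact huv (sub_left_injective (e₂.trans e₃.symm))
  have key : ∀ d₁ ∈ hexUnits, ∀ d₂ ∈ hexUnits, ∀ d₃ ∈ hexUnits, d₂ - d₁ ∈ hexUnits →
      d₃ - d₁ ∈ hexUnits → d₂ ≠ d₃ → d₂ - d₃ ∉ hexUnits ∧
      ∃ z ∈ ({0, d₁, d₂, d₃} : Finset (ℤ × ℤ)), z - (1, 0) ∈ ({0, d₁, d₂, d₃} : Finset (ℤ × ℤ)) ∧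
        z - (0, 1) ∈ ({0, d₁, d₂, d₃} : Finset (ℤ × ℤ)) := by
    set_option synthInstance.maxSize 1000 in decide
  obtain ⟨hk, z, hz, hza, hzb⟩ := key d₁ hd₁ d₂ hd₂ d₃ hd₃ (h21 ▸ hd₄) (h31 ▸ hd₅) h23
  have hmem : ∀ d ∈ ({0, d₁, d₂, d₃} : Finset (ℤ × ℤ)), p + latticeMap a b d ∈ B := by
    intro d hd
    simp only [Finset.mem_insert, Finset.mem_singleton] at hd
    rcases hd with rfl | rfl | rfl | rfl
    · simpa [latticeMap] using hp.2.2
    · rw [← e₁, add_sub_cancel]; exact hq.2.2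
    · rw [← e₂, add_sub_cancel]; exact hu
    · rw [← e₃, add_sub_cancel]; exact hv
  have ht : 0 < (B ∩ (a +ᵥ B) ∩ (b +ᵥ B)).card := by
    refine Finset.card_pos.2 ⟨p + latticeMap a b z, ?_⟩
    simp only [Finset.mem_inter, mem_vadd_finset_iff]
    refine ⟨⟨hmem z hz, ?_⟩, ?_⟩
    · have := hmem _ hza
      rw [latticeMap_sub, show latticeMap a b (1, 0) = a by simp [latticeMap]] at this
      rwa [add_sub_assoc]
    · have := hmem _ hzb
      rw [latticeMap_sub, show latticeMap a b (0, 1) = b by simp [latticeMap]] at this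
      rwa [add_sub_assoc]
  have hN0 : N = ∅ := Finset.card_eq_zero.1 (by omega)
  obtain ⟨d₆, hd₆, e₆⟩ := hadj' u hu v hv huv (by simp [hN0])
  refine hk ?_
  rw [h.eq_of_latticeMap_eq (hU3 _ hd₂ _ hd₃ _ hd₆) (by
    rw [latticeMap_sub, ← e₂, ← e₃, ← e₆]; abel)]
  exact hd₆

end HexagonalSets

/-! ### Balanced six-point sets -/

section BalancedSets

variable {G : Type*} [AddCommGroup G]

/-- Every point of `B + {0, a, b}` has exactly two representations, expressed from the point of
view of the elements of `B`. -/
def HexBalanced (a b : G) (B : Finset G) : Prop :=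
  ∀ z ∈ B, (z - a ∈ B ↔ z - b ∉ B) ∧ (z + a ∈ B ↔ z + a - b ∉ B) ∧ (z + b ∈ B ↔ z + b - a ∉ B)

theorem HexBalanced.swap {a b : G} {B : Finset G} (h : HexBalanced a b B) : HexBalanced b a B :=
  fun z hz => ⟨iff_not_comm.1 (h z hz).1, (h z hz).2.2, (h z hz).2.1⟩

/-- The conditions of `HexBalanced` in lattice coordinates with origin `v`. -/
theorem HexBalanced.lattice {a b : G} {B : Finset G} (h : HexBalanced a b B) (v : G) (m n : ℤ)
    (hz : v + latticeMap a b (m, n) ∈ B) :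
    (v + latticeMap a b (m - 1, n) ∈ B ↔ v + latticeMap a b (m, n - 1) ∉ B) ∧
    (v + latticeMap a b (m + 1, n) ∈ B ↔ v + latticeMap a b (m + 1, n - 1) ∉ B) ∧
    (v + latticeMap a b (m, n + 1) ∈ B ↔ v + latticeMap a b (m - 1, n + 1) ∉ B) := by
  have := h _ hz
  simp only [latticeMap] at this ⊢
  rwa [show v + (m • a + n • b) - a = v + ((m - 1) • a + n • b) by module,
    show v + (m • a + n • b) - b = v + (m • a + (n - 1) • b) by module,
    show v + (m • a + n • b) + a - b = v + ((m + 1) • a + (n - 1) • b) by module,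
    show v + (m • a + n • b) + a = v + ((m + 1) • a + n • b) by module,
    show v + (m • a + n • b) + b - a = v + ((m - 1) • a + (n + 1) • b) by module,
    show v + (m • a + n • b) + b = v + (m • a + (n + 1) • b) by module] at this

theorem latticeMap_zero (a b : G) : latticeMap a b (0, 0) = 0 := by simp [latticeMap]

variable [DecidableEq G]

/-- A balanced set without a triangle `z, z + a, z + b` grows to seven points from the edge
`v, v + a`. -/
theorem HexBalanced.exists_triangle_of_mem_add {a b : G} {B : Finset G} (h : HexBalanced a b B)
    (hf : HexFree a b) (hB : B.card = 6) {v : G} (hv : v ∈ B) (hva : v + a ∈ B) :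
    ∃ z ∈ B, z + a ∈ B ∧ z + b ∈ B := by
  by_contra! hno
  have L := h.lattice v
  have T : ∀ m n : ℤ, v + latticeMap a b (m, n) ∈ B → v + latticeMap a b (m + 1, n) ∈ B →
      v + latticeMap a b (m, n + 1) ∉ B := by
    intro m n h1 h2 h3
    refine hno _ h1 ?_ ?_
    · convert h2 using 1; simp only [latticeMap]; module
    · convert h3 using 1; simp only [latticeMap]; module
  have m00 : v + latticeMap a b (0, 0) ∈ B := by rwa [latticeMap_zero, add_zero]
  have m10 : v + latticeMap a b (1, 0) ∈ B := by simpa [latticeMap] using hva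
  have l00 := L 0 0 m00
  have t00 := T 0 0 m00 m10
  have tm := T (-1) 0
  have l10 := L 1 0 m10
  have t10 := T 1 0 m10
  norm_num at l00 t00 tm l10 t10
  have mm1 : v + latticeMap a b (-1, 1) ∈ B := by by_contra h'; exact t00 (l00.2.2.2 h')
  have m0m : v + latticeMap a b (0, -1) ∈ B := by
    by_contra h'; exact tm (l00.1.2 h') m00 mm1
  have m11 : v + latticeMap a b (1, 1) ∈ B := l10.2.2.2 t00
  have m2m : v + latticeMap a b (2, -1) ∈ B := by
    by_contra h'; exact t10 (l10.2.1.2 h') m11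
  have lm1 := L _ _ mm1
  have tm1 := T (-2) 1
  norm_num at lm1 tm1
  have mm2 : v + latticeMap a b (-1, 2) ∈ B :=
    lm1.2.2.2 (tm1 (lm1.1.2 fun h' => tm h' m00 mm1) mm1)
  have := hf.card_le (F := {(0, 0), (1, 0), (-1, 1), (0, -1), (1, 1), (2, -1), (-1, 2)})
    (by decide) (B := B) (v := v) (by
      intro d hd
      simp only [Finset.mem_insert, Finset.mem_singleton] at hd
      rcases hd with rfl | rfl | rfl | rfl | rfl | rfl | rfl <;> assumption)
  have hc : (({(0, 0), (1, 0), (-1, 1), (0, -1), (1, 1), (2, -1), (-1, 2)} : Finset (ℤ × ℤ))).card =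
    7 := by decide
  omega

/-- A generating pair `a, b` with relations `N a = 0` and `M b ∈ ℤ a` bounds the order of the
group. -/
theorem le_mul_of_nsmul_eq {a b : G} (hgen : AddSubgroup.closure ({a, b} : Set G) = ⊤) {N M c m : ℕ}
    (hN : 0 < N) (hM : 0 < M) (ha : N • a = 0) (hb : M • b = c • a) (hm : LeCard G m) :
    m ≤ N * M := by
  set Z := (Finset.range N ×ˢ Finset.range M).image fun i : ℕ × ℕ => i.1 • a + i.2 • b with hZ
  have hmem : ∀ i j : ℕ, j < M → i • a + j • b ∈ Z := by
    intro i j hj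
    refine Finset.mem_image.2 ⟨(i % N, j), ?_, ?_⟩
    · simp [Nat.mod_lt _ hN, hj]
    · have : i • a = (i % N) • a := by
        conv_lhs => rw [← Nat.mod_add_div i N, add_nsmul, mul_nsmul, ha, nsmul_zero, add_zero]
      rw [this]
  have hall := forall_mem_of_add_mem (Z := Z) (D := {a, b}) ⟨_, hmem 0 0 hM⟩ hgen (by
    intro d hd z hz
    obtain ⟨⟨i, j⟩, hij, rfl⟩ := Finset.mem_image.1 hz
    simp only [Finset.mem_product, Finset.mem_range] at hij
    simp only [Set.mem_insert_iff, Set.mem_singleton_iff] at hd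
    rcases hd with rfl | rfl
    · have := hmem (i + 1) j hij.2
      rwa [add_nsmul, one_nsmul, add_right_comm] at this
    · rcases Nat.lt_or_ge (j + 1) M with h | h
      · have := hmem i (j + 1) h
        rwa [succ_nsmul, ← add_assoc] at this
      · have := hmem (i + c) 0 hM
        rw [add_nsmul, ← hb, show M = j + 1 by omega, zero_nsmul, add_zero] at this
        rwa [add_nsmul, one_nsmul, ← add_assoc] at this)
  refine (hm.le_card hall).trans (Finset.card_image_le.trans ?_)
  simp

/-- A balanced six-point set consists of a triangle and one further neighbour of each of its
vertices. The neighbours of these further points force relations between `a` and `b` that either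
are too short or bound the order of the group by `14`. -/
theorem HexBalanced.false_of_triangle {a b : G} {B : Finset G} (h : HexBalanced a b B)
    (hf : HexFree a b) (hB : B.card = 6) (hgen : AddSubgroup.closure ({a, b} : Set G) = ⊤)
    (hcard : LeCard G 15) {v : G} (hv : v ∈ B) (hva : v + a ∈ B) (hvb : v + b ∈ B)
    (hp : v - a ∈ B) : False := by
  have L := h.lattice v
  have m00 : v + latticeMap a b (0, 0) ∈ B := by rwa [latticeMap_zero, add_zero]
  have m10 : v + latticeMap a b (1, 0) ∈ B := by simpa [latticeMap] using hva
  have m01 : v + latticeMap a b (0, 1) ∈ B := by simpa [latticeMap] using hvb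
  have mm0 : v + latticeMap a b (-1, 0) ∈ B := by simpa [latticeMap, ← sub_eq_add_neg] using hp
  have l00 := L 0 0 m00
  have l10 := L 1 0 m10
  have l01 := L 0 1 m01
  have lm0 := L _ _ mm0
  norm_num at l00 l10 l01 lm0
  obtain ⟨q, hq, hqB⟩ : ∃ q : ℤ × ℤ, (q = (2, 0) ∨ q = (2, -1)) ∧ v + latticeMap a b q ∈ B := by
    by_cases hq : v + latticeMap a b (2, 0) ∈ B
    exacts [⟨_, Or.inl rfl, hq⟩, ⟨_, Or.inr rfl, by_contra fun h' => hq (l10.2.1.2 h')⟩]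
  obtain ⟨w, hw, hwB⟩ : ∃ w : ℤ × ℤ, (w = (0, 2) ∨ w = (-1, 2)) ∧ v + latticeMap a b w ∈ B := by
    by_cases hq : v + latticeMap a b (0, 2) ∈ B
    exacts [⟨_, Or.inl rfl, hq⟩, ⟨_, Or.inr rfl, by_contra fun h' => hq (l01.2.2.2 h')⟩]
  have hF : ∀ d ∈ ({(0, 0), (1, 0), (0, 1), (-1, 0), q, w} : Finset (ℤ × ℤ)),
      ∀ e ∈ ({(0, 0), (1, 0), (0, 1), (-1, 0), q, w} : Finset (ℤ × ℤ)), hexNorm (d - e) ≤ 9 := by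
    rcases hq with rfl | rfl <;> rcases hw with rfl | rfl <;> decide
  have hFB : ∀ d ∈ ({(0, 0), (1, 0), (0, 1), (-1, 0), q, w} : Finset (ℤ × ℤ)),
      v + latticeMap a b d ∈ B := by
    intro d hd
    simp only [Finset.mem_insert, Finset.mem_singleton] at hd
    rcases hd with rfl | rfl | rfl | rfl | rfl | rfl <;> assumption
  have hFc : B.card ≤ ({(0, 0), (1, 0), (0, 1), (-1, 0), q, w} : Finset (ℤ × ℤ)).card := by
    rw [hB]
    rcases hq with rfl | rfl <;> rcases hw with rfl | rfl <;> decide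
  have key : ∀ e : ℤ × ℤ, v + latticeMap a b e ∈ B →
      ∃ d ∈ ({(0, 0), (1, 0), (0, 1), (-1, 0), q, w} : Finset (ℤ × ℤ)),
        ((hexNorm (e - d) ≤ 9 → e = d) ∧ latticeMap a b (e - d) = 0) := by
    intro e he
    obtain ⟨d, hd, hde⟩ := hf.exists_eq hF hFB hFc he
    have hde' := add_left_cancel hde
    exact ⟨d, hd, fun hn => hf.eq_of_latticeMap_eq hn hde', by rw [latticeMap_sub, hde', sub_self]⟩
  -- the left neighbour of the triangle has a further neighbour, which is not a new point
  obtain ⟨d, hd, hd1, hd2⟩ := key (-2, 1) (by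
    by_contra h'; exact l00.2.2.1 m01 (lm0.2.2.2 h'))
  have r1 : (q = (2, 0) ∧ b = (4 : ℤ) • a) ∨ (q = (2, -1) ∧ (2 : ℤ) • b = (4 : ℤ) • a) := by
    simp only [Finset.mem_insert, Finset.mem_singleton] at hd
    rcases hd with rfl | rfl | rfl | rfl | rfl | rfl
    · exact absurd (hd1 (by decide)) (by decide)
    · exact absurd (hd1 (by decide)) (by decide)
    · exact absurd (hd1 (by decide)) (by decide)
    · exact absurd (hd1 (by decide)) (by decide)
    · rcases hq with rfl | rfl
      · refine Or.inl ⟨rfl, sub_eq_zero.1 (Eq.trans ?_ hd2)⟩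
        norm_num [latticeMap]; module
      · refine Or.inr ⟨rfl, sub_eq_zero.1 (Eq.trans ?_ hd2)⟩
        norm_num [latticeMap]; module
    · rcases hw with rfl | rfl <;> exact absurd (hd1 (by decide)) (by decide)
  have hfb : ∀ k : ℤ, k = 1 ∨ k = 2 ∨ k = 3 → k • b ≠ 0 := by
    intro k hk hkb
    have := hf (0, k) (by rcases hk with rfl | rfl | rfl <;> decide)
      (by simpa [latticeMap] using hkb)
    simp only [Prod.mk_eq_zero] at this
    omega
  have r2 : (q = (2, 0) ∧ (4 : ℤ) • a = 0) ∨ (q = (2, -1) ∧ b = (4 : ℤ) • a) ∨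
      (2 : ℤ) • a + (2 : ℤ) • b = 0 ∨ (q = (2, 0) ∧ (3 : ℤ) • a + b = 0) ∨
      a + (3 : ℤ) • b = 0 := by
    have hor : v + latticeMap a b (-2, 0) ∈ B ∨ v + latticeMap a b (-1, -1) ∈ B :=
      or_iff_not_imp_right.2 lm0.1.2
    rcases hor with he | he
    · obtain ⟨d, hd, hd1, hd2⟩ := key _ he
      simp only [Finset.mem_insert, Finset.mem_singleton] at hd
      rcases hd with rfl | rfl | rfl | rfl | rfl | rfl
      · exact absurd (hd1 (by decide)) (by decide)
      · exact absurd (hd1 (by decide)) (by decide)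
      · exact absurd (hd1 (by decide)) (by decide)
      · exact absurd (hd1 (by decide)) (by decide)
      · rcases hq with rfl | rfl
        · refine Or.inl ⟨rfl, neg_eq_zero.1 (Eq.trans ?_ hd2)⟩
          norm_num [latticeMap]
        · refine Or.inr (Or.inl ⟨rfl, sub_eq_zero.1 (Eq.trans ?_ hd2)⟩)
          norm_num [latticeMap]; module
      · rcases hw with rfl | rfl
        · refine Or.inr (Or.inr (Or.inl (neg_eq_zero.1 (Eq.trans ?_ hd2))))
          norm_num [latticeMap]; module
        · exact absurd (hd1 (by decide)) (by decide)
    · obtain ⟨d, hd, hd1, hd2⟩ := key _ he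
      simp only [Finset.mem_insert, Finset.mem_singleton] at hd
      rcases hd with rfl | rfl | rfl | rfl | rfl | rfl
      · exact absurd (hd1 (by decide)) (by decide)
      · exact absurd (hd1 (by decide)) (by decide)
      · exact absurd (hd1 (by decide)) (by decide)
      · exact absurd (hd1 (by decide)) (by decide)
      · rcases hq with rfl | rfl
        · refine Or.inr (Or.inr (Or.inr (Or.inl ⟨rfl, neg_eq_zero.1 (Eq.trans ?_ hd2)⟩)))
          norm_num [latticeMap]; module
        · exact absurd (hd1 (by decide)) (by decide)
      · rcases hw with rfl | rfl
        · refine Or.inr (Or.inr (Or.inr (Or.inr (neg_eq_zero.1 (Eq.trans ?_ hd2)))))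
          norm_num [latticeMap]; module
        · exact absurd (hd1 (by decide)) (by decide)
  -- any two of the relations force `b` to have order at most two, or bound the order of the group
  have bound : ∀ N : ℕ, 0 < N → N < 15 → b = (4 : ℤ) • a → N • a = 0 → False := by
    intro N h0 hN hb ha
    have := le_mul_of_nsmul_eq hgen h0 one_pos ha (c := 4) (by rw [hb]; module) hcard
    omega
  rcases r1 with ⟨rfl, hb⟩ | ⟨rfl, hb⟩
  · rcases r2 with ⟨-, h2⟩ | ⟨h2, -⟩ | h2 | ⟨-, h2⟩ | h2
    · exact hfb 1 (by omega) (by rw [hb, h2, smul_zero])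
    · exact absurd h2 (by decide)
    · refine bound 10 (by omega) (by omega) hb (Eq.trans ?_ h2)
      rw [hb]; module
    · refine bound 7 (by omega) (by omega) hb (Eq.trans ?_ h2)
      rw [hb]; module
    · refine bound 13 (by omega) (by omega) hb (Eq.trans ?_ h2)
      rw [hb]; module
  · rcases r2 with ⟨h2, -⟩ | ⟨-, h2⟩ | h2 | ⟨h2, -⟩ | h2
    · exact absurd h2 (by decide)
    · refine hfb 1 (by omega) (Eq.trans ?_ (sub_eq_zero.2 hb))
      rw [← h2]; module
    · have ha : 6 • a = 0 := Eq.trans (by rw [hb]; module) h2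
      have := le_mul_of_nsmul_eq hgen (by omega) (by omega) ha (M := 2) (c := 4)
        (by rw [← natCast_zsmul, Nat.cast_ofNat, hb]; module) hcard
      omega
    · exact absurd h2 (by decide)
    · have ha : a = -(3 : ℤ) • b := by rw [← sub_eq_zero, ← h2]; module
      have hb' : 14 • b = 0 := by
        rw [← sub_eq_zero, ha] at hb
        rw [← hb]; module
      have := le_mul_of_nsmul_eq (by rwa [Set.pair_comm]) (by omega) one_pos hb' (b := a) (c := 11)
        (by rw [← sub_eq_zero, ← neg_eq_zero, ← hb', ha]; module) hcard
      omega

theorem HexBalanced.false_of_card_eq_six {a b : G} {B : Finset G} (h : HexBalanced a b B)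
    (hf : HexFree a b) (hB : B.card = 6) (hgen : AddSubgroup.closure ({a, b} : Set G) = ⊤)
    (hcard : LeCard G 15) : False := by
  obtain ⟨v, hv, hva, hvb⟩ : ∃ z ∈ B, z + a ∈ B ∧ z + b ∈ B := by
    obtain ⟨v, hv⟩ := Finset.card_pos.1 (show 0 < B.card by omega)
    rcases or_iff_not_imp_right.2 (h v hv).1.2 with h1 | h1
    · exact h.exists_triangle_of_mem_add hf hB h1 (by rwa [sub_add_cancel])
    · obtain ⟨z, hz, h1, h2⟩ := h.swap.exists_triangle_of_mem_add hf.swap hB h1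
        (by rwa [sub_add_cancel])
      exact ⟨z, hz, h2, h1⟩
  rcases or_iff_not_imp_right.2 (h v hv).1.2 with h1 | h1
  · exact h.false_of_triangle hf hB hgen hcard hv hva hvb h1
  · exact h.swap.false_of_triangle hf.swap hB (by rwa [Set.pair_comm]) hcard hv hvb hva h1

end BalancedSets

/-! ### Three-element generating sets -/

section ThreeElementSets

variable {G : Type*} [AddCommGroup G]

theorem HexFree.zsmul_ne_zero {a b : G} (hf : HexFree a b) {x : G} (hx : x = a ∨ x = b ∨ x = b - a)
    {k : ℤ} (hk : k = 1 ∨ k = 2 ∨ k = 3) : k • x ≠ 0 := by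
  intro h
  rcases hx with rfl | rfl | rfl
  · have := hf (k, 0) (by rcases hk with rfl | rfl | rfl <;> decide) (by simpa [latticeMap] using h)
    simp only [Prod.mk_eq_zero] at this
    omega
  · have := hf (0, k) (by rcases hk with rfl | rfl | rfl <;> decide) (by simpa [latticeMap] using h)
    simp only [Prod.mk_eq_zero] at this
    omega
  · have := hf (-k, k) (by rcases hk with rfl | rfl | rfl <;> decide)
      (Eq.trans (by simp only [latticeMap]; module) h)
    simp only [Prod.mk_eq_zero] at this
    omega

variable [DecidableEq G]

theorem HexFree.card_triple {a b : G} (hf : HexFree a b) : ({0, a, b} : Finset G).card = 3 := by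
  have h1 := hf.zsmul_ne_zero (x := a) (by simp) (k := 1) (by simp)
  have h2 := hf.zsmul_ne_zero (x := b) (by simp) (k := 1) (by simp)
  have h3 := hf.zsmul_ne_zero (x := b - a) (by simp) (k := 1) (by simp)
  rw [one_zsmul] at h1 h2 h3
  exact Finset.card_eq_three.2 ⟨_, _, _, h1.symm, h2.symm, (sub_ne_zero.1 h3).symm, rfl⟩

/-- The six differences of distinct elements of `{0, a, b}` are distinct. -/
theorem HexFree.card_triple_inter_le_one {a b : G} (hf : HexFree a b) {x : G} (hx : x ≠ 0) :
    (({0, a, b} : Finset G) ∩ (x +ᵥ ({0, a, b} : Finset G))).card ≤ 1 := by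
  have hT : ∀ y ∈ ({0, a, b} : Finset G), ∃ d ∈ ({(0, 0), (1, 0), (0, 1)} : Finset (ℤ × ℤ)),
      y = latticeMap a b d := by
    intro y hy
    simp only [Finset.mem_insert, Finset.mem_singleton] at hy
    rcases hy with rfl | rfl | rfl
    · exact ⟨(0, 0), by decide, by simp [latticeMap]⟩
    · exact ⟨(1, 0), by decide, by simp [latticeMap]⟩
    · exact ⟨(0, 1), by decide, by simp [latticeMap]⟩
  refine Finset.card_le_one.2 fun y hy z hz => ?_
  rw [Finset.mem_inter, mem_vadd_finset_iff] at hy hz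
  obtain ⟨d₁, h₁, e₁⟩ := hT _ hy.1
  obtain ⟨d₂, h₂, e₂⟩ := hT _ hy.2
  obtain ⟨d₃, h₃, e₃⟩ := hT _ hz.1
  obtain ⟨d₄, h₄, e₄⟩ := hT _ hz.2
  have hN : ∀ d₁ ∈ ({(0, 0), (1, 0), (0, 1)} : Finset (ℤ × ℤ)),
      ∀ d₂ ∈ ({(0, 0), (1, 0), (0, 1)} : Finset (ℤ × ℤ)),
      ∀ d₃ ∈ ({(0, 0), (1, 0), (0, 1)} : Finset (ℤ × ℤ)),
      ∀ d₄ ∈ ({(0, 0), (1, 0), (0, 1)} : Finset (ℤ × ℤ)),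
      hexNorm (d₁ - d₂ - (d₃ - d₄)) ≤ 9 ∧ (d₁ - d₂ = d₃ - d₄ → d₁ = d₂ ∨ d₁ = d₃) := by decide
  obtain ⟨hn, hd⟩ := hN d₁ h₁ d₂ h₂ d₃ h₃ d₄ h₄
  have := hd (hf.eq_of_latticeMap_eq hn (by
    rw [latticeMap_sub, latticeMap_sub, ← e₁, ← e₂, ← e₃, ← e₄, sub_sub_cancel, sub_sub_cancel]))
  rcases this with rfl | rfl
  · exact absurd (sub_eq_self.1 (e₂.trans e₁.symm)) hx
  · exact e₁.trans e₃.symm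

theorem HexFree.subgroupBound {a b : G} (hf : HexFree a b)
    (hgen : AddSubgroup.closure ((({0, a, b} : Finset G) : Set G)) = ⊤) :
    SubgroupBound 2 ({0, a, b} : Finset G) := by
  intro H Y hY hY2 hH
  have h1 := two_mul_card_le_card_add (by simp) hgen hY hH
  obtain ⟨y, hy, hy0⟩ := Finset.exists_mem_ne hY2 (0 : G)
  have h2 := two_mul_card_le_of_mem (A := {0, a, b}) hY ((mem_iff_of_coe_eq hY).1 hy)
  have h3 := hf.card_triple_inter_le_one hy0
  rw [hf.card_triple] at h2
  omega

/-- Inclusion-exclusion for `B + {0, a, b}` when each of its points has at least two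
representations. -/
theorem card_add_triple_le {a b : G} {B : Finset G}
    (h : B + {0, a, b} ⊆ B ∩ (a +ᵥ B) ∪ B ∩ (b +ᵥ B) ∪ (a +ᵥ B) ∩ (b +ᵥ B)) :
    (B + {0, a, b}).card + 2 * (B ∩ (a +ᵥ B) ∩ (b +ᵥ B)).card ≤
      (B ∩ (a +ᵥ B)).card + (B ∩ (b +ᵥ B)).card + ((a +ᵥ B) ∩ (b +ᵥ B)).card := by
  have h1 := Finset.card_union_add_card_inter (B ∩ (a +ᵥ B)) (B ∩ (b +ᵥ B))
  have h2 := Finset.card_union_add_card_inter (B ∩ (a +ᵥ B) ∪ B ∩ (b +ᵥ B))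
    ((a +ᵥ B) ∩ (b +ᵥ B))
  rw [show B ∩ (a +ᵥ B) ∩ (B ∩ (b +ᵥ B)) = B ∩ (a +ᵥ B) ∩ (b +ᵥ B) by
    ext; simp only [Finset.mem_inter]; tauto] at h1
  rw [show (B ∩ (a +ᵥ B) ∪ B ∩ (b +ᵥ B)) ∩ ((a +ᵥ B) ∩ (b +ᵥ B)) = B ∩ (a +ᵥ B) ∩ (b +ᵥ B) by
    ext; simp only [Finset.mem_inter, Finset.mem_union]; tauto] at h2
  have h3 := Finset.card_le_card h
  omega

/-- A non-empty set with at most three elements has no period of order greater than three. -/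
theorem exists_zsmul_eq_zero_of_add_mem {G : Type*} [AddCommGroup G] {W : Finset G} {x : G}
    (hW : W.Nonempty) (hc : W.card ≤ 3) (h : ∀ z ∈ W, z + x ∈ W) :
    ∃ k : ℤ, (k = 1 ∨ k = 2 ∨ k = 3) ∧ k • x = 0 := by
  obtain ⟨z, hz⟩ := hW
  have hz' : ∀ i : ℕ, z + i • x ∈ W := by
    intro i
    induction i with
    | zero => simpa using hz
    | succ i ih => rw [succ_nsmul, ← add_assoc]; exact h _ ih
  obtain ⟨i, hi, j, hj, hij, he⟩ := Finset.exists_ne_map_eq_of_card_lt_of_maps_to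
    (s := Finset.range 4) (t := W) (by simp; omega) (f := fun i => z + i • x) (fun i _ => hz' i)
  have he' : i • x = j • x := add_left_cancel he
  simp only [Finset.mem_range] at hi hj
  have hz : ((i : ℤ) - j) • x = 0 := by
    rw [sub_zsmul, natCast_zsmul, natCast_zsmul, he', add_neg_cancel]
  rcases lt_or_gt_of_ne hij with hlt | hlt
  · exact ⟨(j : ℤ) - i, by omega, by rw [← neg_sub, neg_zsmul, hz, neg_zero]⟩
  · exact ⟨(i : ℤ) - j, by omega, hz⟩

/-- The `4`-atom of `{0, a, b}`, if its boundary has three elements, would have four or six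
elements; neither is possible without a short relation. -/
theorem HexFree.add_lt_card_add {a b : G} (hf : HexFree a b)
    (hgen : AddSubgroup.closure ((({0, a, b} : Finset G) : Set G)) = ⊤) {X : Finset G}
    (hX : IsSep 4 0 {0, a, b} X) : X.card + 3 < (X + {0, a, b}).card := by
  by_contra! hle
  set T : Finset G := {0, a, b} with hT
  have hTc : T.card = 3 := hf.card_triple
  have h0T : (0 : G) ∈ T := by simp [hT]
  have haT : a ∈ T := by simp [hT]
  have hbT : b ∈ T := by simp [hT]
  obtain ⟨κ, hκ, B, hB⟩ := exists_isAtomOf ⟨0, h0T⟩ hX hle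
  rcases hκ.lt_or_eq with hκ' | rfl
  · have hroom := hB.sep.room
    have h4 := hB.sep.le_card
    obtain ⟨r, hr, hrc⟩ := exists_pair_of_two_connectivity_lt h0T hgen (by omega)
      (show 2 + 1 ≤ T.card by omega) (hf.subgroupBound hgen)
      (⟨by omega, hroom.mono (by omega), hB.sep.periodic⟩ : IsSep 2 0 T B)
      (by have := hB.card_add; omega)
    have hr0 : r ≠ 0 := by
      rintro rfl
      have ha : a ∈ AddSubgroup.closure ({0} : Set G) := by rw [hr]; trivial
      rw [AddSubgroup.closure_singleton_zero, AddSubgroup.mem_bot] at ha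
      exact hf.zsmul_ne_zero (x := a) (by simp) (k := 1) (by simp) (by simp [ha])
    have h1 : (T ∩ (r +ᵥ T)).card ≤ 1 := hf.card_triple_inter_le_one hr0
    have h2 := Finset.card_union_add_card_inter T (r +ᵥ T)
    rw [← pair_add_eq_union, Finset.card_vadd_finset] at h2
    omega
  have hBT := hB.card_add
  have h4 := hB.sep.le_card
  have h5 : 5 ≤ B.card := by
    by_contra! hlt
    have : 8 ≤ (B + T).card := hf.eight_le_card_add (by omega)
    omega
  -- by minimality of `B`, every point of `B + T` has two representations
  have hrep : ∀ v ∈ B, ∀ d ∈ T, ∃ d' ∈ T, d' ≠ d ∧ v + d - d' ∈ B := by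
    intro v hv d hd
    by_contra! hno
    have hsub : B.erase v + T ⊆ (B + T).erase (v + d) := by
      intro z hz
      obtain ⟨w, hw, d', hd', rfl⟩ := Finset.mem_add.1 hz
      rw [Finset.mem_erase] at hw
      refine Finset.mem_erase.2 ⟨fun he => ?_, Finset.add_mem_add hw.2 hd'⟩
      refine hno d' hd' ?_ (by rw [← he, add_sub_cancel_right]; exact hw.2)
      rintro rfl
      exact hw.1 (add_right_cancel he)
    have hc1 := Finset.card_le_card hsub
    rw [Finset.card_erase_of_mem (Finset.add_mem_add hv hd)] at hc1
    have hc2 := Finset.card_erase_of_mem hv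
    have hsep : IsSep 4 0 T (B.erase v) := ⟨by omega, hB.sep.room.mono (by omega), zero_vadd _ _⟩
    have h1 := hB.le_of_sep _ hsep
    have h2 := hB.card_le _ hsep (by omega)
    omega
  have hinter : ∀ x, (x = a ∨ x = b ∨ x = b - a) → (B ∩ (x +ᵥ B)).card ≤ 3 := by
    intro x hx
    by_contra! hlt
    have hper := hB.vadd_eq_of_le_card_inter hlt
    have hper' : x +ᵥ (B + T) = B + T := by rw [← vadd_add_assoc, hper]
    have hiff : ∀ C : Finset G, x +ᵥ C = C → ∀ {z}, z + x ∈ C ↔ z ∈ C := by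
      intro C hC z
      conv_lhs => rw [← hC, mem_vadd_finset_iff, add_sub_cancel_right]
    have hBsub : B ⊆ B + T := fun y hy => by simpa using Finset.add_mem_add hy h0T
    have hWc : ((B + T) \ B).card = 3 := by
      rw [Finset.card_sdiff_of_subset hBsub]; omega
    obtain ⟨k, hk, hkx⟩ := exists_zsmul_eq_zero_of_add_mem (W := (B + T) \ B) (x := x)
      (Finset.card_pos.1 (by omega)) hWc.le (by
        intro z hz
        rw [Finset.mem_sdiff] at hz ⊢
        rwa [hiff _ hper', hiff _ hper])
    exact hf.zsmul_ne_zero hx hk hkx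
  have hα := hinter a (by simp)
  have hβ := hinter b (by simp)
  have hγ := hinter (b - a) (by simp)
  rw [← card_vadd_inter_vadd] at hγ
  have hie := card_add_triple a b B
  rw [← hT] at hie
  have hie2 := card_add_triple_le (a := a) (b := b) (B := B) (by
    intro z hz
    obtain ⟨v, hv, d, hd, rfl⟩ := Finset.mem_add.1 hz
    obtain ⟨d', hd', hne, hmem⟩ := hrep v hv d hd
    have hv' : v + d - d ∈ B := by simpa using hv
    simp only [Finset.mem_union, Finset.mem_inter, mem_vadd_finset_iff]
    simp only [hT, Finset.mem_insert, Finset.mem_singleton] at hd hd'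
    rcases hd with rfl | rfl | rfl <;> rcases hd' with rfl | rfl | rfl <;>
      try simp only [sub_zero] at hmem hv' ⊢
    all_goals tauto)
  rw [← hT] at hie2
  have h6 : B.card = 6 := by omega
  have ht : (B ∩ (a +ᵥ B) ∩ (b +ᵥ B)).card = 0 := by omega
  have ht' : ∀ z ∈ B, z - a ∈ B → z - b ∉ B := by
    intro z hz hza hzb
    rw [Finset.card_eq_zero] at ht
    have : z ∈ B ∩ (a +ᵥ B) ∩ (b +ᵥ B) := by
      simp only [Finset.mem_inter, mem_vadd_finset_iff]; exact ⟨⟨hz, hza⟩, hzb⟩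
    simp [ht] at this
  have hbal : HexBalanced a b B := by
    intro z hz
    obtain ⟨d₁, hd₁, hn₁, hm₁⟩ := hrep z hz 0 h0T
    obtain ⟨d₂, hd₂, hn₂, hm₂⟩ := hrep z hz a haT
    obtain ⟨d₃, hd₃, hn₃, hm₃⟩ := hrep z hz b hbT
    simp only [hT, Finset.mem_insert, Finset.mem_singleton] at hd₁ hd₂ hd₃
    refine ⟨⟨ht' z hz, fun h => ?_⟩, ⟨fun h h' => ?_, fun h => ?_⟩, ⟨fun h h' => ?_, fun h => ?_⟩⟩
    · rcases hd₁ with rfl | rfl | rfl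
      · exact absurd rfl hn₁
      · simpa using hm₁
      · exact absurd (by simpa using hm₁) h
    · exact ht' _ h (by simpa using hz) h'
    · rcases hd₂ with rfl | rfl | rfl
      · simpa using hm₂
      · exact absurd rfl hn₂
      · exact absurd hm₂ h
    · exact ht' _ h h' (by simpa using hz)
    · rcases hd₃ with rfl | rfl | rfl
      · simpa using hm₃
      · exact absurd hm₃ h
      · exact absurd rfl hn₃
  have hgen' : AddSubgroup.closure ({a, b} : Set G) = ⊤ := by
    rw [← hgen, hT]
    simp
  refine hbal.false_of_card_eq_six hf h6 hgen' ?_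
  exact (hB.leCard_add hB.sep hB.card_add).mono (by omega)

/-- A three-element generating set with a `4`-separating set `X` such that `|X + T| ≤ |X| + 3`, or
with a four-element set `B` such that `|B + T| ≤ 7`, is a progression of length three or a
progression of length four with an inner term deleted. -/
theorem exists_progression_of_card_eq_three {T : Finset G} (h0 : (0 : G) ∈ T) (hc : T.card = 3)
    (hgen : AddSubgroup.closure (T : Set G) = ⊤)
    (hord : ∀ x ∈ T, ∀ y ∈ T, x ≠ y → (2 : ℤ) • (y - x) ≠ 0 ∧ (3 : ℤ) • (y - x) ≠ 0)
    (h : (∃ X, IsSep 4 0 T X ∧ (X + T).card ≤ X.card + 3) ∨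
      ∃ B : Finset G, B.card = 4 ∧ (B + T).card ≤ 7) :
    ∃ t r : G, T = {t, t + r, t + r + r} ∨ T = {t, t + r, t + r + r + r} := by
  obtain ⟨a, b, hab, hT⟩ := Finset.card_eq_two.1 (show (T.erase 0).card = 2 by
    rw [Finset.card_erase_of_mem h0]; omega)
  have hTe : T = {0, a, b} := by rw [← Finset.insert_erase h0, hT]
  have ha : a ∈ T.erase 0 := by simp [hT]
  have hb : b ∈ T.erase 0 := by simp [hT]
  rw [Finset.mem_erase] at ha hb
  obtain ⟨a2, a3⟩ := hord 0 h0 a ha.2 ha.1.symm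
  obtain ⟨b2, b3⟩ := hord 0 h0 b hb.2 hb.1.symm
  obtain ⟨ab2, ab3⟩ := hord a ha.2 b hb.2 hab
  rw [sub_zero] at a2 a3 b2 b3
  rw [hTe] at hgen h ⊢
  refine exists_progression_of_not_hexFree ha.1 hb.1 hab a2 b2 ab2 a3 b3 ab3 fun hf => ?_
  rcases h with ⟨X, hX, hXc⟩ | ⟨B, hB, hBc⟩
  · have := hf.add_lt_card_add hgen hX
    omega
  · have := hf.eight_le_card_add hB
    omega

end ThreeElementSets

/-! ### Sets with a small sum with a short progression -/

section Progressions

variable {G : Type*} [AddCommGroup G] [DecidableEq G]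

theorem mem_triple_add_iff {r w z : G} {S : Finset G} :
    z ∈ ({0, r, w} : Finset G) + S ↔ z ∈ S ∨ z - r ∈ S ∨ z - w ∈ S := by
  rw [mem_insert_add_iff, mem_insert_add_iff, mem_singleton_add_iff, sub_zero]

/-- For `j = 1` the progression is prolonged by one term, which is then deleted. -/
theorem isNearProgression_of_card_rightEnds_le_one {r : G} {S : Finset G} (hS : S.Nonempty)
    (hr : AddSubgroup.closure {r} = ⊤) (hne : ∃ g, g ∉ S) (hE : (rightEnds r S).card ≤ 1) {j : ℕ}
    (hj : j ≤ 1) : IsNearProgression r j S := by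
  obtain ⟨a, n, hSn, hn⟩ := exists_eq_image_of_card_rightEnds_le_one hS hr hne hE
  rcases Nat.le_one_iff_eq_zero_or_eq_one.1 hj with rfl | rfl
  · exact ⟨S, ∅, ⟨a, n, hSn⟩, by simp, rfl, by simp⟩
  · refine ⟨insert (a + (n + 1) • r) S, {a + (n + 1) • r}, ⟨a, n + 1, ?_⟩, by simp, by simp, ?_⟩
    · rw [Finset.range_add_one, Finset.image_insert, ← hSn]
    · rw [Finset.insert_sdiff_of_mem _ (Finset.mem_singleton_self _),
        Finset.sdiff_singleton_eq_erase, Finset.erase_eq_of_notMem hn]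

/-- If `S` has two right ends and one of the two gaps consists of a single element, then filling
this gap makes `S` a progression. -/
theorem isNearProgression_of_rightEnds_subset {r x₀ x₁ : G} {S : Finset G}
    (hr : AddSubgroup.closure {r} = ⊤) (hroom : LeCard G (S.card + 2))
    (hE : rightEnds r S ⊆ {x₀, x₁}) (hx₁ : x₁ ∈ rightEnds r S) (hgap : x₁ + r + r ∈ S) :
    IsNearProgression r 1 S := by
  obtain ⟨hx₁S, hx₁r⟩ := mem_rightEnds.1 hx₁
  have hends : (rightEnds r (insert (x₁ + r) S)).card ≤ 1 := by
    refine (Finset.card_le_card (t := {x₀}) ?_).trans (by simp)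
    intro x hx
    rw [mem_rightEnds, Finset.mem_insert, Finset.mem_insert] at hx
    push Not at hx
    rcases hx.1 with rfl | hxS
    · exact absurd hgap hx.2.2
    · have := hE (mem_rightEnds.2 ⟨hxS, hx.2.2⟩)
      rcases Finset.mem_insert.1 this with rfl | h
      · exact Finset.mem_singleton_self _
      · rw [Finset.mem_singleton.1 h] at hx
        exact absurd rfl hx.2.1
  obtain ⟨a, n, hP, -⟩ := exists_eq_image_of_card_rightEnds_le_one (Finset.insert_nonempty _ _) hr
    (LeCard.exists_notMem (hroom.mono (by rw [Finset.card_insert_of_notMem hx₁r]))) hends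
  refine ⟨_, {x₁ + r}, ⟨a, n, hP⟩, by simp, by simp, ?_⟩
  rw [Finset.insert_sdiff_of_mem _ (Finset.mem_singleton_self _),
    Finset.sdiff_singleton_eq_erase, Finset.erase_eq_of_notMem hx₁r]

/-- Of the two gaps of `S`, one has a single element, for otherwise `{0, r, 2r} + S` would have at
least two elements more than `{0, r} + S`. -/
theorem isNearProgression_of_card_three_term_add {r : G} {S : Finset G} (hS : S.Nonempty)
    (hr : AddSubgroup.closure {r} = ⊤) (hroom : LeCard G (S.card + 7))
    (h2 : 2 ≤ (rightEnds r S).card)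
    (hc : (({0, r, r + r} : Finset G) + S).card ≤ S.card + 3) : IsNearProgression r 1 S := by
  have hM := card_pair_add r S
  have hMsub : {0, r} + S ⊆ ({0, r, r + r} : Finset G) + S := by
    intro z hz
    rw [mem_pair_add_iff] at hz
    rw [mem_triple_add_iff]
    tauto
  -- a right end whose gap has more than one element contributes a new sum
  have hnew : ∀ x ∈ rightEnds r S, x + r + r ∉ S →
      x + r + r ∉ {0, r} + S ∧ x + r + r ∈ ({0, r, r + r} : Finset G) + S := by
    intro x hx hxS
    rw [mem_pair_add_iff, mem_triple_add_iff, add_sub_cancel_right, add_assoc,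
      add_sub_cancel_right, ← add_assoc]
    rw [mem_rightEnds] at hx
    tauto
  rcases h2.eq_or_lt with h2 | h3
  · obtain ⟨x₀, x₁, hne, hE⟩ := Finset.card_eq_two.1 h2.symm
    have m₀ : x₀ ∈ rightEnds r S := by simp [hE]
    have m₁ : x₁ ∈ rightEnds r S := by simp [hE]
    by_cases g₁ : x₁ + r + r ∈ S
    · exact isNearProgression_of_rightEnds_subset hr (hroom.mono (by omega)) hE.le m₁ g₁
    by_cases g₀ : x₀ + r + r ∈ S
    · exact isNearProgression_of_rightEnds_subset hr (hroom.mono (by omega))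
        (hE.le.trans (Finset.pair_comm _ _).le) m₀ g₀
    exfalso
    have n₀ := hnew _ m₀ g₀
    have n₁ := hnew _ m₁ g₁
    have hsub : insert (x₀ + r + r) (insert (x₁ + r + r) ({0, r} + S)) ⊆
        ({0, r, r + r} : Finset G) + S :=
      Finset.insert_subset n₀.2 (Finset.insert_subset n₁.2 hMsub)
    have := Finset.card_le_card hsub
    rw [Finset.card_insert_of_notMem, Finset.card_insert_of_notMem n₁.1] at this
    · omega
    · rw [Finset.mem_insert, not_or]
      exact ⟨fun h => hne (add_right_cancel (add_right_cancel h)), n₀.1⟩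
  · have hclosed : ∀ x ∈ rightEnds r S, x + r + r ∈ S := by
      intro x hx
      by_contra hxS
      have n := hnew x hx hxS
      have := Finset.card_le_card (Finset.insert_subset n.2 hMsub)
      rw [Finset.card_insert_of_notMem n.1] at this
      omega
    have hall := forall_mem_of_add_mem (Z := {0, r} + S) (D := {r})
      ((Finset.insert_nonempty _ _).add hS) hr (by
        intro d hd z hz
        rw [Set.mem_singleton_iff.1 hd]
        rw [mem_pair_add_iff] at hz ⊢
        rw [add_sub_cancel_right]
        by_cases hzS : z ∈ S
        · exact Or.inr hzS
        · have hz' := hz.resolve_left hzS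
          have := hclosed (z - r) (mem_rightEnds.2 ⟨hz', by rwa [sub_add_cancel]⟩)
          rw [sub_add_cancel] at this
          exact Or.inl this)
    have := hroom.le_card hall
    have := Finset.card_le_card hMsub
    omega

/-- Some gap of `S` has at least three elements, and it accounts for the only sum outside of
`{0, r} + S`; so there are two gaps, and the other one has a single element. -/
theorem isNearProgression_of_card_gapped_add {r : G} {S : Finset G} (hS : 3 ≤ S.card)
    (hr : AddSubgroup.closure {r} = ⊤) (hroom : LeCard G (S.card + 7))
    (h2 : 2 ≤ (rightEnds r S).card)
    (hc : (({0, r, r + r + r} : Finset G) + S).card ≤ S.card + 3) : IsNearProgression r 1 S := by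
  have hSne : S.Nonempty := Finset.card_pos.1 (by omega)
  have hM := card_pair_add r S
  have hMsub : {0, r} + S ⊆ ({0, r, r + r + r} : Finset G) + S := by
    intro z hz
    rw [mem_pair_add_iff] at hz
    rw [mem_triple_add_iff]
    tauto
  have hr0 : r ≠ 0 := by
    rintro rfl
    obtain ⟨x, hx⟩ := Finset.card_pos.1 (show 0 < (rightEnds 0 S).card by omega)
    rw [mem_rightEnds, add_zero] at hx
    exact hx.2 hx.1
  have hnew : ∀ z ∈ S, z + r + r ∉ S → z + r + r + r ∉ S →
      z + r + r + r ∈ (({0, r, r + r + r} : Finset G) + S) \ ({0, r} + S) := by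
    intro z hz h1 h2
    rw [Finset.mem_sdiff, mem_triple_add_iff, mem_pair_add_iff, add_sub_cancel_right,
      show z + r + r + r - (r + r + r) = z by abel]
    tauto
  have hdiff := Finset.card_sdiff_of_subset hMsub
  -- some gap has at least three elements
  obtain ⟨x₀, hx₀, h₀2, h₀3⟩ : ∃ x ∈ rightEnds r S, x + r + r ∉ S ∧ x + r + r + r ∉ S := by
    by_contra! hno
    have hsub : ({0, r} : Finset G) + ({0, r} + S) ⊆ ({0, r} + S) ∪
        (r +ᵥ (r +ᵥ rightEnds r S)) := by
      intro z hz
      simp only [mem_pair_add_iff, Finset.mem_union, mem_vadd_finset_iff, mem_rightEnds,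
        sub_add_cancel] at hz ⊢
      tauto
    have hcard := (Finset.card_le_card hsub).trans (Finset.card_union_le _ _)
    rw [Finset.card_vadd_finset, Finset.card_vadd_finset] at hcard
    have hall := forall_mem_of_add_mem (Z := ({0, r} : Finset G) + ({0, r} + S)) (D := {r})
      ((Finset.insert_nonempty _ _).add ((Finset.insert_nonempty _ _).add hSne)) hr (by
        intro d hd z hz
        rw [Set.mem_singleton_iff.1 hd]
        simp only [mem_pair_add_iff, add_sub_cancel_right] at hz ⊢
        by_cases hz1 : z ∈ S
        · tauto
        by_cases hz2 : z - r ∈ S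
        · tauto
        have hz3 : z - r - r ∈ S := by tauto
        have := hno (z - r - r) (mem_rightEnds.2 ⟨hz3, by rwa [sub_add_cancel]⟩)
        simp only [sub_add_cancel] at this
        tauto)
    have := hroom.le_card hall
    have := Finset.card_le_card hMsub
    omega
  obtain ⟨hx₀S, hx₀r⟩ := mem_rightEnds.1 hx₀
  have n₀ := hnew x₀ hx₀S h₀2 h₀3
  have hpos := Finset.card_pos.2 ⟨_, n₀⟩
  have huniq : ∀ y ∈ (({0, r, r + r + r} : Finset G) + S) \ ({0, r} + S),
      y = x₀ + r + r + r := fun y hy =>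
    Finset.card_le_one.1 (by omega) y hy _ n₀
  have huniq' : ∀ z ∈ S, z + r + r ∉ S → z + r + r + r ∉ S → z = x₀ := fun z hz h1 h2 =>
    add_right_cancel (add_right_cancel (add_right_cancel (huniq _ (hnew z hz h1 h2))))
  obtain ⟨x₁, hx₁, hne⟩ := Finset.exists_mem_ne (s := rightEnds r S) (by omega) x₀
  obtain ⟨hx₁S, hx₁r⟩ := mem_rightEnds.1 hx₁
  have hE : rightEnds r S = {x₀, x₁} := (Finset.eq_of_subset_of_card_le
    (Finset.insert_subset hx₀ (Finset.singleton_subset_iff.2 hx₁))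
    (by rw [Finset.card_pair hne.symm]; omega)).symm
  have hx₀' : x₀ - r ∉ S := by
    intro h
    have := huniq' (x₀ - r) h (by rwa [sub_add_cancel]) (by rwa [sub_add_cancel])
    exact hr0 (sub_eq_self.1 this)
  by_cases hgap : x₁ + r + r ∈ S
  · exact isNearProgression_of_rightEnds_subset hr (hroom.mono (by omega)) hE.le hx₁ hgap
  -- otherwise `x₁` has no predecessor in `S` either, and `S` consists of its two ends
  exfalso
  have hx₁' : x₁ - r ∉ S := by
    intro h
    have := huniq' (x₁ - r) h (by rwa [sub_add_cancel]) (by rwa [sub_add_cancel])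
    rw [← this, sub_add_cancel] at hx₀r
    exact hx₀r hx₁S
  have hrest : ∃ z, z ∈ S \ {x₀, x₁} := by
    refine Finset.card_pos.1 ?_
    have := Finset.le_card_sdiff {x₀, x₁} S
    rw [Finset.card_pair hne.symm] at this
    omega
  have hall := forall_mem_of_add_mem (Z := S \ {x₀, x₁}) (D := {r}) hrest hr (by
    intro d hd z hz
    rw [Set.mem_singleton_iff.1 hd]
    rw [Finset.mem_sdiff] at hz ⊢
    refine ⟨?_, ?_⟩
    · by_contra hzr
      exact hz.2 (hE ▸ mem_rightEnds.2 ⟨hz.1, hzr⟩)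
    · rw [Finset.mem_insert, Finset.mem_singleton]
      rintro (h | h)
      · exact hx₀' (by rw [← h, add_sub_cancel_right]; exact hz.1)
      · exact hx₁' (by rw [← h, add_sub_cancel_right]; exact hz.1))
  have := hall x₀
  simp at this

/-- If `T + S` is small for a three-term progression or a four-term progression with an inner term
deleted, then `S` is a progression with one term deleted. -/
theorem isNearProgression_of_card_add {T S : Finset G} {t r : G} (h0 : (0 : G) ∈ T)
    (hgen : AddSubgroup.closure (T : Set G) = ⊤)
    (hT : T = {t, t + r, t + r + r} ∨ T = {t, t + r, t + r + r + r}) (hS : 3 ≤ S.card)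
    (hroom : LeCard G (S.card + 7))
    (he : ∀ x : G, x ≠ 0 → S.card + 2 ≤ ({0, x} + S).card)
    (hc : (T + S).card ≤ S.card + 3) : IsNearProgression r 1 S := by
  have hr : AddSubgroup.closure {r} = ⊤ := by
    have hmem : ∀ x ∈ T, x - t ∈ AddSubgroup.closure ({r} : Set G) := by
      have hrm : r ∈ AddSubgroup.closure ({r} : Set G) :=
        AddSubgroup.subset_closure (Set.mem_singleton r)
      intro x hx
      rcases hT with rfl | rfl <;> simp only [Finset.mem_insert, Finset.mem_singleton] at hx <;>
        rcases hx with rfl | rfl | rfl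
      · rw [sub_self]; exact zero_mem _
      · rwa [add_sub_cancel_left]
      · rw [show t + r + r - t = r + r by abel]; exact add_mem hrm hrm
      · rw [sub_self]; exact zero_mem _
      · rwa [add_sub_cancel_left]
      · rw [show t + r + r + r - t = r + r + r by abel]; exact add_mem (add_mem hrm hrm) hrm
    refine addSubgroup_eq_top_of_closure hgen fun x hx => ?_
    have := sub_mem (hmem x hx) (hmem 0 h0)
    rwa [sub_sub_sub_cancel_right, sub_zero] at this
  have hr0 : r ≠ 0 := by
    rintro rfl
    have hall : ∀ g : G, g ∈ ({0} : Finset G) := by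
      intro g
      have hg : g ∈ AddSubgroup.closure ({0} : Set G) := by rw [hr]; trivial
      rw [AddSubgroup.closure_singleton_zero, AddSubgroup.mem_bot] at hg
      simp [hg]
    have := hroom.le_card hall
    simp at this
  have h2 : 2 ≤ (rightEnds r S).card := by
    have := he r hr0
    rw [card_pair_add] at this
    omega
  have hc' : ((-t +ᵥ T) + S).card ≤ S.card + 3 := by
    rwa [vadd_add_assoc, Finset.card_vadd_finset]
  rcases hT with rfl | rfl
  · refine isNearProgression_of_card_three_term_add (Finset.card_pos.1 (by omega)) hr hroom h2 ?_
    convert hc' using 3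
    simp only [Finset.vadd_finset_insert, Finset.vadd_finset_singleton, vadd_eq_add, neg_add_cancel,
      add_assoc, neg_add_cancel_left]
  · refine isNearProgression_of_card_gapped_add hS hr hroom h2 ?_
    convert hc' using 3
    simp only [Finset.vadd_finset_insert, Finset.vadd_finset_singleton, vadd_eq_add, neg_add_cancel,
      add_assoc, neg_add_cancel_left]

end Progressions

/-! ### Orders of differences -/

section Differences

variable {G : Type*} [AddCommGroup G] [DecidableEq G]

theorem coe_triple_eq_zmultiples {G : Type*} [AddCommGroup G] [DecidableEq G] {x : G}
    (h3 : (3 : ℤ) • x = 0) :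
    ((({0, x, x + x} : Finset G) : Set G)) = AddSubgroup.zmultiples x := by
  ext z
  simp only [Finset.coe_insert, Finset.coe_singleton, Set.mem_insert_iff, Set.mem_singleton_iff,
    SetLike.mem_coe, AddSubgroup.mem_zmultiples_iff]
  constructor
  · rintro (rfl | rfl | rfl)
    · exact ⟨0, by simp⟩
    · exact ⟨1, by simp⟩
    · exact ⟨2, by rw [two_zsmul]⟩
  · rintro ⟨n, rfl⟩
    have hn : n • x = (n % 3) • x := by
      conv_lhs => rw [← Int.emod_add_mul_ediv n 3, add_zsmul, mul_comm, mul_zsmul, h3, zsmul_zero,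
        add_zero]
    rw [hn]
    rcases (by omega : n % 3 = 0 ∨ n % 3 = 1 ∨ n % 3 = 2) with h | h | h <;> rw [h]
    · simp
    · simp
    · right; right; rw [two_zsmul]

theorem card_triple_of_three_zsmul {x : G} (hx : x ≠ 0) (h3 : (3 : ℤ) • x = 0) :
    ({0, x, x + x} : Finset G).card = 3 := by
  refine Finset.card_eq_three.2 ⟨_, _, _, hx.symm, fun h => hx ?_, fun h => hx ?_, rfl⟩
  · rw [← h3, show (3 : ℤ) • x = (x + x) + x by module, ← h, zero_add]
  · exact left_eq_add.1 h

theorem IsVosperSet.zmultiples_ne_top {S Y : Finset G} (h : IsVosperSet S) {x : G}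
    (hY : (Y : Set G) = AddSubgroup.zmultiples x) (hc : Y.card ≤ 3) :
    AddSubgroup.zmultiples x ≠ ⊤ := by
  intro htop
  have := h.room.le_card (Z := Y) (fun g => by rw [mem_iff_of_coe_eq hY, htop]; trivial)
  have := h.three_le
  omega

/-- A Vosper set has at least two right ends for every non-zero difference. -/
theorem IsVosperSet.add_two_le {S : Finset G} (h : IsVosperSet S) {x : G} (hx : x ≠ 0) :
    S.card + 2 ≤ ({0, x} + S).card := by
  have hc : ({0, x} : Finset G).card = 2 := Finset.card_pair hx.symm
  have h3 := h.three_le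
  have := h.card_add_le hc.ge (h.room.mono (by omega))
  omega

/-- The differences of a three-element Vosper set have order at least four. -/
theorem IsVosperSet.zsmul_sub_ne_zero {S : Finset G} (h : IsVosperSet S) (h3 : S.card = 3) {x y : G}
    (hx : x ∈ S) (hy : y ∈ S) (hxy : x ≠ y) : (2 : ℤ) • (y - x) ≠ 0 ∧ (3 : ℤ) • (y - x) ≠ 0 := by
  have hb : y - x ≠ 0 := sub_ne_zero.2 hxy.symm
  constructor
  · intro h2
    have hi : 0 < (S ∩ ((y - x) +ᵥ S)).card := Finset.card_pos.2 ⟨y, by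
      rw [Finset.mem_inter, mem_vadd_finset_iff, sub_sub_cancel]; exact ⟨hy, hx⟩⟩
    have hu := Finset.card_union_add_card_inter S ((y - x) +ᵥ S)
    rw [← pair_add_eq_union, Finset.card_vadd_finset] at hu
    exact h.two_nsmul_ne_zero hb (by omega) (by exact_mod_cast h2)
  · intro h2
    have hY := coe_triple_eq_zmultiples h2
    have hYc := card_triple_of_three_zsmul hb h2
    have h1 := h.subgroupBound _ _ hY (by omega) (h.zmultiples_ne_top hY hYc.le)
    -- `x` and `y` lie in the same coset, so `S` meets at most two cosets
    have hsub : {0, y - x, y - x + (y - x)} + S ⊆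
        {0, y - x, y - x + (y - x)} + S.erase y := by
      intro z hz
      obtain ⟨q, hq, s, hs, rfl⟩ := Finset.mem_add.1 hz
      by_cases hsy : s = y
      · refine Finset.mem_add.2 ⟨q + (y - x), ?_, x, Finset.mem_erase.2 ⟨hxy, hx⟩, ?_⟩
        · rw [mem_iff_of_coe_eq hY] at hq ⊢
          exact add_mem hq (AddSubgroup.mem_zmultiples _)
        · rw [hsy]; abel
      · exact Finset.add_mem_add hq (Finset.mem_erase.2 ⟨hsy, hs⟩)
    have h4 := (Finset.card_le_card hsub).trans Finset.card_add_le
    rw [hYc, Finset.card_erase_of_mem hy] at h4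
    omega

namespace IsThreeAtom

variable {S A : Finset G}

/-- An atom `A` with an element `b` of order two would have `A + S = {0, b} + S`, which would be
invariant under translation by `A`. -/
theorem two_zsmul_ne_zero (h : IsThreeAtom S A) {b : G} (hb : b ∈ A) (hb0 : b ≠ 0) :
    (2 : ℤ) • b ≠ 0 := by
  intro h2
  have h3 := h.card_eq_three
  have hAS := h.atom.card_add
  have hc : ¬ ({0, b} + S).card ≤ S.card + 2 := fun hc =>
    h.vosper.two_nsmul_ne_zero hb0 hc (by exact_mod_cast h2)
  have hsub : {0, b} + S ⊆ A + S := Finset.add_subset_add_right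
    (Finset.insert_subset h.zero_mem (Finset.singleton_subset_iff.2 hb))
  have heq := Finset.eq_of_subset_of_card_le hsub (by omega)
  have hbb : b + b = 0 := by rw [← two_zsmul, h2]
  -- `A + S` is invariant under translation by `b`, hence under translation by `A`
  have hall := forall_mem_of_add_mem (Z := A + S) (D := (A : Set G))
    (Finset.Nonempty.add ⟨0, h.zero_mem⟩ ⟨0, h.vosper.zero_mem⟩) h.closure (by
      intro d hd z hz
      rw [← heq, mem_pair_add_iff] at hz
      have hb' : ∀ w ∈ A + S, w + b ∈ A + S := by
        intro w hw
        rw [← heq, mem_pair_add_iff] at hw ⊢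
        rw [add_sub_cancel_right, show w + b = w - b + (b + b) by abel, hbb, add_zero]
        exact hw.symm
      rcases hz with hz | hz
      · rw [add_comm z d]; exact Finset.add_mem_add hd hz
      · have := hb' _ (Finset.add_mem_add hd hz)
        rwa [show d + (z - b) + b = z + d by abel] at this)
  have := h.vosper.room.le_card hall
  have := h.vosper.three_le
  omega

/-- If the atom contained an element `b` of order three, then `S` would consist of two points and
of full cosets of `{0, b, 2b}`, and the union of the full cosets would be invariant under
translation by the atom. -/
theorem three_zsmul_ne_zero (h : IsThreeAtom S A) (h4 : 4 ≤ S.card) {b : G} (hb : b ∈ A)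
    (hb0 : b ≠ 0) : (3 : ℤ) • b ≠ 0 := by
  intro h3
  have hA3 := h.card_eq_three
  have hAS := h.atom.card_add
  have hbbb : b + b + b = 0 := by rw [← h3]; module
  have hY := coe_triple_eq_zmultiples h3
  have hYc := card_triple_of_three_zsmul hb0 h3
  have hQ := h.vosper.subgroupBound _ _ hY (by omega) (h.vosper.zmultiples_ne_top hY hYc.le)
  set M := {0, b} + S with hM
  have hQM : ({0, b, b + b} : Finset G) + S = {0, b} + M := by
    ext z
    rw [mem_triple_add_iff, mem_pair_add_iff, hM, mem_pair_add_iff, mem_pair_add_iff, sub_sub]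
    tauto
  have hMc := card_pair_add b S
  have hMMc := card_pair_add b M
  have hRM := rightEnds_pair_add_subset b S
  rw [← hM] at hMc hRM
  have hRMc := Finset.card_le_card hRM
  rw [Finset.card_vadd_finset] at hRMc
  have hMsub : M ⊆ A + S := Finset.add_subset_add_right
    (Finset.insert_subset h.zero_mem (Finset.singleton_subset_iff.2 hb))
  have hMle := Finset.card_le_card hMsub
  rw [hQM] at hQ
  have hMper : ∀ z, z ∈ {0, b} + M ↔ z + b ∈ {0, b} + M := by
    intro z
    rw [← hQM, mem_triple_add_iff, mem_triple_add_iff, add_sub_cancel_right,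
      show z + b - (b + b) = z - b by abel, show z - (b + b) = z + b - (b + b + b) by abel, hbbb,
      sub_zero]
    tauto
  -- `A + S` is not contained in the union of the cosets that meet `S`
  obtain ⟨y, hy, hyQ⟩ : ∃ y ∈ A + S, y ∉ {0, b} + M := by
    by_contra! hno
    have hall := forall_mem_of_add_mem (Z := {0, b} + M) (D := (A : Set G))
      ((Finset.insert_nonempty _ _).add ((Finset.insert_nonempty _ _).add
        ⟨0, h.vosper.zero_mem⟩)) h.closure (by
        intro d hd z hz
        rw [← hQM, mem_triple_add_iff] at hz
        rcases hz with hz | hz | hz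
        · exact hno _ (by rw [add_comm z d]; exact Finset.add_mem_add hd hz)
        · have := (hMper _).1 (hno _ (Finset.add_mem_add hd hz))
          rwa [show d + (z - b) + b = z + d by abel] at this
        · have := (hMper _).1 ((hMper _).1 (hno _ (Finset.add_mem_add hd hz)))
          rwa [show d + (z - (b + b)) + b + b = z + d by abel] at this)
    have := h.vosper.room.le_card hall
    omega
  have hMMsub : M ⊆ {0, b} + M := fun z hz => mem_pair_add_iff.2 (Or.inl hz)
  have hyM : y ∉ M := fun hm => hyQ (hMMsub hm)
  have hins := Finset.card_le_card (Finset.insert_subset hy hMsub)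
  rw [Finset.card_insert_of_notMem hyM] at hins
  have hlow := h.vosper.add_two_le hb0
  rw [← hM] at hlow
  have heq := Finset.eq_of_subset_of_card_le (Finset.insert_subset hy hMsub)
    (by rw [Finset.card_insert_of_notMem hyM]; omega)
  have hRMeq := Finset.eq_of_subset_of_card_le hRM (by rw [Finset.card_vadd_finset]; omega)
  -- the cosets that are not contained in `S` meet `S` in a single element
  have hE : ∀ x ∈ S, x + b ∉ S → x + b + b ∉ M := by
    intro x hx hxb
    have : x + b ∈ rightEnds b M := by
      rw [hRMeq, mem_vadd_finset_iff, add_sub_cancel_right]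
      exact mem_rightEnds.2 ⟨hx, hxb⟩
    exact (mem_rightEnds.1 this).2
  set F := S.filter fun z => z + b ∈ S ∧ z + b + b ∈ S with hF
  have hmemF : ∀ z, z ∈ F ↔ z ∈ S ∧ z + b ∈ S ∧ z + b + b ∈ S := fun z => by
    rw [hF, Finset.mem_filter]
  have hcyc : ∀ z : G, z + b + b + b = z := fun z => by
    rw [show z + b + b + b = z + (b + b + b) by abel, hbbb, add_zero]
  have hFb : ∀ z ∈ F, z + b ∈ F := by
    intro z hz
    rw [hmemF] at hz ⊢
    rw [hcyc]
    exact ⟨hz.2.1, hz.2.2, hz.1⟩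
  have hfull : ∀ z, z ∈ M → z + b ∈ M → z + b + b ∈ M → z ∈ S := by
    intro z h0 h1 h2
    by_contra hz
    have hz2 : z + b + b ∈ S := by
      rw [hM, mem_pair_add_iff] at h0
      have := h0.resolve_left hz
      rwa [← hcyc (z - b), sub_add_cancel] at this
    have := hE _ hz2 (by rwa [hcyc])
    rw [hcyc] at this
    exact this h1
  have hFne : F.Nonempty := by
    have : S \ rightEnds b S ⊆ F := by
      intro z hz
      rw [Finset.mem_sdiff, mem_rightEnds, not_and, not_not] at hz
      have hzb := hz.2 hz.1
      refine (hmemF z).2 ⟨hz.1, hzb, ?_⟩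
      by_contra hz2
      refine hE _ hzb hz2 ?_
      rw [hcyc]
      exact mem_pair_add_iff.2 (Or.inl hz.1)
    have h1 := Finset.card_le_card this
    have h2 := Finset.le_card_sdiff (rightEnds b S) S
    exact Finset.card_pos.1 (by omega)
  have hFA : ∀ d ∈ A, ∀ z ∈ F, z + d ∈ M := by
    intro d hd z hz
    have hz' := (hmemF z).1 hz
    have h1 : z + d ∈ A + S := by rw [add_comm z d]; exact Finset.add_mem_add hd hz'.1
    rw [← heq, Finset.mem_insert] at h1
    refine h1.resolve_left fun hzy => ?_
    have h2 : z + d + b ∈ A + S := by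
      rw [show z + d + b = d + (z + b) by abel]; exact Finset.add_mem_add hd hz'.2.1
    rw [← heq, Finset.mem_insert] at h2
    rcases h2 with h2 | h2
    · exact hb0 (add_eq_left.1 (h2.trans hzy.symm))
    · exact hyQ (by rw [← hzy, hMper]; exact hMMsub h2)
  have hFd : ∀ d ∈ (A : Set G), ∀ z ∈ F, z + d ∈ F := by
    intro d hd z hz
    have m0 := hFA d hd z hz
    have m1 := hFA d hd _ (hFb z hz)
    have m2 := hFA d hd _ (hFb _ (hFb z hz))
    rw [add_right_comm] at m1
    rw [show z + b + b + d = z + d + b + b by abel] at m2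
    exact (hmemF _).2 ⟨hfull _ m0 m1 m2, hfull _ m1 m2 (by rwa [hcyc]),
      hfull _ m2 (by rwa [hcyc]) (by rwa [hcyc])⟩
  have hall := forall_mem_of_add_mem hFne h.closure hFd
  have := h.vosper.room.le_card fun g => ((hmemF g).1 (hall g)).1
  omega

theorem zsmul_sub_ne_zero (h : IsThreeAtom S A) (h4 : 4 ≤ S.card) {x y : G} (hx : x ∈ A)
    (hy : y ∈ A) (hxy : x ≠ y) : (2 : ℤ) • (y - x) ≠ 0 ∧ (3 : ℤ) • (y - x) ≠ 0 := by
  have hb : y - x ∈ -x +ᵥ A := by rw [mem_vadd_finset_iff]; simpa using hy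
  exact ⟨(h.vadd hx).two_zsmul_ne_zero hb (sub_ne_zero.2 hxy.symm),
    (h.vadd hx).three_zsmul_ne_zero h4 hb (sub_ne_zero.2 hxy.symm)⟩

end IsThreeAtom

end Differences

/-! ### Near progressions -/

section Conclusion

variable {G : Type*} [AddCommGroup G] [DecidableEq G]

/-- The case `κ₂(S) < |S|`, in which `S` is a progression. -/
theorem isNearProgression_of_two_connectivity_lt {S : Finset G} (h0 : (0 : G) ∈ S)
    (hgen : AddSubgroup.closure (S : Set G) = ⊤) (h3 : 3 ≤ S.card)
    (hcard : LeCard G (2 * S.card - 1)) (hκ : connectivity 2 S + 1 ≤ S.card)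
    (hnd : ¬ IsDegenerate S) {j : ℕ} (hj : j ≤ 1) : ∃ r : G, IsNearProgression r j S := by
  obtain ⟨r, hr, hrc⟩ := exists_pair_of_not_isDegenerate h0 hgen h3 hcard hκ hnd
  rw [card_pair_add] at hrc
  exact ⟨r, isNearProgression_of_card_rightEnds_le_one ⟨0, h0⟩ hr
    (LeCard.exists_notMem (hcard.mono (by omega))) (by omega) hj⟩

/-- The atom `A` of `S` has three elements, and `S` is a `4`-separating set for `A` with
`|S + A| ≤ |S| + 3`. -/
theorem IsVosperSet.exists_isNearProgression_of_four_le {S X : Finset G} (h : IsVosperSet S)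
    (h4 : 4 ≤ S.card) (hX : IsSep 3 0 S X) (hXc : (X + S).card ≤ X.card + S.card) :
    ∃ r : G, IsNearProgression r 1 S := by
  obtain ⟨κ, hκ, A₁, hA₁⟩ := exists_isAtomOf ⟨0, h.zero_mem⟩ hX hXc
  have hA₁3 := hA₁.sep.le_card
  have hκS : κ = S.card := by
    have := h.two_sep A₁ ⟨by omega, hA₁.sep.room.mono (by omega), zero_vadd _ _⟩
    have := hA₁.card_add
    omega
  subst hκS
  obtain ⟨a, ha⟩ := Finset.card_pos.1 (show 0 < A₁.card by omega)
  have hA : IsThreeAtom S (-a +ᵥ A₁) :=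
    ⟨h, hA₁.vadd _, by rw [mem_vadd_finset_iff]; simpa using ha⟩
  set A := -a +ᵥ A₁
  have hA3 := hA.card_eq_three
  have hAS := hA.atom.card_add
  have hSA : (S + A).card = S.card + 3 := by rw [add_comm, hAS, hA3, add_comm]
  have hroom : LeCard G (S.card + 7) := h.room.mono (by omega)
  obtain ⟨t, r, hT⟩ := exists_progression_of_card_eq_three hA.zero_mem hA3 hA.closure
    (fun x hx y hy hxy => hA.zsmul_sub_ne_zero h4 hx hy hxy)
    (Or.inl ⟨S, ⟨h4, by rw [hSA]; exact hroom, zero_vadd _ _⟩, hSA.le⟩)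
  exact ⟨r, isNearProgression_of_card_add hA.zero_mem hA.closure hT h.three_le hroom
    (fun x hx => h.add_two_le hx) (by omega)⟩

/-- If there is no `4`-separating set, then `G` has order ten, and a `3`-separating set or the
complement of its sum with `S` supplies a suitable set of four elements. -/
theorem IsVosperSet.exists_card_eq_four {S X : Finset G} (h : IsVosperSet S) (h3 : S.card = 3)
    (hX : IsSep 3 0 S X) (hXc : (X + S).card ≤ X.card + 3) (hconn : connectivity 4 S ≤ 3) :
    (∃ Y, IsSep 4 0 S Y ∧ (Y + S).card ≤ Y.card + 3) ∨
      ∃ B : Finset G, B.card = 4 ∧ (B + S).card ≤ 7 := by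
  by_cases hex : ∃ Y, IsSep 4 0 S Y
  · obtain ⟨Y, hY⟩ := hex
    obtain ⟨Z, hZ, hZc⟩ := exists_card_add_eq_connectivity h.zero_mem hY
    exact Or.inl ⟨Z, hZ, by omega⟩
  right
  obtain ⟨hfin, hcon⟩ := finite_and_connectivity_eq hex
  have := Fintype.ofFinite G
  have hroom := h.room
  rw [leCard_iff_of_finite] at hroom
  have hXroom := hX.room
  rw [leCard_iff_of_finite] at hXroom
  have hXS := h.two_sep X ⟨by have := hX.le_card; omega, hX.room.mono (by omega), zero_vadd _ _⟩
  have hX3 := hX.le_card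
  by_cases hX4 : X.card = 4
  · exact ⟨X, hX4, by omega⟩
  · refine ⟨-(X + S)ᶜ, ?_, ?_⟩
    · rw [Finset.card_neg, Finset.card_compl, ← Nat.card_eq_fintype_card]
      omega
    · refine (Finset.card_le_card (neg_compl_add_subset X S)).trans ?_
      rw [Finset.card_neg, Finset.card_compl, ← Nat.card_eq_fintype_card]
      omega

/-- The classification of three-element sets applied to `S` itself. -/
theorem IsVosperSet.exists_isNearProgression_of_card_eq_three {S : Finset G} (h : IsVosperSet S)
    (h3 : S.card = 3) (hB : (∃ Y, IsSep 4 0 S Y ∧ (Y + S).card ≤ Y.card + 3) ∨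
      ∃ B : Finset G, B.card = 4 ∧ (B + S).card ≤ 7) :
    ∃ r : G, IsNearProgression r 1 S := by
  have hord : ∀ x ∈ S, ∀ y ∈ S, x ≠ y → (2 : ℤ) • (y - x) ≠ 0 ∧ (3 : ℤ) • (y - x) ≠ 0 :=
    fun x hx y hy hxy => h.zsmul_sub_ne_zero h3 hx hy hxy
  obtain ⟨t, r, hT⟩ := exists_progression_of_card_eq_three h.zero_mem h3 h.closure hord hB
  have hr0 : r ≠ 0 := by
    rintro rfl
    rcases hT with rfl | rfl <;> simp at h3
  refine ⟨r, ?_⟩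
  rcases hT with hT | hT
  · -- a three-term progression is not a Vosper set
    exfalso
    have h1 := h.add_two_le hr0
    have hsub : {0, r} + S ⊆ insert (t + r + r + r) S := by
      intro z hz
      rw [mem_pair_add_iff] at hz
      rcases hz with hz | hz
      · exact Finset.mem_insert_of_mem hz
      · rw [hT, Finset.mem_insert, Finset.mem_insert, Finset.mem_singleton] at hz
        simp only [sub_eq_iff_eq_add] at hz
        rw [hT]
        simp only [Finset.mem_insert, Finset.mem_singleton]
        tauto
    have h2 := (Finset.card_le_card hsub).trans (Finset.card_insert_le _ _)
    omega
  · have h2 : r + r ≠ 0 := by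
      have := (hord t (by simp [hT]) (t + r) (by simp [hT]) (left_ne_add.2 hr0)).1
      rwa [add_sub_cancel_left, two_zsmul] at this
    have hnot : t + r + r ∉ S := by
      rw [hT]
      simp only [Finset.mem_insert, Finset.mem_singleton, not_or]
      refine ⟨?_, ?_, ?_⟩
      · rw [add_assoc]; exact fun h => h2 (add_eq_left.1 h)
      · exact fun h => hr0 (add_eq_left.1 h)
      · exact fun h => hr0 (left_eq_add.1 h)
    refine ⟨insert (t + r + r) S, {t + r + r}, ⟨t, 3, ?_⟩, by simp, by simp, ?_⟩
    · rw [hT]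
      simp only [Finset.range_add_one, Finset.range_zero, Finset.image_insert, Finset.image_empty]
      ext z
      simp only [Finset.mem_insert, Finset.mem_singleton, Finset.notMem_empty, zero_nsmul,
        succ_nsmul, add_zero, zero_add, ← add_assoc]
      tauto
    · rw [Finset.insert_sdiff_of_mem _ (Finset.mem_singleton_self _),
        Finset.sdiff_singleton_eq_erase, Finset.erase_eq_of_notMem hnot]

end Conclusion

theorem mainTheorem3 {G : Type*} [AddCommGroup G] [DecidableEq G] (μ : ℕ) (hμ : μ ≤ 1)
    (S : Finset G) (h0 : (0 : G) ∈ S)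
    (hgen : AddSubgroup.closure (S : Set G) = ⊤)
    (h3 : 3 ≤ S.card)
    (hcard : 2 * (S.card : ℕ∞) + 4 ≤ ENat.card G + 5 * (μ : ℕ∞))
    (hκ : connectivity (3 - μ) S ≤ S.card - μ)
    (hκ4 : S.card = 3 → μ = 0 → connectivity 4 S ≤ S.card)
    (hnd : ¬ IsDegenerate S) :
    ∃ r : G, IsNearProgression r (1 - μ) S := by
  have hroom : LeCard G (2 * S.card + 4 - 5 * μ) := by
    rcases finite_or_infinite G with hG | hG
    · rw [leCard_iff_of_finite]
      rw [ENat.card_eq_coe_natCard] at hcard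
      have : 2 * S.card + 4 ≤ Nat.card G + 5 * μ := by exact_mod_cast hcard
      omega
    · exact leCard_of_infinite _
  rcases Nat.le_one_iff_eq_zero_or_eq_one.1 hμ with rfl | rfl
  swap
  · exact isNearProgression_of_two_connectivity_lt h0 hgen h3 (hroom.mono (by omega))
      (by have : connectivity 2 S ≤ S.card - 1 := hκ
          omega) hnd (Nat.zero_le _)
  by_cases h2 : connectivity 2 S + 1 ≤ S.card
  · exact isNearProgression_of_two_connectivity_lt h0 hgen h3 (hroom.mono (by omega)) h2 hnd le_rfl
  have hκ' : connectivity 3 S ≤ S.card := hκ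
  obtain ⟨X, hX⟩ : ∃ X, IsSep 3 0 S X := by
    by_contra hno
    obtain ⟨hfin, hconn⟩ := finite_and_connectivity_eq hno
    rw [leCard_iff_of_finite] at hroom
    omega
  obtain ⟨Y, hY, hYc⟩ := exists_card_add_eq_connectivity h0 hX
  have hY2 := card_add_connectivity_le h0
    (⟨by have := hY.le_card; omega, hY.room.mono (by omega), zero_vadd _ _⟩ : IsSep 2 0 S Y)
  have hκ2 : connectivity 2 S = S.card := by omega
  have hV : IsVosperSet S :=
    { zero_mem := h0
      closure := hgen
      three_le := h3
      room := hroom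
      subgroupBound := by
        have := subgroupBound_of_not_isDegenerate h0 hgen hnd (hroom.mono (by omega))
        rwa [hκ2] at this
      two_sep := fun Z hZ => by
        have := card_add_connectivity_le h0 hZ
        rwa [hκ2] at this }
  rcases h3.eq_or_lt with h3' | h4
  · have hκ4' := hκ4 h3'.symm rfl
    exact hV.exists_isNearProgression_of_card_eq_three h3'.symm
      (hV.exists_card_eq_four h3'.symm hY (by omega) (by omega))
  · exact hV.exists_isNearProgression_of_four_le h4 hY (by omega)
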